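/- For $n\ge 1$, a (2-dimensional) hypertree on the vertex set $[n]=\{1,\dots,n\}$ is a simplicial complex $S$ on $[n]$, with all faces of dimension at most $2$, such that $S$ has complete $1$-skeleton, $S$ has exactly $\binom{n-1}{2}$ triangular faces, and $H_1(S,\mathbb{Z})$ is finite. The determinantal hypertree $T_n$ is the random hypertree on $[n]$ that equals a given hypertree $S$ with probability $$\frac{|H_1(S,\mathbb{Z})|^2}{n^{\binom{n-2}{2}}}.$$ (i) For every positive integer $h$ there is an $n_0=n_0(h)$ such that for all $n\ge n_0$, $$\mathbb{P}(\dim_{\mathbb{F}_2} H_1(T_n,\mathbb{F}_2)\ge h)\ge \frac{e^{-200h}}{(100h)^{5h}}.$$ (ii) For $p=2$, it is not true that for all integers $k\ge 0$ $$\lim_{n\to\infty}\mathbb{P}(\dim_{\mathbb{F}_p} H_1(T_n,\mathbb{F}_p)=k)=p^{-k^2}\prod_{j=1}^{k}(1-p^{-j})^{-2}\prod_{j=1}^{\infty}(1-p^{-j}).$$ (iii) For a prime $p$, let $\Gamma_{n,p}$ be the $p$-torsion (that is, the Sylow $p$-subgroup) of $H_1(T_n,\mathbb{Z})$. For $p=2$,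 it is not true that for every finite abelian $p$-group $G$ $$\lim_{n\to\infty}\mathbb{P}(\Gamma_{n,p}\cong G)=\frac{1}{|\mathrm{Aut}(G)|}\prod_{j=1}^{\infty}(1-p^{-j}).$$ In particular the conjecture of Kahle and Newman, that this holds for every prime $p$ and every finite abelian $p$-group $G$, is false. -/

import Mathlib

open Filter Topology

noncomputable section

namespace DetHypertree

/-- The `d`-dimensional faces of a simplicial complex on the vertex set `Fin n`. -/
abbrev Face {n : ℕ} (S : AbstractSimplicialComplex (Fin n)) (d : ℕ) : Type :=
  {σ : Finset (Fin n) // σ ∈ S.faces ∧ σ.card = d + 1}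

instance instFintypeFace {n : ℕ} (S : AbstractSimplicialComplex (Fin n)) (d : ℕ) :
    Fintype (Face S d) :=
  Fintype.ofFinite _

/-- The matrix of the simplicial boundary map from `(d + 1)`-chains to `d`-chains with
coefficients in `R`, every face being oriented by the order of its vertices: for
`σ = {x₀ < x₁ < ⋯}` the entry at `(σ \ {xᵢ}, σ)` is `(-1) ^ i`, all other entries vanish. -/
def boundaryMatrix (R : Type) [CommRing R] {n : ℕ} (S : AbstractSimplicialComplex (Fin n))
    (d : ℕ) : Matrix (Face S d) (Face S (d + 1)) R :=
  Matrix.of fun τ σ =>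
    ∑ x ∈ σ.1, if τ.1 = σ.1.erase x then (-1) ^ (σ.1.filter (· < x)).card else 0

/-- The simplicial boundary map `C_{d+1}(S, R) → C_d(S, R)`. -/
def boundary (R : Type) [CommRing R] {n : ℕ} (S : AbstractSimplicialComplex (Fin n)) (d : ℕ) :
    (Face S (d + 1) → R) →ₗ[R] (Face S d → R) :=
  (boundaryMatrix R S d).mulVecLin

/-- The first simplicial homology group `H_1(S, R)`: 1-cycles modulo boundaries of 2-chains. -/
abbrev H1 (R : Type) [CommRing R] {n : ℕ} (S : AbstractSimplicialComplex (Fin n)) : Type :=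
  ↥(LinearMap.ker (boundary R S 0)) ⧸
    (LinearMap.range (boundary R S 1)).submoduleOf (LinearMap.ker (boundary R S 0))

/-- Two-dimensional hypertrees on the vertex set `Fin n`. -/
structure IsHypertree {n : ℕ} (S : AbstractSimplicialComplex (Fin n)) : Prop where
  dim_le_two : ∀ σ ∈ S.faces, σ.card ≤ 3
  complete_skeleton : ∀ σ : Finset (Fin n), σ.card = 2 → σ ∈ S.faces
  card_triangles : Fintype.card (Face S 2) = (n - 1).choose 2
  finite_homology : Finite (H1 ℤ S)

/-- The set of two-dimensional hypertrees on the vertex set `Fin n`. -/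
abbrev Hypertree (n : ℕ) : Type := {S : AbstractSimplicialComplex (Fin n) // IsHypertree S}

instance instFiniteComplex (n : ℕ) : Finite (AbstractSimplicialComplex (Fin n)) :=
  Finite.of_injective (fun S => S.faces) fun _ _ h => AbstractSimplicialComplex.ext h

instance instFintypeHypertree (n : ℕ) : Fintype (Hypertree n) :=
  Fintype.ofFinite _

/-- The probability that the determinantal hypertree `T_n` equals `S`. -/
def weight {n : ℕ} (S : Hypertree n) : ℝ :=
  (Nat.card (H1 ℤ S.1) : ℝ) ^ 2 / (n : ℝ) ^ ((n - 2).choose 2)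

open Classical in
/-- The probability that the determinantal hypertree `T_n` satisfies `E`. -/
def prob (n : ℕ) (E : Hypertree n → Prop) : ℝ :=
  ∑ S : Hypertree n with E S, weight S

/-- `dim H_1(S, 𝔽_p)`. -/
def bettiOne (p : ℕ) [Fact p.Prime] {n : ℕ} (S : Hypertree n) : ℕ :=
  Module.finrank (ZMod p) (H1 (ZMod p) S.1)

/-- The `p`-torsion (`p`-primary part, i.e. Sylow `p`-subgroup) of `H_1(S, ℤ)`. -/
abbrev Torsion (p : ℕ) {n : ℕ} (S : Hypertree n) : Type :=
  AddCommGroup.primaryComponent (H1 ℤ S.1) p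

/-- `∏_{j ≥ 1} (1 - p ^ (-j))`. -/
def eulerProd (p : ℕ) : ℝ := ∏' j : ℕ, (1 - ((p : ℝ) ^ (j + 1))⁻¹)

/-- The rank distribution predicted for the prime `p`: for every `k`, the probability that
`dim H_1(T_n, 𝔽_p) = k` tends to
`p ^ (-k²) * ∏_{j=1}^{k} (1 - p ^ (-j)) ^ (-2) * ∏_{j ≥ 1} (1 - p ^ (-j))`. -/
def RankPrediction (p : ℕ) [Fact p.Prime] : Prop :=
  ∀ k : ℕ, Tendsto (fun n : ℕ => prob n fun S => bettiOne p S = k) atTop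
    (𝓝 (((p : ℝ) ^ (k ^ 2))⁻¹ *
      (∏ j ∈ Finset.Icc 1 k, ((1 - ((p : ℝ) ^ j)⁻¹) ^ 2)⁻¹) * eulerProd p))

/-- The conjecture of Kahle and Newman for the prime `p`: the `p`-torsion of `H_1(T_n, ℤ)`
converges to the Cohen-Lenstra distribution. -/
def KahleNewman (p : ℕ) : Prop :=
  ∀ (G : Type) [AddCommGroup G] [Finite G], IsPGroup p (Multiplicative G) →
    Tendsto (fun n : ℕ => prob n fun S => Nonempty (Torsion p S ≃+ G)) atTop
      (𝓝 ((Nat.card (G ≃+ G) : ℝ)⁻¹ * eulerProd p))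

end DetHypertree

end

noncomputable section

/-! Write n = v + 1. The edges at the vertex `0` form a spanning tree of the complete graph, so a
1-cycle is determined by its values on the remaining edges, and H_1(S, R) is the cokernel of the
columns of `colMat` = [1 | `triMat`] selected by the triangles of S (`homologyEquiv`). For an
integral square selection T, |H_1|² is the squared determinant `gramDet T`. By `cauchyBinet`, a sum
of weights over all T inside a given set U of columns is the single determinant of a Gram matrix.
This proves that the weights sum to 1 and computes the probabilities of the events below.

The excess of 2-torsion comes from Möbius bands. The five-vertex band has a core circle of five
edges, and each of its five triangles contains exactly two of them. If the triangles of T with an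
edge in the core are exactly the band's triangles (`Isolated`), then summing over the core edges mod
2 kills every boundary (`Isolated.sum_colVec`). Bands with disjoint cores give independent
functionals, so h of them force dim H_1(S, F_2) ≥ h (`le_bettiOne`).

For a separated family C with set A of core edges, the weight of "all bands of C are isolated" is
4^|C| · det(1 + L), where L is the Gram matrix of the triangles with no edge in A
(`sum_gramDet_isolated`); the 4 is the square of the determinant ±2 of a band. The Laplacian of the
complete complex is scalar, and this turns det(1 + L) into a quotient of determinants of matrices n
- K with K small. Gershgorin's theorem then shows that the probability is (4 / n⁵)^|C| up to a
factor exponential in |C| (`colProb_isolated_bounds`). There are of order (n / h)^(5h) ways to place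
h bands in prescribed disjoint blocks of vertices, and a second moment argument bounds from below
the probability that some placement is isolated (`le_colProb_exists_isolated`). Its logarithm is
-O(h log h).

The Cohen-Lenstra measure, by contrast, gives rank at least h a mass of at most 2^(-h(h-1)), which
is smaller for large h (`exists_inv_two_pow_lt`). The needed lower bounds for the mass of rank below
h come from counting m-tuples in (ℤ/2)^m and (ℤ/2^e)^m according to the subgroup they generate
(`le_sum_rank`, `exists_le_sum_inv_card_aut`). If the predicted limits held, finitely many of them
would already add up to more than the probability left for rank below h, contradicting
`sum_limit_le`. -/

namespace DetHypertree

/-! ### The Cauchy–Binet formula for Gram determinants. -/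

section CauchyBinet

variable {m n R : Type*} [Fintype m] [DecidableEq m] [Fintype n] [DecidableEq n] [CommRing R]

/-- The Gram matrix of the rows of `A` when only the columns in `T` are retained. -/
def maskedGram (A : Matrix m n R) (T : Finset n) : Matrix m m R :=
  A * Matrix.diagonal (fun t => if t ∈ T then (1 : R) else 0) * A.transpose

theorem maskedGram_apply (A : Matrix m n R) (T : Finset n) (i j : m) :
    maskedGram A T i j = ∑ t ∈ T, A i t * A j t := by
  simp [maskedGram, Matrix.mul_apply, Matrix.diagonal_apply, Finset.sum_ite_mem]

/-- Each row of the product is a linear combination of the rows of `B`; expand by multilinearity of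
the determinant in the rows. -/
theorem det_mul_eq_sum_functions (A : Matrix m n R) (B : Matrix n m R) :
    (A * B).det = ∑ f : m → n, (∏ i, A i (f i)) * (B.submatrix f id).det := by
  have h : (A * B) = fun i => ∑ k, A i k • B k := by
    ext i j
    simp [Matrix.mul_apply]
  calc (A * B).det = Matrix.detRowAlternating (fun i => ∑ k, A i k • B k) := by
        rw [h]; rfl
    _ = ∑ f : m → n, Matrix.detRowAlternating (fun i => A i (f i) • B (f i)) := by
        exact MultilinearMap.map_sum Matrix.detRowAlternating.toMultilinearMap _
    _ = _ := by
        refine Finset.sum_congr rfl fun f _ => ?_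
        exact MultilinearMap.map_smul_univ Matrix.detRowAlternating.toMultilinearMap _ _

/-- A non-injective `f` repeats a row, and an `f` that leaves `T` picks up a zero of the mask. -/
theorem det_maskedGram_eq_sum (A : Matrix m n R) (T : Finset n) :
    (maskedGram A T).det =
      ∑ f : m → n with Function.Injective f ∧ Finset.univ.image f ⊆ T,
        (∏ i, A i (f i)) * (A.transpose.submatrix f id).det := by
  rw [maskedGram, det_mul_eq_sum_functions, Finset.sum_filter]
  refine Finset.sum_congr rfl fun f _ => ?_
  by_cases hf : Function.Injective f
  · by_cases hT : Finset.univ.image f ⊆ T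
    · rw [if_pos ⟨hf, hT⟩]
      congr 1
      refine Finset.prod_congr rfl fun i _ => ?_
      have : f i ∈ T := hT (Finset.mem_image_of_mem f (Finset.mem_univ i))
      simp [Matrix.mul_diagonal, this]
    · rw [if_neg (fun h => hT h.2)]
      obtain ⟨i, hi⟩ : ∃ i, f i ∉ T := by
        by_contra! h
        exact hT (Finset.image_subset_iff.2 fun i _ => h i)
      rw [Finset.prod_eq_zero (Finset.mem_univ i) (by simp [Matrix.mul_diagonal, hi]), zero_mul]
  · rw [if_neg (fun h => hf h.1)]
    obtain ⟨i, j, hij, hne⟩ := Function.not_injective_iff.1 hf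
    rw [Matrix.det_zero_of_row_eq hne (by ext k; simp [hij]), mul_zero]

/-- The **Cauchy–Binet formula** for a Gram determinant. -/
theorem cauchyBinet (A : Matrix m n R) (U : Finset n) :
    (maskedGram A U).det = ∑ T ∈ U.powersetCard (Fintype.card m), (maskedGram A T).det := by
  -- When `T` has exactly as many elements as there are rows, an injective `f` into `T` has image
  -- `T`. So the terms for `T` are those of the expansion for `U` lying in the fibre over `T` of
  -- taking images.
  have hfib : ∀ T ∈ U.powersetCard (Fintype.card m), (maskedGram A T).det =
      ∑ f ∈ (Finset.univ.filter fun f : m → n =>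
          Function.Injective f ∧ Finset.univ.image f ⊆ U) with Finset.univ.image f = T,
        (∏ i, A i (f i)) * (A.transpose.submatrix f id).det := by
    intro T hT
    obtain ⟨hTU, hcard⟩ := Finset.mem_powersetCard.1 hT
    rw [det_maskedGram_eq_sum, Finset.filter_filter]
    refine Finset.sum_congr (Finset.filter_congr fun f _ => ?_) fun _ _ => rfl
    constructor
    · rintro ⟨hf, hs⟩
      refine ⟨⟨hf, hs.trans hTU⟩, Finset.eq_of_subset_of_card_le hs ?_⟩
      rw [Finset.card_image_of_injective _ hf, hcard, Finset.card_univ]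
    · rintro ⟨⟨hf, _⟩, rfl⟩
      exact ⟨hf, subset_rfl⟩
  rw [Finset.sum_congr rfl hfib, det_maskedGram_eq_sum]
  refine (Finset.sum_fiberwise_of_maps_to (fun f hf => ?_) _).symm
  obtain ⟨hf, hU⟩ := (Finset.mem_filter.1 hf).2
  exact Finset.mem_powersetCard.2
    ⟨hU, by rw [Finset.card_image_of_injective _ hf, Finset.card_univ]⟩

/-- When `T` has as many elements as `A` has rows, `maskedGram A T` is the Gram matrix of a square
matrix, any bijection of the rows with `T` being used to index the columns of the latter. -/
theorem det_maskedGram_of_equiv (A : Matrix m n R) (T : Finset n) (e : m ≃ T) :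
    (maskedGram A T).det = (Matrix.of fun i j => A i (e j)).det ^ 2 := by
  have : maskedGram A T =
      (Matrix.of fun i j => A i (e j)) * (Matrix.of fun i j => A i (e j)).transpose := by
    ext i j
    rw [maskedGram_apply, Matrix.mul_apply, ← Finset.sum_coe_sort, ← e.sum_comp]
    rfl
  rw [this, Matrix.det_mul, Matrix.det_transpose, sq]

theorem maskedGram_map {S : Type*} [CommRing S] (φ : R →+* S) (A : Matrix m n R) (T : Finset n) :
    maskedGram (A.map φ) T = (maskedGram A T).map φ := by
  ext i j
  simp [maskedGram_apply]

end CauchyBinet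

/-! ### Boundary matrices and Laplacians of the complete complex. -/

/-- The edges of the complete graph on `Fin v`, oriented by the order of the vertices. -/
abbrev Edge (v : ℕ) : Type := {p : Fin v × Fin v // p.1 < p.2}

/-- The triangles on the vertex set `Fin v`. -/
abbrev Tri (v : ℕ) : Type :=
  {p : Fin v × Fin v × Fin v // p.1 < p.2.1 ∧ p.2.1 < p.2.2}

/-- The coefficient of the pair `p` in the boundary of the triple `q`. -/
def coeff {α : Type*} [DecidableEq α] (R : Type*) [CommRing R] (p : α × α) (q : α × α × α) : R :=
  (if p = (q.2.1, q.2.2) then 1 else 0) - (if p = (q.1, q.2.2) then 1 else 0) +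
    (if p = (q.1, q.2.1) then 1 else 0)

/-- The boundary matrix from triangles to edges of the complete complex on `Fin v`. -/
def triMat (R : Type*) [CommRing R] (v : ℕ) : Matrix (Edge v) (Tri v) R :=
  Matrix.of fun e t => coeff R e.1 t.1

/-- The boundary matrix from edges to vertices of the complete complex on `Fin v`. -/
def incMat (R : Type*) [CommRing R] (v : ℕ) : Matrix (Fin v) (Edge v) R :=
  Matrix.of fun u e => (if u = e.1.2 then 1 else 0) - (if u = e.1.1 then 1 else 0)

section Identities

variable {R : Type*} [CommRing R] {v : ℕ}

theorem sum_edge (G : Fin v × Fin v → R) :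
    ∑ e : Edge v, G e.1 = ∑ x, ∑ y, if x < y then G (x, y) else 0 := by
  rw [← Fintype.sum_prod_type' (f := fun x y => if x < y then G (x, y) else 0),
    ← Finset.sum_filter]
  exact (Finset.sum_subtype _ (by simp) G).symm

theorem sum_tri (G : Fin v × Fin v × Fin v → R) :
    ∑ t : Tri v, G t.1 = ∑ x, ∑ y, ∑ z, if x < y ∧ y < z then G (x, y, z) else 0 := by
  have h : ∀ x : Fin v, ∑ y, ∑ z, (if x < y ∧ y < z then G (x, y, z) else 0) =
      ∑ q : Fin v × Fin v, if x < q.1 ∧ q.1 < q.2 then G (x, q) else 0 := fun x => by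
    rw [Fintype.sum_prod_type]
  simp_rw [h]
  rw [← Fintype.sum_prod_type'
    (f := fun x (q : Fin v × Fin v) => if x < q.1 ∧ q.1 < q.2 then G (x, q) else 0),
    ← Finset.sum_filter]
  exact (Finset.sum_subtype _ (by simp) G).symm

/-- The triangles containing an edge are indexed by their third vertex `w`, which may come first, in
the middle or last; the signs follow this position. -/
theorem sum_triMat_mul (e : Edge v) (G : Fin v × Fin v × Fin v → R) :
    ∑ t, triMat R v e t * G t.1 =
      ∑ w, ((if w < e.1.1 then G (w, e.1) else 0) -
        (if e.1.1 < w ∧ w < e.1.2 then G (e.1.1, w, e.1.2) else 0) +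
        (if e.1.2 < w then G (e.1.1, e.1.2, w) else 0)) := by
  obtain ⟨⟨a, b⟩, hab⟩ := e
  dsimp only at hab ⊢
  have h1 : ∀ x y z : Fin v, (if x < y ∧ y < z then coeff R (a, b) (x, y, z) * G (x, y, z) else 0) =
      (if y = a then if z = b then if x < a then G (x, a, b) else 0 else 0 else 0) -
      (if x = a then if z = b then if a < y ∧ y < b then G (a, y, b) else 0 else 0 else 0) +
      (if x = a then if y = b then if b < z then G (a, b, z) else 0 else 0 else 0) := by
    intro x y z
    simp only [coeff, Prod.mk.injEq]
    by_cases hya : y = a <;> by_cases hzb : z = b <;> by_cases hxa : x = a <;>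
      by_cases hyb : y = b <;> simp_all [eq_comm] <;> grind
  have h2 := sum_tri (v := v) (fun q => coeff R (a, b) q * G q)
  simp only [triMat, Matrix.of_apply]
  rw [h2]
  simp only [h1, Finset.sum_add_distrib, Finset.sum_sub_distrib]
  simp [Finset.sum_ite_eq', Finset.sum_comm, Finset.sum_ite_irrel]

/-- The Laplacian of the complete two-dimensional complex is scalar. -/
theorem triMat_mul_transpose_add :
    triMat R v * (triMat R v).transpose + (incMat R v).transpose * incMat R v =
      (v : R) • (1 : Matrix (Edge v) (Edge v) R) := by
  ext e e'
  rw [Matrix.add_apply, Matrix.mul_apply, Matrix.mul_apply]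
  have h1 := sum_triMat_mul e (coeff R e'.1)
  simp only [Matrix.transpose_apply]
  have h0 : ∀ t, triMat R v e' t = coeff R e'.1 t.1 := fun t => rfl
  simp only [h0]
  rw [h1]
  obtain ⟨⟨a, b⟩, hab⟩ := e
  obtain ⟨⟨c, d⟩, hcd⟩ := e'
  dsimp only at hab hcd ⊢
  set δ : R := if a = c ∧ b = d then 1 else 0 with hδ
  set α : R := (if d = a then 1 else 0) - (if d = b ∧ c ≠ a then 1 else 0) with hα
  set β : R := (if c = b then 1 else 0) - (if c = a ∧ d ≠ b then 1 else 0) with hβ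
  -- As a function of the third vertex, the summand is the constant `δ`, up to corrections at the
  -- end points of the two edges: `w = a` and `w = b` give no triangle, and only `w = c` or `w = d`
  -- can produce an off-diagonal contribution.
  have hS : ∀ w : Fin v, ((if w < a then coeff R (c, d) (w, a, b) else 0) -
        (if a < w ∧ w < b then coeff R (c, d) (a, w, b) else 0) +
        (if b < w then coeff R (c, d) (a, b, w) else 0)) =
      δ - (if w = a then δ else 0) - (if w = b then δ else 0) +
        (if w = c then α else 0) + (if w = d then β else 0) := by
    intro w
    simp only [coeff, Prod.mk.injEq, hδ, hα, hβ]
    rcases lt_trichotomy w a with h | h | h <;> rcases lt_trichotomy w b with h' | h' | h' <;>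
      grind
  have hB : ∑ w, incMat R v w ⟨(a, b), hab⟩ * incMat R v w ⟨(c, d), hcd⟩ =
      (if b = d then 1 else 0) - (if b = c then 1 else 0) - (if a = d then 1 else 0) +
        (if a = c then 1 else 0) := by
    simp only [incMat, Matrix.of_apply, sub_mul, mul_sub, Finset.sum_sub_distrib]
    simp
    grind
  simp only [hS, Finset.sum_add_distrib, Finset.sum_sub_distrib, hB]
  simp only [Finset.sum_ite_eq', Finset.mem_univ, if_true, Finset.sum_const, Finset.card_univ,
    Fintype.card_fin, Matrix.smul_apply, Matrix.one_apply, Subtype.mk.injEq, Prod.mk.injEq,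
    nsmul_eq_mul, smul_eq_mul, hδ, hα, hβ]
  grind

theorem sum_mul_triMat (G : Edge v → R) (t : Tri v) :
    ∑ e, G e * triMat R v e t =
      G ⟨(t.1.2.1, t.1.2.2), t.2.2⟩ - G ⟨(t.1.1, t.1.2.2), t.2.1.trans t.2.2⟩ +
        G ⟨(t.1.1, t.1.2.1), t.2.1⟩ := by
  have h : ∀ (p : Fin v × Fin v) (hp : p.1 < p.2), ∑ e : Edge v,
      G e * (if e.1 = p then 1 else 0) = G ⟨p, hp⟩ := by
    intro p hp
    rw [Finset.sum_eq_single ⟨p, hp⟩]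
    · simp
    · intro e _ he
      rw [if_neg (fun h => he (Subtype.ext h)), mul_zero]
    · simp
  simp only [triMat, Matrix.of_apply, coeff, mul_add, mul_sub, Finset.sum_add_distrib,
    Finset.sum_sub_distrib]
  rw [h _ t.2.2, h _ (t.2.1.trans t.2.2), h _ t.2.1]

theorem incMat_mul_triMat : incMat R v * triMat R v = 0 := by
  ext u t
  rw [Matrix.mul_apply, sum_mul_triMat]
  simp [incMat]

theorem incMat_mul_transpose :
    incMat R v * (incMat R v).transpose + Matrix.of (fun _ _ => 1) =
      (v : R) • (1 : Matrix (Fin v) (Fin v) R) := by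
  ext u w
  have hsum := sum_edge (v := v) (R := R) (fun p => ((if u = p.2 then 1 else 0) -
    (if u = p.1 then 1 else 0)) * ((if w = p.2 then 1 else 0) - (if w = p.1 then 1 else 0)))
  have hpt : ∀ x y : Fin v, (if x < y then (((if u = y then 1 else 0) -
      (if u = x then 1 else 0)) * ((if w = y then 1 else 0) - (if w = x then 1 else 0)) : R)
      else 0) = (if y = u then (if x < u ∧ u = w then 1 else 0) -
          (if x = w then (if w < u then 1 else 0) else 0) else 0) +
        (if x = u then (if u < y ∧ u = w then 1 else 0) -
          (if y = w then (if u < w then 1 else 0) else 0) else 0) := by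
    intro x y
    grind
  have hx : ∀ x : Fin v, (if x < u ∧ u = w then (1 : R) else 0) +
      (if u < x ∧ u = w then 1 else 0) = (if u = w then 1 else 0) -
        (if x = u then (if u = w then 1 else 0) else 0) := by
    intro x
    grind
  rw [Matrix.add_apply, Matrix.mul_apply]
  simp only [incMat, Matrix.of_apply, Matrix.transpose_apply]
  rw [hsum]
  simp only [hpt, Finset.sum_add_distrib]
  rw [Finset.sum_comm (f := fun x y => if x = u then _ else _)]
  simp only [Finset.sum_ite_eq', Finset.mem_univ, if_true, Finset.sum_sub_distrib]
  have hx' := Finset.sum_congr (rfl : (Finset.univ : Finset (Fin v)) = Finset.univ)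
    fun x _ => hx x
  rw [Finset.sum_add_distrib, Finset.sum_sub_distrib] at hx'
  simp only [Finset.sum_ite_eq', Finset.mem_univ, if_true, Finset.sum_const, Finset.card_univ,
    Fintype.card_fin, nsmul_eq_mul] at hx'
  simp only [Matrix.smul_apply, Matrix.one_apply, smul_eq_mul]
  have h3 : (if w < u then (1 : R) else 0) + (if u < w then 1 else 0) =
      1 - if u = w then 1 else 0 := by
    grind
  linear_combination hx' - h3

end Identities

/-! ### Gram determinants after removing the triangles that meet a set of edges. -/

section MaskedGram

variable {m n R : Type*} [Fintype m] [DecidableEq m] [Fintype n] [DecidableEq n] [CommRing R]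

theorem maskedGram_univ (A : Matrix m n R) : maskedGram A Finset.univ = A * A.transpose := by
  simp [maskedGram]

theorem maskedGram_add_compl (A : Matrix m n R) (T : Finset n) :
    maskedGram A T + maskedGram A Tᶜ = A * A.transpose := by
  ext i j
  rw [Matrix.add_apply, maskedGram_apply, maskedGram_apply, Finset.sum_add_sum_compl,
    Matrix.mul_apply]
  rfl

theorem maskedGram_transpose (A : Matrix m n R) (T : Finset n) :
    (maskedGram A T).transpose = maskedGram A T := by
  ext i j
  simp [maskedGram_apply, mul_comm]

end MaskedGram

/-- The triangles on `Fin (v + 1)`: those containing the vertex `0` correspond to the edges on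
`Fin v`, the others to the triangles on `Fin v`. -/
abbrev Col (v : ℕ) : Type := Edge v ⊕ Tri v

/-- The boundary matrix from the triangles on `Fin (v + 1)` to the edges avoiding the vertex `0`. -/
def colMat (R : Type*) [CommRing R] (v : ℕ) : Matrix (Edge v) (Col v) R :=
  Matrix.fromCols 1 (triMat R v)

@[simp]
theorem colMat_inl {R : Type*} [CommRing R] {v : ℕ} (e e' : Edge v) :
    colMat R v e (Sum.inl e') = if e = e' then 1 else 0 := by
  simp [colMat, Matrix.one_apply]

@[simp]
theorem colMat_inr {R : Type*} [CommRing R] {v : ℕ} (e : Edge v) (t : Tri v) :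
    colMat R v e (Sum.inr t) = triMat R v e t := by
  simp [colMat]

variable {v : ℕ}

/-- The triangles with an edge in `A`. -/
def star (A : Finset (Edge v)) : Finset (Tri v) :=
  Finset.univ.filter fun t => ∃ a ∈ A, triMat ℝ v a t ≠ 0

/-- The projection onto the edges outside `A`. -/
def offProj (A : Finset (Edge v)) : Matrix (Edge v) (Edge v) ℝ :=
  Matrix.diagonal fun e => if e ∈ A then 0 else 1

/-- The Gram matrix of the triangles with no edge in `A`. -/
def offGram (A : Finset (Edge v)) : Matrix (Edge v) (Edge v) ℝ :=
  maskedGram (triMat ℝ v) (star A)ᶜ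

/-- The Gram matrix of the triangles with an edge in `A`, restricted to the edges outside `A`. -/
def starGram (A : Finset (Edge v)) : Matrix (Edge v) (Edge v) ℝ :=
  offProj A * maskedGram (triMat ℝ v) (star A) * offProj A

theorem triMat_eq_zero_of_mem {A : Finset (Edge v)} {e : Edge v} (he : e ∈ A) {t : Tri v}
    (ht : t ∉ star A) : triMat ℝ v e t = 0 := by
  by_contra h
  exact ht (Finset.mem_filter.2 ⟨Finset.mem_univ _, e, he, h⟩)

theorem offProj_mul_offGram (A : Finset (Edge v)) : offProj A * offGram A = offGram A := by
  ext e e'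
  rw [offProj, Matrix.diagonal_mul]
  split_ifs with h
  · rw [zero_mul, offGram, maskedGram_apply, Finset.sum_eq_zero]
    intro t ht
    rw [triMat_eq_zero_of_mem h (Finset.mem_compl.1 ht), zero_mul]
  · rw [one_mul]

theorem offGram_mul_offProj (A : Finset (Edge v)) : offGram A * offProj A = offGram A := by
  have h := congrArg Matrix.transpose (offProj_mul_offGram A)
  rwa [Matrix.transpose_mul, offGram, maskedGram_transpose, offProj,
    Matrix.diagonal_transpose] at h

theorem offProj_mul_self (A : Finset (Edge v)) : offProj A * offProj A = offProj A := by
  rw [offProj, Matrix.diagonal_mul_diagonal]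
  congr 1
  ext e
  split_ifs <;> simp

theorem offGram_mul_incMat_transpose (A : Finset (Edge v)) :
    offGram A * (incMat ℝ v).transpose = 0 := by
  rw [offGram, maskedGram, Matrix.mul_assoc, ← Matrix.transpose_mul, incMat_mul_triMat,
    Matrix.transpose_zero, Matrix.mul_zero]

theorem maskedGram_incMat_compl (A : Finset (Edge v)) :
    maskedGram (incMat ℝ v) Aᶜ = (incMat ℝ v * offProj A) * (incMat ℝ v).transpose := by
  rw [maskedGram, offProj]
  congr 3
  ext e
  simp only [Finset.mem_compl]
  split_ifs <;> simp_all

/-- Since L P = L and L Bᵀ = 0, the product (1 + L)(1 + P Bᵀ B P) has no mixed term, and the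
Laplacian identity rewrites it as 1 + vP - PSP. Scaling the coordinates in `A` by v + 1 makes this a
scalar matrix minus `starGram A`, a perturbation whose size is governed by `A` alone. -/
theorem det_one_add_offGram_mul (A : Finset (Edge v)) :
    (((v : ℝ) + 1) • (1 : Matrix (Edge v) (Edge v) ℝ) - starGram A).det =
      ((v : ℝ) + 1) ^ A.card * ((1 + offGram A).det *
        (1 + maskedGram (incMat ℝ v) Aᶜ).det) := by
  set P := offProj A with hP
  set L := offGram A with hL
  set B := incMat ℝ v with hB
  set S := maskedGram (triMat ℝ v) (star A) with hS
  have hPP : P * P = P := offProj_mul_self A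
  have hdet : (1 + maskedGram B Aᶜ).det = (1 + P * B.transpose * (B * P)).det := by
    have h : maskedGram B Aᶜ = B * P * (P * B.transpose) := by
      rw [← Matrix.mul_assoc, Matrix.mul_assoc B P P, hPP]
      exact maskedGram_incMat_compl A
    rw [Matrix.det_one_add_mul_comm, h]
  have hLP : L * P = L := offGram_mul_offProj A
  have hPL : P * L = L := offProj_mul_offGram A
  have hLB : L * B.transpose = 0 := offGram_mul_incMat_transpose A
  have hlap : B.transpose * B = (v : ℝ) • (1 : Matrix (Edge v) (Edge v) ℝ) - S - L := by
    rw [← triMat_mul_transpose_add, ← maskedGram_add_compl (triMat ℝ v) (star A)]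
    simp only [hS, hL, hB, offGram]
    abel
  have hprod : (1 + L) * (1 + P * B.transpose * (B * P)) =
      1 + (v : ℝ) • P - P * S * P := by
    have h1 : L * (P * B.transpose * (B * P)) = 0 := by
      rw [← Matrix.mul_assoc, ← Matrix.mul_assoc L, hLP, hLB, Matrix.zero_mul]
    have h2 : P * B.transpose * (B * P) = (v : ℝ) • P - P * S * P - L := by
      rw [Matrix.mul_assoc, ← Matrix.mul_assoc B.transpose, hlap]
      simp only [Matrix.sub_mul, Matrix.mul_sub, Matrix.smul_mul, Matrix.mul_smul, Matrix.one_mul,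
        hPP, hLP, hPL, Matrix.mul_assoc]
    rw [Matrix.add_mul, Matrix.one_mul, Matrix.mul_add L, h1, h2, Matrix.mul_one]
    abel
  have hscale : (1 + (v : ℝ) • P - P * S * P) * (P + ((v : ℝ) + 1) • (1 - P)) =
      ((v : ℝ) + 1) • (1 : Matrix (Edge v) (Edge v) ℝ) - P * S * P := by
    have h3 : P * S * P * (1 - P) = 0 := by
      rw [Matrix.mul_sub, Matrix.mul_one, Matrix.mul_assoc (P * S), hPP, sub_self]
    have h4 : P * (1 - P) = 0 := by rw [Matrix.mul_sub, Matrix.mul_one, hPP, sub_self]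
    have h5 : P * S * P * P = P * S * P := by rw [Matrix.mul_assoc (P * S), hPP]
    rw [Matrix.mul_add, Matrix.mul_smul, Matrix.sub_mul, Matrix.sub_mul, Matrix.add_mul,
      Matrix.add_mul, h3, h5, Matrix.smul_mul, Matrix.smul_mul, h4, hPP, Matrix.one_mul,
      Matrix.one_mul]
    module
  have hdiag : (P + ((v : ℝ) + 1) • (1 - P)).det = ((v : ℝ) + 1) ^ A.card := by
    have : P + ((v : ℝ) + 1) • (1 - P) =
        Matrix.diagonal fun e => if e ∈ A then ((v : ℝ) + 1) else 1 := by
      ext e e'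
      by_cases h : e = e'
      · subst h
        by_cases he : e ∈ A <;> simp [hP, offProj, he]
      · simp [hP, offProj, h]
    rw [this, Matrix.det_diagonal, Finset.prod_ite_mem, Finset.univ_inter, Finset.prod_const]
  rw [hdet, starGram, ← hscale, ← hprod, Matrix.det_mul, Matrix.det_mul, hdiag]
  ring

/-- The same device one dimension lower: the all-ones matrix J satisfies Bᵀ J = 0 and the Laplacian
of the complete graph is v - J, so multiplying by 1 + J, of determinant v + 1, leaves only the Gram
matrix of the edges in `A`. -/
theorem det_one_add_incGram (A : Finset (Edge v)) :
    ((v : ℝ) + 1) * (1 + maskedGram (incMat ℝ v) Aᶜ).det =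
      (((v : ℝ) + 1) • (1 : Matrix (Fin v) (Fin v) ℝ) - maskedGram (incMat ℝ v) A).det := by
  set J : Matrix (Fin v) (Fin v) ℝ := Matrix.of (fun _ _ => 1) with hJ
  have hBJ : (incMat ℝ v).transpose * J = 0 := by
    ext e u
    simp [Matrix.mul_apply, hJ, incMat]
  have hprod : (1 + maskedGram (incMat ℝ v) Aᶜ) * (1 + J) =
      ((v : ℝ) + 1) • (1 : Matrix (Fin v) (Fin v) ℝ) - maskedGram (incMat ℝ v) A := by
    have h1 := incMat_mul_transpose (R := ℝ) (v := v)
    rw [← maskedGram_add_compl _ A] at h1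
    have h2 : maskedGram (incMat ℝ v) Aᶜ * J = 0 := by
      rw [maskedGram, Matrix.mul_assoc, hBJ, Matrix.mul_zero]
    rw [Matrix.add_mul, Matrix.mul_add, Matrix.mul_add, h2, Matrix.mul_one, Matrix.mul_one,
      Matrix.one_mul, add_smul, ← h1, hJ]
    module
  have hdet : (1 + J).det = (v : ℝ) + 1 := by
    have : J = Matrix.replicateCol Unit (fun _ : Fin v => (1 : ℝ)) *
        Matrix.replicateRow Unit (fun _ : Fin v => (1 : ℝ)) := by
      ext i j
      simp [hJ, Matrix.mul_apply]
    rw [this, Matrix.det_one_add_replicateCol_mul_replicateRow]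
    simp [dotProduct, add_comm]
  rw [← hprod, Matrix.det_mul, hdet, mul_comm]

theorem maskedGram_colMat_univ :
    maskedGram (colMat ℝ v) Finset.univ = 1 + offGram (∅ : Finset (Edge v)) := by
  have : star (∅ : Finset (Edge v)) = ∅ := by simp [star]
  rw [offGram, this, Finset.compl_empty, maskedGram_univ, maskedGram_univ, colMat,
    Matrix.transpose_fromCols, Matrix.fromCols_mul_fromRows]
  simp

theorem card_edge : Fintype.card (Edge v) = v.choose 2 := by
  have h := sum_edge (v := v) (R := ℤ) (fun _ => 1)
  have h2 : ∀ x : Fin v, (∑ y : Fin v, if x < y then (1 : ℤ) else 0) = ((v - 1 - x : ℕ) : ℤ) := by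
    intro x
    rw [← Finset.sum_filter, Finset.sum_const, nsmul_eq_mul, mul_one]
    congr 1
    rw [← Fin.card_Ioi]
    congr 1
    ext y
    simp
  simp only [h2] at h
  rw [Finset.sum_const, Finset.card_univ, nsmul_eq_mul, mul_one,
    Fin.sum_univ_eq_sum_range (fun x => ((v - 1 - x : ℕ) : ℤ)), ← Nat.cast_sum,
    Finset.sum_range_reflect (fun x => x) v, Finset.sum_range_id, ← Nat.choose_two_right] at h
  exact_mod_cast h

/-- The weighted number of two-dimensional hypertrees on `v + 1` vertices. -/
theorem det_maskedGram_colMat_univ (hv : 1 ≤ v) :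
    (maskedGram (colMat ℝ v) Finset.univ).det = ((v : ℝ) + 1) ^ ((v - 1).choose 2) := by
  have hstar : starGram (∅ : Finset (Edge v)) = 0 := by
    have : star (∅ : Finset (Edge v)) = ∅ := by simp [star]
    ext
    simp [starGram, this, maskedGram]
  have h1 := det_one_add_offGram_mul (∅ : Finset (Edge v))
  have h2 := det_one_add_incGram (∅ : Finset (Edge v))
  have h0 : maskedGram (incMat ℝ v) ∅ = 0 := by ext; simp [maskedGram_apply]
  rw [h0, sub_zero, Matrix.det_smul, Matrix.det_one, mul_one, Fintype.card_fin] at h2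
  rw [hstar, sub_zero, Matrix.det_smul, Matrix.det_one, mul_one, card_edge, Finset.card_empty,
    pow_zero, one_mul] at h1
  rw [maskedGram_colMat_univ]
  obtain ⟨w, rfl⟩ : ∃ w, v = w + 1 := ⟨v - 1, by omega⟩
  set x : ℝ := ((w + 1 : ℕ) : ℝ) + 1 with hx
  have hxpos : 0 < x := by positivity
  have h3 : (1 + maskedGram (incMat ℝ (w + 1)) ∅ᶜ).det = x ^ w := by
    have : x * (1 + maskedGram (incMat ℝ (w + 1)) ∅ᶜ).det = x * x ^ w := by
      rw [h2, pow_succ, mul_comm]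
    exact mul_left_cancel₀ hxpos.ne' this
  -- The surplus exponent `w` is cancelled by the incidence determinant, which `h3` has evaluated as
  -- `x ^ w`.
  have h4 : (w + 1).choose 2 = w.choose 2 + w := by
    rw [Nat.choose_succ_succ' w 1, Nat.choose_one_right, add_comm]
  rw [h3, h4, pow_add] at h1
  exact (mul_right_cancel₀ (pow_ne_zero _ hxpos.ne') h1).symm

/-- The triangles on `Fin (v + 1)` that are of the form `τ a` with `a ∈ A₀`, or have no edge
in `A`. -/
def allowed (A A₀ : Finset (Edge v)) (τ : Edge v → Tri v) : Finset (Col v) :=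
  Finset.disjSum Aᶜ (A₀.image τ ∪ (star A)ᶜ)

/-- The matrix whose columns indexed by `A₀` are the boundaries of the triangles `τ a`, whose
columns indexed by `A \ A₀` vanish and whose other columns are those of the identity. -/
def replaced (A A₀ : Finset (Edge v)) (τ : Edge v → Tri v) : Matrix (Edge v) (Edge v) ℝ :=
  Matrix.of fun e a => if a ∈ A then (if a ∈ A₀ then triMat ℝ v e (τ a) else 0)
    else if e = a then 1 else 0

/-- With Z the replaced matrix, Z Zᵀ accounts for the identity columns outside `A` and the columns
`τ a`. Since Z fixes the coordinate vectors outside `A`, on which `offGram A` lives, Z `offGram A`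
Zᵀ = `offGram A`. -/
theorem maskedGram_allowed {A A₀ : Finset (Edge v)} {τ : Edge v → Tri v} (hA : A₀ ⊆ A)
    (hinj : Set.InjOn τ A₀) (hτ : ∀ a ∈ A₀, τ a ∈ star A) :
    maskedGram (colMat ℝ v) (allowed A A₀ τ) =
      replaced A A₀ τ * (1 + offGram A) * (replaced A A₀ τ).transpose := by
  set Z := replaced A A₀ τ with hZ
  have hZP : Z * offProj A = offProj A := by
    ext e e'
    rw [offProj, Matrix.mul_diagonal]
    by_cases h : e' ∈ A
    · by_cases hh : e = e' <;> simp [h, hh, Matrix.diagonal_apply]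
    · simp [h, hZ, replaced, Matrix.diagonal_apply]
      grind
  have hZL : Z * offGram A = offGram A := by
    rw [← offProj_mul_offGram, ← Matrix.mul_assoc, hZP]
  have hLZ : offGram A * Z.transpose = offGram A := by
    have h := congrArg Matrix.transpose hZL
    rwa [Matrix.transpose_mul, offGram, maskedGram_transpose] at h
  rw [Matrix.mul_add, Matrix.mul_one, hZL, Matrix.add_mul, hLZ]
  ext e e'
  have hdisj : Disjoint (A₀.image τ) (star A)ᶜ := by
    rw [Finset.disjoint_left]
    intro t ht
    obtain ⟨a, ha, rfl⟩ := Finset.mem_image.1 ht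
    simpa using hτ a ha
  rw [maskedGram_apply, allowed, Finset.sum_disjSum, Finset.sum_union hdisj,
    Finset.sum_image hinj, Matrix.add_apply, Matrix.mul_apply, offGram, maskedGram_apply,
    ← add_assoc, ← Finset.sum_compl_add_sum A]
  simp only [colMat_inl, colMat_inr, Matrix.transpose_apply]
  congr 2
  · refine Finset.sum_congr rfl fun a ha => ?_
    simp [hZ, replaced, Finset.mem_compl.1 ha]
  · rw [← Finset.sum_subset hA]
    · refine Finset.sum_congr rfl fun a ha => ?_
      simp [hZ, replaced, ha, hA ha]
    · intro a ha ha'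
      simp [hZ, replaced, ha, ha']

theorem det_maskedGram_allowed {A A₀ : Finset (Edge v)} {τ : Edge v → Tri v} (hA : A₀ ⊆ A)
    (hinj : Set.InjOn τ A₀) (hτ : ∀ a ∈ A₀, τ a ∈ star A) :
    (maskedGram (colMat ℝ v) (allowed A A₀ τ)).det =
      (replaced A A₀ τ).det ^ 2 * (1 + offGram A).det := by
  rw [maskedGram_allowed hA hinj hτ, Matrix.det_mul, Matrix.det_mul, Matrix.det_transpose]
  ring

/-- This is used to show that no weight lies on sets of allowed columns that omit one of the
triangles `τ a`. -/
theorem det_replaced_eq_zero {A A₀ : Finset (Edge v)} {τ : Edge v → Tri v} {a : Edge v}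
    (ha : a ∈ A) (ha' : a ∉ A₀) : (replaced A A₀ τ).det = 0 :=
  Matrix.det_eq_zero_of_column_eq_zero a fun e => by simp [replaced, ha, ha']

/-! ### Determinants of small perturbations of a scalar matrix. -/

section Gershgorin

variable {ι : Type*} [Fintype ι] [DecidableEq ι]

theorem exp_neg_two_mul_le {x : ℝ} (h0 : 0 ≤ x) (h1 : x ≤ 1 / 2) : Real.exp (-(2 * x)) ≤ 1 - x := by
  have h2 : 0 < 1 - x := by linarith
  have h3 : (1 - x)⁻¹ ≤ Real.exp (2 * x) := by
    refine le_trans ?_ (Real.add_one_le_exp (2 * x))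
    rw [inv_le_iff_one_le_mul₀ h2]
    nlinarith
  rw [Real.exp_neg]
  exact inv_le_of_inv_le₀ h2 h3

/-- A two-sided estimate for `det (n - K)` when the row sums of `K` are small compared to `n`. -/
theorem det_smul_one_sub_bounds {K : Matrix ι ι ℝ} (hK : K.PosSemidef) {n : ℝ} (hn : 0 < n)
    (hrow : ∀ i, ∑ j, |K i j| ≤ n / 2) :
    n ^ Fintype.card ι * Real.exp (-(2 * K.trace / n)) ≤ (n • (1 : Matrix ι ι ℝ) - K).det ∧
      (n • (1 : Matrix ι ι ℝ) - K).det ≤ n ^ Fintype.card ι := by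
  have hH := hK.1
  have hdet : (n • (1 : Matrix ι ι ℝ) - K).det = ∏ i, (n - hH.eigenvalues i) := by
    have h1 := Matrix.eval_charpoly K n
    rw [hH.charpoly_eq, Polynomial.eval_prod] at h1
    simp only [Polynomial.eval_sub, Polynomial.eval_X, Polynomial.eval_C] at h1
    rw [Matrix.scalar_apply, ← Matrix.smul_one_eq_diagonal] at h1
    exact h1.symm
  have h0 : ∀ i, 0 ≤ hH.eigenvalues i := hK.eigenvalues_nonneg
  have hle : ∀ i, hH.eigenvalues i ≤ n / 2 := by
    intro i
    have hev : Module.End.HasEigenvalue (Matrix.toLin' K) (hH.eigenvalues i) := by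
      rw [Module.End.hasEigenvalue_iff_mem_spectrum, Matrix.spectrum_toLin']
      exact hH.eigenvalues_mem_spectrum_real i
    -- Gershgorin: an eigenvalue lies within the off-diagonal row sum of some diagonal entry, so it
    -- is at most an absolute row sum, that is n / 2.
    obtain ⟨k, hk⟩ := eigenvalue_mem_ball hev
    rw [Metric.mem_closedBall, Real.dist_eq] at hk
    have h2 := hrow k
    rw [← Finset.add_sum_erase _ _ (Finset.mem_univ k)] at h2
    simp only [Real.norm_eq_abs] at hk
    have h3 := le_abs_self (hH.eigenvalues i - K k k)
    have h4 := le_abs_self (K k k)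
    linarith
  have htr : K.trace = ∑ i, hH.eigenvalues i := by
    simpa using hH.trace_eq_sum_eigenvalues
  rw [hdet]
  constructor
  · have h5 : n ^ Fintype.card ι * Real.exp (-(2 * K.trace / n)) =
        ∏ i, (n * Real.exp (-(2 * (hH.eigenvalues i / n)))) := by
      rw [Finset.prod_mul_distrib, Finset.prod_const, Finset.card_univ, ← Real.exp_sum, htr]
      congr 2
      rw [Finset.sum_neg_distrib, ← Finset.mul_sum, ← Finset.sum_div, mul_div_assoc]
    rw [h5]
    refine Finset.prod_le_prod (fun i _ => by positivity) fun i _ => ?_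
    have h6 : hH.eigenvalues i / n ≤ 1 / 2 := by
      rw [div_le_iff₀ hn]
      linarith [hle i]
    calc n * Real.exp (-(2 * (hH.eigenvalues i / n))) ≤ n * (1 - hH.eigenvalues i / n) :=
          mul_le_mul_of_nonneg_left
            (exp_neg_two_mul_le (div_nonneg (h0 i) hn.le) h6) hn.le
      _ = n - hH.eigenvalues i := by field_simp
  · calc ∏ i, (n - hH.eigenvalues i) ≤ ∏ _i : ι, n :=
          Finset.prod_le_prod (fun i _ => by linarith [hle i]) fun i _ => by linarith [h0 i]
      _ = n ^ Fintype.card ι := by simp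

end Gershgorin

/-! ### Row sums and traces of the perturbing Gram matrices. -/

section GramBounds

variable {m n : Type*} [Fintype m] [DecidableEq m] [Fintype n] [DecidableEq n]

theorem posSemidef_maskedGram (C : Matrix m n ℝ) (T : Finset n) : (maskedGram C T).PosSemidef := by
  have h : maskedGram C T =
      (C * Matrix.diagonal fun t => if t ∈ T then (1 : ℝ) else 0) *
        (C * Matrix.diagonal fun t => if t ∈ T then (1 : ℝ) else 0).conjTranspose := by
    ext i j
    rw [maskedGram_apply, Matrix.mul_apply]
    simp [Matrix.mul_diagonal, Finset.sum_ite_mem]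
  rw [h]
  exact Matrix.posSemidef_self_mul_conjTranspose _

theorem sum_abs_maskedGram_le (C : Matrix m n ℝ) (T : Finset n) {c : ℝ}
    (hc : ∀ t, ∑ i, |C i t| ≤ c) (i : m) :
    ∑ j, |maskedGram C T i j| ≤ c * ∑ t ∈ T, |C i t| := by
  calc ∑ j, |maskedGram C T i j| ≤ ∑ j, ∑ t ∈ T, |C i t| * |C j t| := by
        refine Finset.sum_le_sum fun j _ => ?_
        rw [maskedGram_apply]
        exact (Finset.abs_sum_le_sum_abs _ _).trans_eq (by simp [abs_mul])
    _ = ∑ t ∈ T, |C i t| * ∑ j, |C j t| := by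
        rw [Finset.sum_comm]
        simp [Finset.mul_sum]
    _ ≤ ∑ t ∈ T, |C i t| * c :=
        Finset.sum_le_sum fun t _ => mul_le_mul_of_nonneg_left (hc t) (abs_nonneg _)
    _ = _ := by rw [← Finset.sum_mul, mul_comm]

theorem trace_maskedGram_le (C : Matrix m n ℝ) (T : Finset n) {c : ℝ}
    (hc : ∀ t, ∑ i, C i t ^ 2 ≤ c) : (maskedGram C T).trace ≤ c * T.card := by
  have : (maskedGram C T).trace = ∑ t ∈ T, ∑ i, C i t ^ 2 := by
    rw [Matrix.trace, Finset.sum_comm]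
    exact Finset.sum_congr rfl fun i _ => by
      rw [Matrix.diag_apply, maskedGram_apply]
      exact Finset.sum_congr rfl fun t _ => (sq _).symm
  rw [this, mul_comm, ← nsmul_eq_mul]
  exact Finset.sum_le_card_nsmul _ _ _ fun t _ => hc t

end GramBounds

variable {v : ℕ}

theorem abs_triMat (e : Edge v) (t : Tri v) :
    |triMat ℝ v e t| = (if e.1 = (t.1.2.1, t.1.2.2) then 1 else 0) +
      (if e.1 = (t.1.1, t.1.2.2) then 1 else 0) + (if e.1 = (t.1.1, t.1.2.1) then 1 else 0) := by
  obtain ⟨⟨x, y, z⟩, hxy, hyz⟩ := t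
  obtain ⟨⟨a, b⟩, hab⟩ := e
  simp only [triMat, coeff, Matrix.of_apply, Prod.mk.injEq] at *
  have h1 : x ≠ y := hxy.ne
  have h2 : y ≠ z := hyz.ne
  have h3 : x ≠ z := (hxy.trans hyz).ne
  split_ifs <;> simp_all

theorem abs_triMat_eq (e : Edge v) (t : Tri v) :
    |triMat ℝ v e t| = if triMat ℝ v e t = 0 then 0 else 1 := by
  split_ifs with h
  · rw [h, abs_zero]
  · have h1 := abs_triMat e t
    have h4 : |triMat ℝ v e t| ≠ 0 := abs_ne_zero.2 h
    obtain ⟨⟨x, y, z⟩, hxy, hyz⟩ := t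
    have h2 : y ≠ z := hyz.ne
    have h3 : x ≠ y := hxy.ne
    rw [h1] at h4 ⊢
    dsimp only at h4 ⊢
    by_cases i1 : e.1 = (y, z) <;> by_cases i2 : e.1 = (x, z) <;>
      by_cases i3 : e.1 = (x, y) <;> simp_all

theorem triMat_sq (e : Edge v) (t : Tri v) : triMat ℝ v e t ^ 2 = |triMat ℝ v e t| := by
  rw [← sq_abs, abs_triMat_eq]
  split_ifs <;> norm_num

theorem sum_abs_triMat_col (t : Tri v) : ∑ e, |triMat ℝ v e t| ≤ 3 := by
  have h : ∀ p : Fin v × Fin v, ∑ e : Edge v, (if e.1 = p then (1 : ℝ) else 0) ≤ 1 := by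
    intro p
    rw [← Finset.sum_filter, Finset.sum_const, nsmul_eq_mul, mul_one]
    have hcard : (Finset.univ.filter fun e : Edge v => e.1 = p).card ≤ 1 :=
      Finset.card_le_one.2 fun a ha b hb => Subtype.ext
        ((Finset.mem_filter.1 ha).2.trans (Finset.mem_filter.1 hb).2.symm)
    exact_mod_cast hcard
  simp only [abs_triMat, Finset.sum_add_distrib]
  linarith [h (t.1.2.1, t.1.2.2), h (t.1.1, t.1.2.2), h (t.1.1, t.1.2.1)]

/-- The entries are 0 or ±1, so the sum is a diagonal entry of `triMat` times its transpose; the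
Laplacian identity bounds it by `v`, the incidence part being nonnegative. -/
theorem sum_abs_triMat_row (e : Edge v) : ∑ t, |triMat ℝ v e t| ≤ v := by
  have h := congrFun (congrFun (triMat_mul_transpose_add (R := ℝ) (v := v)) e) e
  rw [Matrix.add_apply, Matrix.mul_apply, Matrix.mul_apply] at h
  simp only [Matrix.transpose_apply, ← sq, triMat_sq, Matrix.smul_apply, Matrix.one_apply_eq,
    smul_eq_mul, mul_one] at h
  have : 0 ≤ ∑ u, incMat ℝ v u e ^ 2 := Finset.sum_nonneg fun _ _ => sq_nonneg _
  linarith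

theorem eq_of_triMat_ne_zero {R : Type*} [CommRing R] {e : Edge v} {t : Tri v}
    (h : triMat R v e t ≠ 0) : e.1 = (t.1.2.1, t.1.2.2) ∨ e.1 = (t.1.1, t.1.2.2) ∨
      e.1 = (t.1.1, t.1.2.1) := by
  by_contra! hc
  apply h
  simp [triMat, coeff, hc.1, hc.2.1, hc.2.2]

/-- Two distinct edges of a triangle already determine its three vertices. -/
theorem tri_unique {a e : Edge v} (hae : a ≠ e) {t t' : Tri v} (h1 : triMat ℝ v a t ≠ 0)
    (h2 : triMat ℝ v e t ≠ 0) (h3 : triMat ℝ v a t' ≠ 0) (h4 : triMat ℝ v e t' ≠ 0) : t = t' := by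
  replace h1 := eq_of_triMat_ne_zero h1
  replace h2 := eq_of_triMat_ne_zero h2
  replace h3 := eq_of_triMat_ne_zero h3
  replace h4 := eq_of_triMat_ne_zero h4
  obtain ⟨⟨a1, a2⟩, ha⟩ := a
  obtain ⟨⟨e1, e2⟩, he⟩ := e
  obtain ⟨⟨x, y, z⟩, hxy, hyz⟩ := t
  obtain ⟨⟨x', y', z'⟩, hxy', hyz'⟩ := t'
  simp only [Prod.mk.injEq, Subtype.mk.injEq, ne_eq] at *
  grind

theorem sum_abs_triMat_mul_le {a e : Edge v} (hae : a ≠ e) :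
    ∑ t, |triMat ℝ v e t| * |triMat ℝ v a t| ≤ 1 := by
  have h : ∀ t, |triMat ℝ v e t| * |triMat ℝ v a t| =
      if triMat ℝ v e t ≠ 0 ∧ triMat ℝ v a t ≠ 0 then 1 else 0 := by
    intro t
    rw [abs_triMat_eq, abs_triMat_eq]
    split_ifs <;> simp_all
  simp only [h]
  rw [← Finset.sum_filter, Finset.sum_const, nsmul_eq_mul, mul_one]
  exact_mod_cast Finset.card_le_one.2 fun t ht t' ht' => by
    obtain ⟨h1, h2⟩ := (Finset.mem_filter.1 ht).2
    obtain ⟨h3, h4⟩ := (Finset.mem_filter.1 ht').2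
    exact tri_unique hae h2 h1 h4 h3

theorem one_le_sum_abs_of_mem_star {A : Finset (Edge v)} {t : Tri v} (ht : t ∈ star A) :
    1 ≤ ∑ a ∈ A, |triMat ℝ v a t| := by
  obtain ⟨a, ha, h⟩ := (Finset.mem_filter.1 ht).2
  calc (1 : ℝ) = |triMat ℝ v a t| := by rw [abs_triMat_eq, if_neg h]
    _ ≤ _ := Finset.single_le_sum (f := fun a => |triMat ℝ v a t|) (fun _ _ => abs_nonneg _) ha

theorem card_star_le (A : Finset (Edge v)) : ((star A).card : ℝ) ≤ A.card * v := by
  calc ((star A).card : ℝ) = ∑ t ∈ star A, 1 := by simp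
    _ ≤ ∑ t ∈ star A, ∑ a ∈ A, |triMat ℝ v a t| :=
        Finset.sum_le_sum fun t ht => one_le_sum_abs_of_mem_star ht
    _ ≤ ∑ t, ∑ a ∈ A, |triMat ℝ v a t| :=
        Finset.sum_le_sum_of_subset_of_nonneg (Finset.subset_univ _)
          fun t _ _ => Finset.sum_nonneg fun _ _ => abs_nonneg _
    _ = ∑ a ∈ A, ∑ t, |triMat ℝ v a t| := Finset.sum_comm
    _ ≤ ∑ a ∈ A, (v : ℝ) := Finset.sum_le_sum fun a _ => sum_abs_triMat_row a
    _ = _ := by simp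

theorem starGram_eq (A : Finset (Edge v)) :
    starGram A = maskedGram (offProj A * triMat ℝ v) (star A) := by
  rw [starGram, maskedGram, maskedGram, Matrix.transpose_mul, offProj, Matrix.diagonal_transpose]
  simp only [Matrix.mul_assoc]

theorem abs_offProj_mul_triMat_le (A : Finset (Edge v)) (e : Edge v) (t : Tri v) :
    |(offProj A * triMat ℝ v) e t| ≤ |triMat ℝ v e t| := by
  rw [offProj, Matrix.diagonal_mul]
  split_ifs <;> simp

/-- An edge outside `A` shares at most one triangle with each element of `A`, hence lies in at most
|A| triangles of the star, each having three edges. It matters that the bound does not grow with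
`v`: this is what makes Gershgorin applicable. -/
theorem sum_abs_starGram_le (A : Finset (Edge v)) (e : Edge v) :
    ∑ e', |starGram A e e'| ≤ 3 * A.card := by
  rw [starGram_eq]
  refine (sum_abs_maskedGram_le _ _ (fun t => (Finset.sum_le_sum fun e _ =>
    abs_offProj_mul_triMat_le A e t).trans (sum_abs_triMat_col t)) e).trans ?_
  refine mul_le_mul_of_nonneg_left ?_ (by norm_num)
  by_cases he : e ∈ A
  · rw [Finset.sum_eq_zero]
    · positivity
    · intro t _
      simp [offProj, Matrix.diagonal_mul, he]
  · calc ∑ t ∈ star A, |(offProj A * triMat ℝ v) e t| ≤ ∑ t ∈ star A, |triMat ℝ v e t| :=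
          Finset.sum_le_sum fun t _ => abs_offProj_mul_triMat_le A e t
      _ ≤ ∑ t ∈ star A, |triMat ℝ v e t| * ∑ a ∈ A, |triMat ℝ v a t| :=
          Finset.sum_le_sum fun t ht =>
            le_mul_of_one_le_right (abs_nonneg _) (one_le_sum_abs_of_mem_star ht)
      _ ≤ ∑ t, |triMat ℝ v e t| * ∑ a ∈ A, |triMat ℝ v a t| :=
          Finset.sum_le_sum_of_subset_of_nonneg (Finset.subset_univ _)
            fun t _ _ => by positivity
      _ = ∑ a ∈ A, ∑ t, |triMat ℝ v e t| * |triMat ℝ v a t| := by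
          simp only [Finset.mul_sum]
          exact Finset.sum_comm
      _ ≤ ∑ a ∈ A, (1 : ℝ) :=
          Finset.sum_le_sum fun a ha => sum_abs_triMat_mul_le fun h => he (h ▸ ha)
      _ = A.card := by simp

theorem trace_starGram_le (A : Finset (Edge v)) : (starGram A).trace ≤ 3 * (A.card * v) := by
  rw [starGram_eq]
  refine (trace_maskedGram_le _ _ (c := 3) fun t => ?_).trans
    (mul_le_mul_of_nonneg_left (card_star_le A) (by norm_num))
  refine (Finset.sum_le_sum fun e _ => ?_).trans (sum_abs_triMat_col t)
  rw [← triMat_sq]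
  exact sq_le_sq.2 (abs_offProj_mul_triMat_le A e t)

theorem abs_incMat (u : Fin v) (e : Edge v) :
    |incMat ℝ v u e| = (if u = e.1.2 then 1 else 0) + (if u = e.1.1 then 1 else 0) := by
  obtain ⟨⟨a, b⟩, hab⟩ := e
  have : a ≠ b := hab.ne
  simp only [incMat, Matrix.of_apply]
  split_ifs <;> simp_all

theorem sum_abs_incMat_col (e : Edge v) : ∑ u, |incMat ℝ v u e| ≤ 2 := by
  simp only [abs_incMat, Finset.sum_add_distrib]
  simp
  norm_num

theorem abs_incMat_le_one (u : Fin v) (e : Edge v) : |incMat ℝ v u e| ≤ 1 := by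
  rw [abs_incMat]
  obtain ⟨⟨a, b⟩, hab⟩ := e
  have : a ≠ b := hab.ne
  split_ifs <;> simp_all

theorem sum_abs_incGram_le (A : Finset (Edge v)) (u : Fin v) :
    ∑ w, |maskedGram (incMat ℝ v) A u w| ≤ 2 * A.card := by
  refine (sum_abs_maskedGram_le _ _ sum_abs_incMat_col u).trans ?_
  refine mul_le_mul_of_nonneg_left ?_ (by norm_num)
  refine (Finset.sum_le_card_nsmul _ _ 1 fun e _ => abs_incMat_le_one u e).trans ?_
  simp

theorem trace_incGram_le (A : Finset (Edge v)) :
    (maskedGram (incMat ℝ v) A).trace ≤ 2 * A.card := by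
  refine trace_maskedGram_le _ _ fun e => (Finset.sum_le_sum fun u _ => ?_).trans
    (sum_abs_incMat_col e)
  rw [← sq_abs]
  exact pow_le_of_le_one (abs_nonneg _) (abs_incMat_le_one u e) two_ne_zero

/-- The two determinant identities express det(1 + `offGram A`) as a quotient of determinants of
perturbed scalar matrices. The numerator loses at most exp(-6|A|), as its perturbation has trace at
most 3|A|v; the denominator loses at most exp(-4|A| / (v + 1)), as its perturbation has trace at
most 2|A|. -/
theorem det_one_add_offGram_bounds (hv : 1 ≤ v) {A : Finset (Edge v)} (hA : 6 * A.card ≤ v + 1) :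
    ((v : ℝ) + 1) ^ ((v - 1).choose 2) * Real.exp (-(6 * (A.card : ℝ))) ≤
        (1 + offGram A).det * ((v : ℝ) + 1) ^ A.card ∧
      (1 + offGram A).det * ((v : ℝ) + 1) ^ A.card ≤
        ((v : ℝ) + 1) ^ ((v - 1).choose 2) * Real.exp (4 * (A.card : ℝ) / ((v : ℝ) + 1)) := by
  set x : ℝ := (v : ℝ) + 1 with hx
  have hxpos : 0 < x := by positivity
  have hA' : 6 * (A.card : ℝ) ≤ x := by
    rw [hx]
    exact_mod_cast hA
  obtain ⟨hQ1, hQ2⟩ := det_smul_one_sub_bounds (K := starGram A)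
    (starGram_eq A ▸ posSemidef_maskedGram _ _) hxpos
    fun e => (sum_abs_starGram_le A e).trans (by linarith)
  obtain ⟨hL1, hL2⟩ := det_smul_one_sub_bounds (posSemidef_maskedGram (incMat ℝ v) A) hxpos
    fun u => (sum_abs_incGram_le A u).trans (by
      have : (0 : ℝ) ≤ A.card := by positivity
      linarith)
  have h1 := det_one_add_offGram_mul A
  have h2 := det_one_add_incGram A
  rw [← hx] at h1 h2
  have h4 : v.choose 2 + 1 = (v - 1).choose 2 + v := by
    obtain ⟨w, rfl⟩ : ∃ w, v = w + 1 := ⟨v - 1, by omega⟩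
    rw [Nat.choose_succ_succ' w 1, Nat.choose_one_right, Nat.add_sub_cancel]
    ring
  rw [card_edge] at hQ1 hQ2
  rw [Fintype.card_fin] at hL1 hL2
  set G := (1 + offGram A).det
  set q := (x • (1 : Matrix (Edge v) (Edge v) ℝ) - starGram A).det
  set l := (x • (1 : Matrix (Fin v) (Fin v) ℝ) - maskedGram (incMat ℝ v) A).det
  have hlpos : 0 < l := lt_of_lt_of_le (by positivity) hL1
  have hkey : G * x ^ A.card * l = x * q := by
    rw [h1, ← h2]
    ring
  have hpow : x * x ^ v.choose 2 = x ^ (v - 1).choose 2 * x ^ v := by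
    rw [← pow_add, ← h4, pow_succ, mul_comm]
  have htrQ : 2 * (starGram A).trace / x ≤ 6 * A.card := by
    rw [div_le_iff₀ hxpos]
    have := trace_starGram_le A
    have h0 : (0 : ℝ) ≤ A.card := by positivity
    have : (A.card : ℝ) * v ≤ A.card * x := mul_le_mul_of_nonneg_left (by linarith) h0
    linarith
  have htrL : 2 * (maskedGram (incMat ℝ v) A).trace / x ≤ 4 * A.card / x := by
    have := trace_incGram_le A
    exact div_le_div_of_nonneg_right (by linarith) hxpos.le
  constructor
  · refine le_of_mul_le_mul_right ?_ hlpos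
    rw [hkey]
    calc x ^ (v - 1).choose 2 * Real.exp (-(6 * (A.card : ℝ))) * l
        ≤ x ^ (v - 1).choose 2 * Real.exp (-(6 * (A.card : ℝ))) * x ^ v := by gcongr
      _ = x * (x ^ v.choose 2 * Real.exp (-(6 * (A.card : ℝ)))) := by
          linear_combination -Real.exp (-(6 * (A.card : ℝ))) * hpow
      _ ≤ x * q := by
          refine mul_le_mul_of_nonneg_left (le_trans ?_ hQ1) hxpos.le
          gcongr
  · refine le_of_mul_le_mul_right ?_ hlpos
    rw [hkey]
    have hexp : Real.exp (4 * (A.card : ℝ) / x) *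
        Real.exp (-(2 * (maskedGram (incMat ℝ v) A).trace / x)) ≥ 1 := by
      rw [← Real.exp_add]
      exact Real.one_le_exp (by linarith)
    calc x * q ≤ x * x ^ v.choose 2 := by gcongr
      _ = x ^ (v - 1).choose 2 * x ^ v * 1 := by rw [hpow, mul_one]
      _ ≤ x ^ (v - 1).choose 2 * x ^ v * (Real.exp (4 * (A.card : ℝ) / x) *
          Real.exp (-(2 * (maskedGram (incMat ℝ v) A).trace / x))) := by gcongr
      _ = x ^ (v - 1).choose 2 * Real.exp (4 * (A.card : ℝ) / x) * (x ^ v *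
          Real.exp (-(2 * (maskedGram (incMat ℝ v) A).trace / x))) := by ring
      _ ≤ _ := by gcongr

/-! ### Faces of a complex as increasing pairs and triples. -/

section Vertices

variable {n : ℕ}

/-- The set of end points of an edge. -/
def edgeSet (e : Edge n) : Finset (Fin n) := {e.1.1, e.1.2}

/-- The vertex set of a triangle. -/
def triSet (t : Tri n) : Finset (Fin n) := {t.1.1, t.1.2.1, t.1.2.2}

theorem card_edgeSet (e : Edge n) : (edgeSet e).card = 2 := Finset.card_pair e.2.ne

theorem card_triSet (t : Tri n) : (triSet t).card = 3 :=
  Finset.card_eq_three.2 ⟨_, _, _, t.2.1.ne, (t.2.1.trans t.2.2).ne, t.2.2.ne, rfl⟩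

theorem edgeSet_injective : Function.Injective (edgeSet (n := n)) := by
  rintro ⟨⟨a, b⟩, hab⟩ ⟨⟨c, d⟩, hcd⟩ h
  simp only [edgeSet, Finset.ext_iff, Finset.mem_insert, Finset.mem_singleton] at h hab hcd
  have h1 := (h a).1 (Or.inl rfl)
  have h2 := (h b).1 (Or.inr rfl)
  have h3 := (h c).2 (Or.inl rfl)
  simp only [Subtype.mk.injEq, Prod.mk.injEq]
  omega

theorem triSet_injective : Function.Injective (triSet (n := n)) := by
  rintro ⟨⟨a, b, c⟩, hab, hbc⟩ ⟨⟨x, y, z⟩, hxy, hyz⟩ h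
  simp only [triSet, Finset.ext_iff, Finset.mem_insert, Finset.mem_singleton] at h hab hbc hxy hyz
  have h1 := (h a).1 (by simp)
  have h2 := (h b).1 (by simp)
  have h3 := (h c).1 (by simp)
  have h4 := (h x).2 (by simp)
  have h5 := (h y).2 (by simp)
  have h6 := (h z).2 (by simp)
  simp only [Subtype.mk.injEq, Prod.mk.injEq]
  omega

theorem exists_edgeSet_eq {σ : Finset (Fin n)} (h : σ.card = 2) : ∃ e, edgeSet e = σ := by
  obtain ⟨x, y, hxy, rfl⟩ := Finset.card_eq_two.1 h
  rcases hxy.lt_or_gt with h | h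
  · exact ⟨⟨(x, y), h⟩, rfl⟩
  · exact ⟨⟨(y, x), h⟩, Finset.pair_comm _ _⟩

theorem exists_triSet_eq {σ : Finset (Fin n)} (h : σ.card = 3) : ∃ t, triSet t = σ := by
  have hmono := (σ.orderEmbOfFin h).strictMono
  refine ⟨⟨(σ.orderEmbOfFin h 0, σ.orderEmbOfFin h 1, σ.orderEmbOfFin h 2),
    hmono (by decide), hmono (by decide)⟩, ?_⟩
  refine Finset.eq_of_subset_of_card_le ?_ (by rw [card_triSet, h])
  intro x hx
  simp only [triSet, Finset.mem_insert, Finset.mem_singleton] at hx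
  rcases hx with rfl | rfl | rfl <;> exact Finset.orderEmbOfFin_mem _ _ _

variable {R : Type} [CommRing R] (S : AbstractSimplicialComplex (Fin n))

theorem boundaryMatrix_zero_apply (τ : Face S 0) (σ : Face S 1) (u : Fin n) (e : Edge n)
    (hu : τ.1 = {u}) (he : σ.1 = edgeSet e) : boundaryMatrix R S 0 τ σ = incMat R n u e := by
  obtain ⟨⟨a, b⟩, hab⟩ := e
  dsimp only at hab
  have hne : a ≠ b := hab.ne
  have e1 : ({a, b} : Finset (Fin n)).erase a = {b} := by grind
  have e2 : ({a, b} : Finset (Fin n)).erase b = {a} := by grind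
  have f1 : ({a, b} : Finset (Fin n)).filter (· < a) = ∅ := by grind
  have f2 : ({a, b} : Finset (Fin n)).filter (· < b) = {a} := by grind
  simp only [boundaryMatrix, Matrix.of_apply, hu, he, edgeSet, incMat]
  rw [Finset.sum_pair hne, e1, e2, f1, f2]
  simp [Finset.singleton_inj]
  grind

theorem boundaryMatrix_one_apply (τ : Face S 1) (σ : Face S 2) (e : Edge n) (t : Tri n)
    (he : τ.1 = edgeSet e) (ht : σ.1 = triSet t) : boundaryMatrix R S 1 τ σ = triMat R n e t := by
  obtain ⟨⟨a, b, c⟩, hab, hbc⟩ := t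
  dsimp only at hab hbc
  have hac := hab.trans hbc
  have e1 : ({a, b, c} : Finset (Fin n)).erase a = {b, c} := by grind
  have e2 : ({a, b, c} : Finset (Fin n)).erase b = {a, c} := by grind
  have e3 : ({a, b, c} : Finset (Fin n)).erase c = {a, b} := by grind
  have f1 : (({a, b, c} : Finset (Fin n)).filter (· < a)) = ∅ := by grind
  have f2 : (({a, b, c} : Finset (Fin n)).filter (· < b)) = {a} := by grind
  have f3 : (({a, b, c} : Finset (Fin n)).filter (· < c)) = {a, b} := by grind
  have k : ∀ (x y : Fin n) (h : x < y), edgeSet e = {x, y} ↔ e.1 = (x, y) := by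
    intro x y h
    constructor
    · intro h'
      rw [edgeSet_injective (a₁ := e) (a₂ := ⟨(x, y), h⟩) h']
    · intro h'
      simp [edgeSet, h']
  simp only [boundaryMatrix, Matrix.of_apply, he, ht, triSet, triMat, coeff]
  rw [Finset.sum_insert (by grind), Finset.sum_pair hbc.ne, e1, e2, e3, f1, f2, f3,
    Finset.card_pair hab.ne]
  simp only [k _ _ hab, k _ _ hbc, k _ _ hac, Finset.card_empty, Finset.card_singleton, pow_zero,
    pow_one]
  split_ifs <;> ring

end Vertices

/-! ### Singling out the vertex 0. -/

section Cone

variable {v : ℕ}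

/-- The edge from the vertex `0` to a further vertex. -/
def baseEdge (b : Fin v) : Edge (v + 1) := ⟨(0, b.succ), Fin.succ_pos b⟩

/-- An edge on `Fin v` as an edge on `Fin (v + 1)` that avoids the vertex `0`. -/
def succEdge (e : Edge v) : Edge (v + 1) := ⟨(e.1.1.succ, e.1.2.succ), Fin.succ_lt_succ_iff.2 e.2⟩

/-- The triangles on `Fin (v + 1)`. -/
def colTri : Col v → Tri (v + 1)
  | Sum.inl e => ⟨(0, e.1.1.succ, e.1.2.succ), Fin.succ_pos _, Fin.succ_lt_succ_iff.2 e.2⟩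
  | Sum.inr t => ⟨(t.1.1.succ, t.1.2.1.succ, t.1.2.2.succ),
      Fin.succ_lt_succ_iff.2 t.2.1, Fin.succ_lt_succ_iff.2 t.2.2⟩

theorem bijective_edge : Function.Bijective (Sum.elim baseEdge succEdge : Fin v ⊕ Edge v → _) := by
  constructor
  · rintro (b | e) (b' | e') h
    · simpa [baseEdge] using h
    · have h1 := congrArg (fun e => e.1.1) h
      exact absurd h1.symm (Fin.succ_ne_zero _)
    · have h1 := congrArg (fun e => e.1.1) h
      exact absurd h1 (Fin.succ_ne_zero _)
    · simp only [Sum.elim_inr, succEdge, Subtype.mk.injEq, Prod.mk.injEq, Fin.succ_inj] at h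
      exact congrArg Sum.inr (Subtype.ext (Prod.ext h.1 h.2))
  · rintro ⟨⟨a, b⟩, hab⟩
    dsimp only at hab
    have hb : b ≠ 0 := fun h => absurd (h ▸ hab) (Fin.not_lt_zero _)
    obtain ⟨b, rfl⟩ := Fin.exists_succ_eq.2 hb
    induction a using Fin.cases with
    | zero => exact ⟨Sum.inl b, rfl⟩
    | succ a => exact ⟨Sum.inr ⟨(a, b), Fin.succ_lt_succ_iff.1 hab⟩, rfl⟩

theorem bijective_colTri : Function.Bijective (colTri (v := v)) := by
  constructor
  · rintro (e | t) (e' | t') h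
    · simp only [colTri, Subtype.mk.injEq, Prod.mk.injEq, Fin.succ_inj] at h
      exact congrArg Sum.inl (Subtype.ext (Prod.ext h.2.1 h.2.2))
    · have h1 := congrArg (fun e => e.1.1) h
      exact absurd h1.symm (Fin.succ_ne_zero _)
    · have h1 := congrArg (fun e => e.1.1) h
      exact absurd h1 (Fin.succ_ne_zero _)
    · simp only [colTri, Subtype.mk.injEq, Prod.mk.injEq, Fin.succ_inj] at h
      exact congrArg Sum.inr (Subtype.ext (Prod.ext h.1 (Prod.ext h.2.1 h.2.2)))
  · rintro ⟨⟨a, b, c⟩, hab, hbc⟩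
    dsimp only at hab hbc
    have hb : b ≠ 0 := fun h => absurd (h ▸ hab) (Fin.not_lt_zero _)
    have hc : c ≠ 0 := fun h => absurd (h ▸ hbc) (Fin.not_lt_zero _)
    obtain ⟨b, rfl⟩ := Fin.exists_succ_eq.2 hb
    obtain ⟨c, rfl⟩ := Fin.exists_succ_eq.2 hc
    induction a using Fin.cases with
    | zero => exact ⟨Sum.inl ⟨(b, c), Fin.succ_lt_succ_iff.1 hbc⟩, rfl⟩
    | succ a =>
      exact ⟨Sum.inr ⟨(a, b, c), Fin.succ_lt_succ_iff.1 hab, Fin.succ_lt_succ_iff.1 hbc⟩, rfl⟩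

variable {R : Type*} [CommRing R]

theorem triMat_succEdge_colTri (e : Edge v) (t : Col v) :
    triMat R (v + 1) (succEdge e) (colTri t) = colMat R v e t := by
  obtain ⟨⟨a, b⟩, hab⟩ := e
  rcases t with ⟨⟨c, d⟩, hcd⟩ | ⟨⟨x, y, z⟩, hxy, hyz⟩
  · simp [triMat, coeff, succEdge, colTri, Fin.succ_ne_zero]
  · simp [triMat, coeff, succEdge, colTri]

theorem sum_edge_succ (f : Edge (v + 1) → R) :
    ∑ e, f e = ∑ b, f (baseEdge b) + ∑ e, f (succEdge e) := by
  rw [← (Equiv.ofBijective _ (bijective_edge (v := v))).sum_comp, Fintype.sum_sum_type]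
  rfl

/-- A cycle is determined by its values on the edges avoiding the vertex `0`. -/
theorem mulVec_incMat_eq_zero_iff (z : Edge (v + 1) → R) :
    (incMat R (v + 1)).mulVec z = 0 ↔
      ∀ u, z (baseEdge u) = -(incMat R v).mulVec (fun e => z (succEdge e)) u := by
  have hsucc : ∀ u : Fin v, (incMat R (v + 1)).mulVec z u.succ =
      z (baseEdge u) + (incMat R v).mulVec (fun e => z (succEdge e)) u := by
    intro u
    simp only [Matrix.mulVec, dotProduct]
    rw [sum_edge_succ]
    congr 1
    · simp [incMat, baseEdge, Fin.succ_ne_zero]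
    · simp [incMat, succEdge]
  have hzero : (incMat R (v + 1)).mulVec z 0 = -∑ u, z (baseEdge u) := by
    simp only [Matrix.mulVec, dotProduct]
    rw [sum_edge_succ]
    simp [incMat, baseEdge, succEdge, (Fin.succ_ne_zero _).symm]
  constructor
  · intro h u
    have := congrFun h u.succ
    rw [hsucc] at this
    exact eq_neg_of_add_eq_zero_left this
  · intro h
    ext u
    induction u using Fin.cases with
    | zero =>
      rw [hzero, Pi.zero_apply, neg_eq_zero, Finset.sum_congr rfl fun u _ => h u,
        Finset.sum_neg_distrib, neg_eq_zero]
      simp only [Matrix.mulVec, dotProduct]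
      rw [Finset.sum_comm]
      refine Finset.sum_eq_zero fun e _ => ?_
      rw [← Finset.sum_mul]
      simp [incMat]
    | succ u => rw [hsucc, h u, neg_add_cancel, Pi.zero_apply]

end Cone

/-! ### First homology as the cokernel of the reduced boundary matrix. -/

section Homology

variable {v : ℕ} (S : AbstractSimplicialComplex (Fin (v + 1)))

open Classical in
/-- The triangles of the complex `S`. -/
def triangles : Finset (Col v) := Finset.univ.filter fun t => triSet (colTri t) ∈ S.faces

theorem mem_triangles {t : Col v} : t ∈ triangles S ↔ triSet (colTri t) ∈ S.faces := by
  simp [triangles]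

/-- A triangle of `S` as a face. -/
def triFace (t : triangles S) : Face S 2 :=
  ⟨triSet (colTri t.1), (mem_triangles S).1 t.2, card_triSet _⟩

theorem bijective_triFace : Function.Bijective (triFace S) := by
  constructor
  · intro t t' h
    exact Subtype.ext (bijective_colTri.1 (triSet_injective (congrArg Subtype.val h)))
  · rintro ⟨σ, hσ, hcard⟩
    obtain ⟨t, rfl⟩ := exists_triSet_eq hcard
    obtain ⟨c, rfl⟩ := bijective_colTri.2 t
    exact ⟨⟨c, (mem_triangles S).2 hσ⟩, rfl⟩

theorem card_face_two : Fintype.card (Face S 2) = (triangles S).card := by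
  rw [← Fintype.card_coe]
  exact (Fintype.card_of_bijective (bijective_triFace S)).symm

/-- A vertex as a face. -/
def vertexFace (u : Fin (v + 1)) : Face S 0 := ⟨{u}, S.singleton_mem u, Finset.card_singleton u⟩

theorem vertexFace_surjective : Function.Surjective (vertexFace S) := by
  rintro ⟨σ, hσ, hcard⟩
  obtain ⟨u, rfl⟩ := Finset.card_eq_one.1 hcard
  exact ⟨u, rfl⟩

variable {S} (hS : ∀ σ : Finset (Fin (v + 1)), σ.card = 2 → σ ∈ S.faces)

/-- An edge as a face of a complex with complete `1`-skeleton. -/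
def edgeFace (e : Edge (v + 1)) : Face S 1 :=
  ⟨edgeSet e, hS _ (card_edgeSet e), card_edgeSet e⟩

theorem bijective_edgeFace : Function.Bijective (edgeFace hS) := by
  constructor
  · intro e e' h
    exact edgeSet_injective (congrArg Subtype.val h)
  · rintro ⟨σ, hσ, hcard⟩
    obtain ⟨e, rfl⟩ := exists_edgeSet_eq hcard
    exact ⟨e, rfl⟩

variable (R : Type) [CommRing R]

theorem mem_ker_boundary_iff (z : Face S 1 → R) :
    z ∈ LinearMap.ker (boundary R S 0) ↔
      (incMat R (v + 1)).mulVec (fun e => z (edgeFace hS e)) = 0 := by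
  have h : ∀ u, (boundaryMatrix R S 0).mulVec z (vertexFace S u) =
      (incMat R (v + 1)).mulVec (fun e => z (edgeFace hS e)) u := by
    intro u
    simp only [Matrix.mulVec, dotProduct]
    rw [← (Equiv.ofBijective _ (bijective_edgeFace hS)).sum_comp]
    refine Finset.sum_congr rfl fun e _ => ?_
    rw [boundaryMatrix_zero_apply S (vertexFace S u) _ u e rfl rfl]
    rfl
  rw [LinearMap.mem_ker, boundary, Matrix.mulVecLin_apply]
  constructor
  · intro h0
    ext u
    rw [← h, h0]
    rfl
  · intro h0
    ext τ
    obtain ⟨u, rfl⟩ := vertexFace_surjective S τ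
    rw [h, h0]
    rfl

/-- Restriction of `1`-chains to the edges avoiding the vertex `0`. -/
def restrictChain : (Face S 1 → R) →ₗ[R] (Edge v → R) :=
  LinearMap.funLeft R R fun e => edgeFace hS (succEdge e)

/-- The edges at `0` form a spanning tree: the values of a cycle there are forced by, and can be
solved for from, arbitrary values on the other edges. -/
theorem bijective_restrictChain_ker : Function.Bijective
    ((restrictChain hS R).comp (LinearMap.ker (boundary R S 0)).subtype) := by
  constructor
  · rw [← LinearMap.ker_eq_bot, LinearMap.ker_eq_bot']
    rintro ⟨z, hz⟩ h
    rw [mem_ker_boundary_iff hS, mulVec_incMat_eq_zero_iff] at hz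
    have hsucc : ∀ e, z (edgeFace hS (succEdge e)) = 0 := fun e => congrFun h e
    have hbase : ∀ u, z (edgeFace hS (baseEdge u)) = 0 := by
      intro u
      rw [hz u]
      simp only [hsucc]
      simp [Matrix.mulVec, dotProduct]
    apply Subtype.ext
    ext σ
    obtain ⟨e, rfl⟩ := (bijective_edgeFace hS).2 σ
    obtain ⟨b | e, rfl⟩ := bijective_edge.2 e
    · exact hbase b
    · exact hsucc e
  · intro w
    let E1 := Equiv.ofBijective _ (bijective_edge (v := v))
    let E2 := Equiv.ofBijective _ (bijective_edgeFace hS)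
    let z : Face S 1 → R := fun σ =>
      Sum.elim (fun u => -(incMat R v).mulVec w u) w (E1.symm (E2.symm σ))
    have hz : ∀ x, z (edgeFace hS (Sum.elim baseEdge succEdge x)) =
        Sum.elim (fun u => -(incMat R v).mulVec w u) w x := by
      intro x
      have h2 : E2.symm (edgeFace hS (Sum.elim baseEdge succEdge x)) =
          Sum.elim baseEdge succEdge x := E2.symm_apply_apply _
      have h1 : E1.symm (Sum.elim baseEdge succEdge x) = x := E1.symm_apply_apply _
      simp only [z, h2, h1]
    refine ⟨⟨z, ?_⟩, ?_⟩
    · rw [mem_ker_boundary_iff hS, mulVec_incMat_eq_zero_iff]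
      intro u
      have h1 : ∀ e, z (edgeFace hS (succEdge e)) = w e := fun e => hz (Sum.inr e)
      simp only [h1]
      exact hz (Sum.inl u)
    · ext e
      exact hz (Sum.inr e)

/-- The boundary of a triangle, restricted to the edges avoiding the vertex `0`. -/
def colVec (t : Col v) : Edge v → R := fun e => colMat R v e t

theorem boundary_single (t : triangles S) (e : Edge (v + 1)) :
    boundary R S 1 (Pi.single (triFace S t) 1) (edgeFace hS e) =
      triMat R (v + 1) e (colTri t.1) := by
  rw [boundary, Matrix.mulVecLin_apply, Matrix.mulVec_single_one]
  exact boundaryMatrix_one_apply S (edgeFace hS e) (triFace S t) e (colTri t.1) rfl rfl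

theorem range_boundary_eq : LinearMap.range (boundary R S 1) =
    Submodule.span R
      (Set.range fun t : triangles S => boundary R S 1 (Pi.single (triFace S t) 1)) := by
  rw [LinearMap.range_eq_map, ← (Pi.basisFun R (Face S 2)).span_eq, Submodule.map_span]
  congr 1
  rw [← Set.range_comp, ← (bijective_triFace S).2.range_comp]
  congr 1
  ext t
  simp

theorem range_boundary_le (hS : ∀ σ : Finset (Fin (v + 1)), σ.card = 2 → σ ∈ S.faces) :
    LinearMap.range (boundary R S 1) ≤ LinearMap.ker (boundary R S 0) := by
  rw [range_boundary_eq, Submodule.span_le]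
  rintro _ ⟨t, rfl⟩
  rw [SetLike.mem_coe, mem_ker_boundary_iff hS]
  simp only [boundary_single]
  ext u
  have h := congrFun (congrFun (incMat_mul_triMat (R := R) (v := v + 1)) u) (colTri t.1)
  rw [Matrix.mul_apply] at h
  exact h

theorem map_range_boundary : (LinearMap.range (boundary R S 1)).map (restrictChain hS R) =
    Submodule.span R (colVec R '' (triangles S : Set (Col v))) := by
  rw [range_boundary_eq, Submodule.map_span]
  congr 1
  rw [← Set.range_comp, Set.image_eq_range]
  congr 1
  ext t e
  simp only [Function.comp_apply, restrictChain, LinearMap.funLeft_apply, boundary_single]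
  exact triMat_succEdge_colTri e t.1

/-- The first homology as the cokernel of the boundary matrix without the rows of the edges at the
vertex `0`. -/
def homologyEquiv : H1 R S ≃ₗ[R]
    (Edge v → R) ⧸ Submodule.span R (colVec R '' (triangles S : Set (Col v))) :=
  Submodule.Quotient.equiv _ _ (LinearEquiv.ofBijective _ (bijective_restrictChain_ker hS R)) (by
    rw [← map_range_boundary hS]
    have h := range_boundary_le R hS
    ext w
    constructor
    · rintro ⟨x, hx, rfl⟩
      exact ⟨x.1, hx, rfl⟩
    · rintro ⟨x, hx, rfl⟩
      exact ⟨⟨x, h hx⟩, hx, rfl⟩)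

end Homology

/-! ### Order and finiteness of the cokernel of an integral square matrix. -/

section Index

variable {ι : Type*} [Fintype ι] [DecidableEq ι]

theorem card_quotient_range (A : Matrix ι ι ℤ) (hdet : A.det ≠ 0) :
    Nat.card ((ι → ℤ) ⧸ LinearMap.range A.mulVecLin) = A.det.natAbs := by
  have hinj : Function.Injective A.mulVecLin := by
    rw [← LinearMap.ker_eq_bot, LinearMap.ker_eq_bot']
    exact fun x hx => Matrix.eq_zero_of_mulVec_eq_zero hdet hx
  rw [← Submodule.natAbs_det_equiv (LinearMap.range A.mulVecLin)
    (LinearEquiv.ofInjective A.mulVecLin hinj), ← LinearMap.det_toLin']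
  congr 1

/-- If the determinant vanishes, a nonzero integral `w` with w A = 0 descends to a functional on the
cokernel that is injective on the multiples of some coordinate vector. -/
theorem finite_quotient_range_iff (A : Matrix ι ι ℤ) :
    Finite ((ι → ℤ) ⧸ LinearMap.range A.mulVecLin) ↔ A.det ≠ 0 := by
  constructor
  · intro hfin hdet
    obtain ⟨w, hw0, hw⟩ := Matrix.exists_vecMul_eq_zero_iff.2 hdet
    obtain ⟨i, hi⟩ := Function.ne_iff.1 hw0
    let f : (ι → ℤ) →ₗ[ℤ] ℤ := dotProductBilin ℤ ℤ w
    have hf : LinearMap.range A.mulVecLin ≤ LinearMap.ker f := by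
      rintro _ ⟨x, rfl⟩
      change w ⬝ᵥ (A.mulVec x) = 0
      rw [Matrix.dotProduct_mulVec, hw, zero_dotProduct]
    have hinj : Function.Injective fun k : ℤ =>
        (LinearMap.range A.mulVecLin).liftQ f hf (Submodule.Quotient.mk (Pi.single i k)) := by
      intro k l hkl
      have h1 : ∀ k : ℤ, (LinearMap.range A.mulVecLin).liftQ f hf
          (Submodule.Quotient.mk (Pi.single i k)) = w i * k := by
        intro k
        change w ⬝ᵥ (Pi.single i k) = _
        rw [dotProduct_single]
      simp only [h1] at hkl
      exact mul_left_cancel₀ hi hkl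
    have hinj' : Function.Injective fun k : ℤ =>
        (Submodule.Quotient.mk (Pi.single i k) : (ι → ℤ) ⧸ LinearMap.range A.mulVecLin) :=
      fun k l hkl => hinj (congrArg _ hkl)
    exact not_finite_iff_infinite.2 (Infinite.of_injective _ hinj') hfin
  · intro hdet
    refine Nat.finite_of_card_ne_zero ?_
    rw [card_quotient_range A hdet]
    exact Int.natAbs_ne_zero.2 hdet

end Index

/-! ### The determinantal measure on sets of triangles. -/

section Measure

variable {v : ℕ}

/-- The squared determinant of the columns in `T` of the boundary matrix. -/
def gramDet (T : Finset (Col v)) : ℝ := (maskedGram (colMat ℝ v) T).det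

theorem colMat_map {R R' : Type*} [CommRing R] [CommRing R'] (φ : R →+* R') :
    (colMat R v).map φ = colMat R' v := by
  ext e t
  rcases t with e' | t
  · simp only [Matrix.map_apply, colMat_inl, apply_ite φ, map_one, map_zero]
  · simp only [Matrix.map_apply, colMat_inr, triMat, coeff, Matrix.of_apply, map_add, map_sub,
      apply_ite φ, map_one, map_zero]

theorem gramDet_eq_sq (T : Finset (Col v)) (e : Edge v ≃ T) :
    gramDet T = (((Matrix.of fun i j => colMat ℤ v i (e j)).det : ℤ) : ℝ) ^ 2 := by
  rw [gramDet, ← colMat_map (Int.castRingHom ℝ), maskedGram_map, ← RingHom.mapMatrix_apply, ← RingHom.map_det,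
    det_maskedGram_of_equiv _ T e]
  simp

theorem exists_equiv_of_card {T : Finset (Col v)} (hT : T.card = v.choose 2) :
    Nonempty (Edge v ≃ T) :=
  ⟨Fintype.equivOfCardEq (by rw [card_edge, Fintype.card_coe, hT])⟩

theorem gramDet_nonneg {T : Finset (Col v)} (hT : T.card = v.choose 2) : 0 ≤ gramDet T := by
  obtain ⟨e⟩ := exists_equiv_of_card hT
  rw [gramDet_eq_sq T e]
  positivity

theorem span_colVec_eq_range (T : Finset (Col v)) (e : Edge v ≃ T) :
    Submodule.span ℤ (colVec ℤ '' (T : Set (Col v))) =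
      LinearMap.range (Matrix.of fun i j => colMat ℤ v i (e j)).mulVecLin := by
  rw [Matrix.range_mulVecLin, Set.image_eq_range]
  congr 1
  rw [← e.surjective.range_comp]
  rfl

variable {S : AbstractSimplicialComplex (Fin (v + 1))}

theorem finite_homology_iff (hS : ∀ σ : Finset (Fin (v + 1)), σ.card = 2 → σ ∈ S.faces)
    (hT : (triangles S).card = v.choose 2) :
    Finite (H1 ℤ S) ↔ gramDet (triangles S) ≠ 0 := by
  obtain ⟨e⟩ := exists_equiv_of_card hT
  rw [(homologyEquiv hS ℤ).toEquiv.finite_iff, span_colVec_eq_range _ e,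
    finite_quotient_range_iff, gramDet_eq_sq _ e]
  simp

theorem card_homology_sq (hS : ∀ σ : Finset (Fin (v + 1)), σ.card = 2 → σ ∈ S.faces)
    (hT : (triangles S).card = v.choose 2) (hfin : Finite (H1 ℤ S)) :
    (Nat.card (H1 ℤ S) : ℝ) ^ 2 = gramDet (triangles S) := by
  have h0 := (finite_homology_iff hS hT).1 hfin
  obtain ⟨e⟩ := exists_equiv_of_card hT
  rw [gramDet_eq_sq _ e] at h0 ⊢
  have hdet : (Matrix.of fun i j => colMat ℤ v i (e j)).det ≠ 0 := by
    intro h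
    simp [h] at h0
  rw [Nat.card_congr (homologyEquiv hS ℤ).toEquiv, span_colVec_eq_range _ e,
    card_quotient_range _ hdet, Nat.cast_natAbs, Int.cast_abs, sq_abs]

/-- The complex with complete `1`-skeleton and the given triangles. -/
def complexOf (T : Finset (Col v)) : AbstractSimplicialComplex (Fin (v + 1)) where
  faces := {σ | σ.Nonempty ∧ (σ.card ≤ 2 ∨ ∃ t ∈ T, σ = triSet (colTri t))}
  isRelLowerSet_faces := by
    rintro σ ⟨hne, h⟩
    refine ⟨hne, fun τ hτ hne' => ⟨hne', ?_⟩⟩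
    rcases h with h | ⟨t, ht, rfl⟩
    · exact Or.inl ((Finset.card_le_card hτ).trans h)
    · rcases eq_or_ne τ (triSet (colTri t)) with rfl | hne2
      · exact Or.inr ⟨t, ht, rfl⟩
      · left
        have := Finset.card_lt_card (lt_of_le_of_ne hτ hne2)
        rw [card_triSet] at this
        omega
  singleton_mem u := ⟨Finset.singleton_nonempty u, Or.inl (by simp)⟩

theorem triangles_complexOf (T : Finset (Col v)) : triangles (complexOf T) = T := by
  ext t
  rw [mem_triangles]
  constructor
  · rintro ⟨-, h | ⟨t', ht', h⟩⟩
    · rw [card_triSet] at h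
      omega
    · rwa [bijective_colTri.1 (triSet_injective h)]
  · intro ht
    exact ⟨Finset.card_pos.1 (by rw [card_triSet]; norm_num), Or.inr ⟨t, ht, rfl⟩⟩

theorem complexOf_complete (T : Finset (Col v)) (σ : Finset (Fin (v + 1))) (hσ : σ.card = 2) :
    σ ∈ (complexOf T).faces :=
  ⟨Finset.card_pos.1 (by omega), Or.inl hσ.le⟩

theorem isHypertree_complexOf {T : Finset (Col v)} (hT : T.card = v.choose 2)
    (h0 : gramDet T ≠ 0) : IsHypertree (complexOf T) where
  dim_le_two := by
    rintro σ ⟨-, h | ⟨t, -, rfl⟩⟩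
    · omega
    · rw [card_triSet]
  complete_skeleton := complexOf_complete T
  card_triangles := by
    rw [card_face_two, triangles_complexOf, hT, Nat.add_sub_cancel]
  finite_homology := by
    rw [finite_homology_iff (complexOf_complete T) (by rw [triangles_complexOf, hT]),
      triangles_complexOf]
    exact h0

theorem IsHypertree.card_triangles_eq (hS : IsHypertree S) :
    (triangles S).card = v.choose 2 := by
  rw [← card_face_two, hS.card_triangles, Nat.add_sub_cancel]

theorem triangles_injective :
    Function.Injective fun S : Hypertree (v + 1) => triangles S.1 := by
  have key : ∀ S S' : Hypertree (v + 1), triangles S.1 = triangles S'.1 →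
      S.1.faces ⊆ S'.1.faces := by
    intro S S' h σ hσ
    have hne : σ.Nonempty := (S.1.isRelLowerSet_faces hσ).1
    have h1 := Finset.card_pos.2 hne
    have h3 := S.2.dim_le_two σ hσ
    obtain h | h | h : σ.card = 1 ∨ σ.card = 2 ∨ σ.card = 3 := by omega
    · obtain ⟨u, rfl⟩ := Finset.card_eq_one.1 h
      exact S'.1.singleton_mem u
    · exact S'.2.complete_skeleton σ h
    · obtain ⟨t, rfl⟩ := exists_triSet_eq h
      obtain ⟨c, rfl⟩ := bijective_colTri.2 t
      rw [← mem_triangles] at hσ ⊢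
      rwa [← ‹triangles S.1 = triangles S'.1›]
  intro S S' h
  have hle := key S' S h.symm
  exact Subtype.ext (AbstractSimplicialComplex.ext (Set.Subset.antisymm (key S _ h) hle))

/-- The distribution of the triangles of the determinantal hypertree. -/
theorem sum_weight_mul (φ : Finset (Col v) → ℝ) :
    ∑ S : Hypertree (v + 1), weight S * φ (triangles S.1) =
      (∑ T ∈ Finset.univ.powersetCard (v.choose 2), gramDet T * φ T) /
        ((v : ℝ) + 1) ^ ((v - 1).choose 2) := by
  have hw : ∀ S : Hypertree (v + 1), weight S * φ (triangles S.1) =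
      gramDet (triangles S.1) * φ (triangles S.1) / ((v : ℝ) + 1) ^ ((v - 1).choose 2) := by
    intro S
    rw [weight, card_homology_sq S.2.complete_skeleton S.2.card_triangles_eq S.2.finite_homology,
      Nat.cast_succ, show v + 1 - 2 = v - 1 by omega]
    ring
  rw [Finset.sum_congr rfl fun S _ => hw S, ← Finset.sum_div]
  congr 1
  rw [← Finset.sum_image (f := fun T => gramDet T * φ T)
    (g := fun S : Hypertree (v + 1) => triangles S.1)
    (fun S _ S' _ h => triangles_injective h)]
  refine Finset.sum_subset ?_ ?_
  · intro T hT
    obtain ⟨S, -, rfl⟩ := Finset.mem_image.1 hT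
    exact Finset.mem_powersetCard.2 ⟨Finset.subset_univ _, S.2.card_triangles_eq⟩
  · intro T hT hT'
    have hcard := (Finset.mem_powersetCard.1 hT).2
    -- The sets of the right size that are missed come from complexes with infinite first homology,
    -- and these carry no weight.
    have h0 : gramDet T = 0 := by
      by_contra h0
      exact hT' (Finset.mem_image.2 ⟨⟨complexOf T, isHypertree_complexOf hcard h0⟩,
        Finset.mem_univ _, triangles_complexOf T⟩)
    rw [h0, zero_mul]

theorem weight_nonneg {n : ℕ} (S : Hypertree n) : 0 ≤ weight S := by
  rw [weight]
  positivity

/-- Cauchy–Binet over all columns, together with the closed form of the full Gram determinant. -/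
theorem sum_weight (hv : 1 ≤ v) : ∑ S : Hypertree (v + 1), weight S = 1 := by
  have h := sum_weight_mul (v := v) fun _ => 1
  simp only [mul_one] at h
  have h2 : ∑ T ∈ (Finset.univ : Finset (Col v)).powersetCard (v.choose 2), gramDet T =
      (maskedGram (colMat ℝ v) Finset.univ).det := by
    rw [cauchyBinet, card_edge]
    rfl
  rw [h, h2, det_maskedGram_colMat_univ hv, div_self (by positivity)]

end Measure

/-! ### Möbius bands and the weight of isolated families of them. -/

section Bands

variable {v : ℕ}

/-- The image of an edge under an increasing map. -/
def edgeMap {k : ℕ} (c : Fin k ↪o Fin v) (e : Edge k) : Edge v :=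
  ⟨(c e.1.1, c e.1.2), c.lt_iff_lt.2 e.2⟩

/-- The image of a triangle under an increasing map. -/
def triMap {k : ℕ} (c : Fin k ↪o Fin v) (t : Tri k) : Tri v :=
  ⟨(c t.1.1, c t.1.2.1, c t.1.2.2), c.lt_iff_lt.2 t.2.1, c.lt_iff_lt.2 t.2.2⟩

theorem triMat_map {R : Type*} [CommRing R] {k : ℕ} (c : Fin k ↪o Fin v) (e : Edge k) (t : Tri k) :
    triMat R v (edgeMap c e) (triMap c t) = triMat R k e t := by
  obtain ⟨⟨a, b⟩, hab⟩ := e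
  obtain ⟨⟨x, y, z⟩, hxy, hyz⟩ := t
  simp [triMat, coeff, edgeMap, triMap]

/-- The edges of the core circle of the Möbius band on five vertices. -/
def coreEdge : Fin 5 → Edge 5 :=
  ![⟨(0, 1), by decide⟩, ⟨(1, 2), by decide⟩, ⟨(2, 3), by decide⟩, ⟨(3, 4), by decide⟩,
    ⟨(0, 4), by decide⟩]

/-- The triangles of the Möbius band on five vertices. -/
def coreTri : Fin 5 → Tri 5 :=
  ![⟨(0, 1, 2), by decide⟩, ⟨(1, 2, 3), by decide⟩, ⟨(2, 3, 4), by decide⟩,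
    ⟨(0, 3, 4), by decide⟩, ⟨(0, 1, 4), by decide⟩]

/-- The boundary matrix of the Möbius band, restricted to the edges of its core circle. -/
def coreMat (R : Type*) [CommRing R] : Matrix (Fin 5) (Fin 5) R :=
  !![1, 0, 0, 0, 1; 1, 1, 0, 0, 0; 0, 1, 1, 0, 0; 0, 0, 1, 1, 0; 0, 0, 0, -1, -1]

theorem triMat_core {R : Type*} [CommRing R] (i j : Fin 5) :
    triMat R 5 (coreEdge i) (coreTri j) = coreMat R i j := by
  fin_cases i <;> fin_cases j <;> simp [triMat, coeff, coreEdge, coreTri, coreMat]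

/-- The determinant ±2 reflects that each triangle contains two consecutive edges of the core circle
and that the band is non-orientable. It is the source of the 2-torsion; the value is checked over ℤ,
where it is decidable. -/
theorem det_coreMat_sq : (coreMat ℝ).det ^ 2 = 4 := by
  have h : (coreMat ℝ) = (coreMat ℤ).map (Int.castRingHom ℝ) := by
    ext i j
    fin_cases i <;> fin_cases j <;> simp [coreMat]
  have h2 : (coreMat ℤ).det ^ 2 = 4 := by decide +kernel
  rw [h, ← RingHom.mapMatrix_apply, ← RingHom.map_det, ← map_pow, h2]
  norm_num

theorem coreMat_diag_ne_zero (i : Fin 5) : coreMat ℝ i i ≠ 0 := by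
  fin_cases i <;> simp [coreMat]

theorem coreEdge_injective : Function.Injective coreEdge := by decide

theorem coreTri_injective : Function.Injective coreTri := by decide

/-- The core edges of the Möbius band placed at `c`. -/
def bandEdge (c : Fin 5 ↪o Fin v) (i : Fin 5) : Edge v := edgeMap c (coreEdge i)

/-- The triangles of the Möbius band placed at `c`. -/
def bandTri (c : Fin 5 ↪o Fin v) (i : Fin 5) : Tri v := triMap c (coreTri i)

theorem triMat_band {R : Type*} [CommRing R] (c : Fin 5 ↪o Fin v) (i j : Fin 5) :
    triMat R v (bandEdge c i) (bandTri c j) = coreMat R i j := by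
  rw [bandEdge, bandTri, triMat_map, triMat_core]

theorem bandEdge_injective (c : Fin 5 ↪o Fin v) : Function.Injective (bandEdge c) := by
  intro i j h
  simp only [bandEdge, edgeMap, Subtype.mk.injEq, Prod.mk.injEq, EmbeddingLike.apply_eq_iff_eq] at h
  exact coreEdge_injective (Subtype.ext (Prod.ext h.1 h.2))

theorem bandTri_injective (c : Fin 5 ↪o Fin v) : Function.Injective (bandTri c) := by
  intro i j h
  simp only [bandTri, triMap, Subtype.mk.injEq, Prod.mk.injEq, EmbeddingLike.apply_eq_iff_eq] at h
  exact coreTri_injective (Subtype.ext (Prod.ext h.1 (Prod.ext h.2.1 h.2.2)))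

/-- The triangles in `T` with an edge in the core circle of the Möbius band placed at `c` are
precisely the triangles of this band. -/
def Isolated (c : Fin 5 ↪o Fin v) (T : Finset (Col v)) : Prop :=
  ∀ t, (t ∈ T ∧ ∃ i, colMat ℝ v (bandEdge c i) t ≠ 0) ↔ ∃ j, t = Sum.inr (bandTri c j)

theorem Isolated.mem {c : Fin 5 ↪o Fin v} {T : Finset (Col v)} (h : Isolated c T) (j : Fin 5) :
    Sum.inr (bandTri c j) ∈ T :=
  ((h _).2 ⟨j, rfl⟩).1

/-- Two bands that are both isolated in the same set of triangles do not meet, as soon as common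
vertices have the same position in both. -/
theorem Isolated.eq_of_ne_zero {c c' : Fin 5 ↪o Fin v} {T : Finset (Col v)} (h : Isolated c T)
    (h' : Isolated c' T) (hal : ∀ k k', c k = c' k' → k = k') {i j : Fin 5}
    (hij : triMat ℝ v (bandEdge c i) (bandTri c' j) ≠ 0) : c = c' := by
  -- A triangle of `c'` with an edge in the core of `c` lies in `T`, so isolation of `c` makes it a
  -- triangle of `c`. As common vertices occupy equal positions, the two bands then agree at its
  -- three positions.
  have agree : ∀ l, (∃ i, triMat ℝ v (bandEdge c i) (bandTri c' l) ≠ 0) →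
      c (coreTri l).1.1 = c' (coreTri l).1.1 ∧ c (coreTri l).1.2.1 = c' (coreTri l).1.2.1 ∧
        c (coreTri l).1.2.2 = c' (coreTri l).1.2.2 := by
    rintro l ⟨i, hi⟩
    obtain ⟨j, hj⟩ := (h (Sum.inr (bandTri c' l))).1 ⟨h'.mem l, i, by simpa using hi⟩
    have hj' := congrArg Subtype.val (Sum.inr_injective hj)
    simp only [bandTri, triMap, Prod.mk.injEq] at hj'
    have h1 := hal _ _ hj'.1.symm
    have h2 := hal _ _ hj'.2.1.symm
    have h3 := hal _ _ hj'.2.2.symm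
    rw [h1, h2, h3] at hj'
    exact ⟨hj'.1.symm, hj'.2.1.symm, hj'.2.2.symm⟩
  -- Triangle `l` contains the core edges `l` and `l + 1`, and triangle `l + 1` contains core edge
  -- `l + 1` again, so agreement propagates around the circle.
  have step : ∀ l, (∃ i, triMat ℝ v (bandEdge c i) (bandTri c' l) ≠ 0) →
      ∃ i, triMat ℝ v (bandEdge c i) (bandTri c' (l + 1)) ≠ 0 := by
    intro l hl
    obtain ⟨h1, h2, h3⟩ := agree l hl
    refine ⟨l + 1, ?_⟩
    have he : bandEdge c (l + 1) = bandEdge c' (l + 1) := by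
      apply Subtype.ext
      fin_cases l <;> simp_all [bandEdge, edgeMap, coreEdge, coreTri]
    rw [he, triMat_band]
    exact coreMat_diag_ne_zero _
  have all : ∀ d : ℕ, ∃ i, triMat ℝ v (bandEdge c i) (bandTri c' ((· + 1)^[d] j)) ≠ 0 := by
    intro d
    induction d with
    | zero => exact ⟨i, hij⟩
    | succ d ih =>
      rw [Function.iterate_succ_apply']
      exact step _ ih
  have all' : ∀ l, ∃ i, triMat ℝ v (bandEdge c i) (bandTri c' l) ≠ 0 := by
    intro l
    obtain ⟨d, rfl⟩ : ∃ d : Fin 5, (· + 1)^[d.val] j = l := by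
      clear * -
      revert j l
      decide
    exact all d.val
  -- Triangles 0 and 2 of the band together cover all five vertices.
  have a0 := agree 0 (all' 0)
  have a2 := agree 2 (all' 2)
  ext k
  fin_cases k
  · exact congrArg Fin.val a0.1
  · exact congrArg Fin.val a0.2.1
  · exact congrArg Fin.val a0.2.2
  · exact congrArg Fin.val a2.2.1
  · exact congrArg Fin.val a2.2.2

variable (C : Finset (Fin 5 ↪o Fin v))

/-- No triangle of a band in `C` has an edge in the core circle of another one. -/
def Separated : Prop :=
  ∀ c ∈ C, ∀ d ∈ C, c ≠ d → ∀ i j, triMat ℝ v (bandEdge c i) (bandTri d j) = 0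

/-- The core edges of a family of bands. -/
def coreEdges : Finset (Edge v) :=
  Finset.univ.image fun p : C × Fin 5 => bandEdge p.1.1 p.2

variable {C}

theorem injective_bandEdge_of_separated (hC : Separated C) :
    Function.Injective fun p : C × Fin 5 => bandEdge p.1.1 p.2 := by
  rintro ⟨⟨c, hc⟩, i⟩ ⟨⟨c', hc'⟩, i'⟩ h
  dsimp only at h
  have hcc : c = c' := by
    by_contra hne
    have := hC c hc c' hc' hne i i'
    rw [h, triMat_band] at this
    exact coreMat_diag_ne_zero _ this
  subst hcc
  rw [bandEdge_injective c h]

theorem injective_bandTri_of_separated (hC : Separated C) :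
    Function.Injective fun p : C × Fin 5 => bandTri p.1.1 p.2 := by
  rintro ⟨⟨c, hc⟩, i⟩ ⟨⟨c', hc'⟩, i'⟩ h
  dsimp only at h
  have hcc : c = c' := by
    by_contra hne
    have := hC c hc c' hc' hne i i'
    rw [← h, triMat_band] at this
    exact coreMat_diag_ne_zero _ this
  subst hcc
  rw [bandTri_injective c h]

theorem card_coreEdges (hC : Separated C) : (coreEdges C).card = 5 * C.card := by
  rw [coreEdges, Finset.card_image_of_injective _ (injective_bandEdge_of_separated hC),
    Finset.card_univ, Fintype.card_prod, Fintype.card_coe, Fintype.card_fin, mul_comm]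

theorem mem_coreEdges {e : Edge v} : e ∈ coreEdges C ↔ ∃ c ∈ C, ∃ i, bandEdge c i = e := by
  simp [coreEdges]

/-- The bijection between core edges and triangles. -/
theorem exists_matching (hC : Separated C) (hne : C.Nonempty) :
    ∃ τ : Edge v → Tri v, ∀ c ∈ C, ∀ i, τ (bandEdge c i) = bandTri c i := by
  obtain ⟨c₀, -⟩ := hne
  refine ⟨Function.extend (fun p : C × Fin 5 => bandEdge p.1.1 p.2)
    (fun p => bandTri p.1.1 p.2) fun _ => bandTri c₀ 0, fun c hc i => ?_⟩
  exact (injective_bandEdge_of_separated hC).extend_apply _ _ (⟨c, hc⟩, i)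

theorem det_toSquareBlockProp_eq {m k : Type*} [Fintype m] [DecidableEq m] [Fintype k]
    [DecidableEq k] (M : Matrix m m ℝ) (p : m → Prop) [DecidablePred p] (f : k → m)
    (hf : Function.Injective f) (hp : ∀ a, p a ↔ ∃ x, f x = a) :
    (M.toSquareBlockProp p).det = (M.submatrix f f).det := by
  let g : k ≃ {a // p a} := Equiv.ofBijective (fun x => ⟨f x, (hp _).2 ⟨x, rfl⟩⟩)
    ⟨fun x y h => hf (congrArg Subtype.val h), fun ⟨a, ha⟩ => by
      obtain ⟨x, rfl⟩ := (hp a).1 ha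
      exact ⟨x, rfl⟩⟩
  rw [← Matrix.det_submatrix_equiv_self g]
  rfl

/-- The matrix is block triangular, with the identity outside the core edges. By separation its
block on the core edges splits into one copy of `coreMat` per band. -/
theorem det_replaced_sq (hC : Separated C) {τ : Edge v → Tri v}
    (hτ : ∀ c ∈ C, ∀ i, τ (bandEdge c i) = bandTri c i) :
    (replaced (coreEdges C) (coreEdges C) τ).det ^ 2 = 4 ^ C.card := by
  have hinj := injective_bandEdge_of_separated hC
  rw [Matrix.twoBlockTriangular_det' _ (· ∈ coreEdges C)]
  swap
  · intro i hi j hj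
    have : i ≠ j := fun h => hj (h ▸ hi)
    simp [replaced, hj, this]
  have h1 : (replaced (coreEdges C) (coreEdges C) τ).toSquareBlockProp (fun i => ¬ i ∈ coreEdges C)
      = 1 := by
    ext i j
    simp [Matrix.toSquareBlockProp, replaced, j.2, Matrix.one_apply, Subtype.ext_iff]
  have h2 : (replaced (coreEdges C) (coreEdges C) τ).submatrix
      (fun p : Fin 5 × C => bandEdge p.2.1 p.1) (fun p : Fin 5 × C => bandEdge p.2.1 p.1) =
      Matrix.blockDiagonal fun _ : C => coreMat ℝ := by
    ext ⟨i, c, hc⟩ ⟨j, c', hc'⟩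
    have hmem : bandEdge c' j ∈ coreEdges C := mem_coreEdges.2 ⟨c', hc', j, rfl⟩
    rw [Matrix.blockDiagonal_apply]
    simp only [Matrix.submatrix_apply, replaced, Matrix.of_apply, hmem, if_true, hτ c' hc' j,
      Subtype.mk.injEq]
    split_ifs with h
    · rw [h, triMat_band]
    · exact hC c hc c' hc' h i j
  rw [h1, Matrix.det_one, mul_one, det_toSquareBlockProp_eq _ _
    (fun p : Fin 5 × C => bandEdge p.2.1 p.1), h2, Matrix.det_blockDiagonal, Finset.prod_const,
    ← pow_mul, mul_comm, pow_mul, det_coreMat_sq, Finset.card_univ, Fintype.card_coe]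
  · intro p q h
    have := hinj (a₁ := (p.2, p.1)) (a₂ := (q.2, q.1)) h
    simp only [Prod.mk.injEq] at this
    exact Prod.ext this.2 this.1
  · intro a
    rw [mem_coreEdges]
    constructor
    · rintro ⟨c, hc, i, rfl⟩
      exact ⟨(i, ⟨c, hc⟩), rfl⟩
    · rintro ⟨p, rfl⟩
      exact ⟨p.2.1, p.2.2, p.1, rfl⟩

/-- The two directions of isolation become two conditions on `T`: it contains no foreign triangle
with a core edge, and it contains every triangle of the bands. -/
theorem isolated_iff (hC : Separated C) {τ : Edge v → Tri v}
    (hτ : ∀ c ∈ C, ∀ i, τ (bandEdge c i) = bandTri c i) (T : Finset (Col v)) :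
    (∀ c ∈ C, Isolated c T) ↔ T ⊆ allowed (coreEdges C) (coreEdges C) τ ∧
      ∀ a ∈ coreEdges C, Sum.inr (τ a) ∈ T := by
  constructor
  · intro h
    constructor
    · rintro (e | t) ht
      · rw [allowed, Finset.inl_mem_disjSum, Finset.mem_compl]
        intro he
        obtain ⟨c, hc, i, rfl⟩ := mem_coreEdges.1 he
        obtain ⟨j, hj⟩ := (h c hc _).1 ⟨ht, i, by simp⟩
        exact Sum.inl_ne_inr hj
      · rw [allowed, Finset.inr_mem_disjSum, Finset.mem_union, Finset.mem_compl, or_iff_not_imp_right,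
          not_not]
        intro hs
        obtain ⟨a, ha, hat⟩ := (Finset.mem_filter.1 hs).2
        obtain ⟨c, hc, i, rfl⟩ := mem_coreEdges.1 ha
        obtain ⟨j, hj⟩ := (h c hc _).1 ⟨ht, i, by simpa using hat⟩
        rw [Sum.inr_injective hj, ← hτ c hc j]
        exact Finset.mem_image_of_mem _ (mem_coreEdges.2 ⟨c, hc, j, rfl⟩)
    · intro a ha
      obtain ⟨c, hc, i, rfl⟩ := mem_coreEdges.1 ha
      rw [hτ c hc i]
      exact (h c hc).mem i
  · rintro ⟨hsub, hmem⟩ c hc t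
    constructor
    · rintro ⟨ht, i, hi⟩
      have hall := hsub ht
      have hmemi : bandEdge c i ∈ coreEdges C := mem_coreEdges.2 ⟨c, hc, i, rfl⟩
      rcases t with e | t
      · rw [allowed, Finset.inl_mem_disjSum, Finset.mem_compl] at hall
        have : bandEdge c i = e := by
          by_contra hne
          simp [hne] at hi
        exact absurd (this ▸ hmemi) hall
      · rw [allowed, Finset.inr_mem_disjSum, Finset.mem_union, Finset.mem_compl] at hall
        rw [colMat_inr] at hi
        rcases hall with hall | hall
        · obtain ⟨a, ha, rfl⟩ := Finset.mem_image.1 hall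
          obtain ⟨c', hc', j, rfl⟩ := mem_coreEdges.1 ha
          rw [hτ c' hc' j] at hi ⊢
          have : c = c' := by
            by_contra hne
            exact hi (hC c hc c' hc' hne i j)
          subst this
          exact ⟨j, rfl⟩
        · exact absurd (triMat_eq_zero_of_mem hmemi hall) hi
    · rintro ⟨j, rfl⟩
      refine ⟨?_, j, ?_⟩
      · rw [← hτ c hc j]
        exact hmem _ (mem_coreEdges.2 ⟨c, hc, j, rfl⟩)
      · rw [colMat_inr, triMat_band]
        exact coreMat_diag_ne_zero j

/-- By Cauchy–Binet the subsets of the allowed columns have total weight 4^|C| det(1 + `offGram`).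
Those omitting a band triangle have total weight zero, since `replaced` then has a zero column;
being nonnegative, their weights vanish one by one, so only the isolated sets contribute. -/
theorem sum_gramDet_isolated (hC : Separated C) (hne : C.Nonempty)
    [DecidablePred fun T : Finset (Col v) => ∀ c ∈ C, Isolated c T] :
    ∑ T ∈ Finset.univ.powersetCard (v.choose 2) with ∀ c ∈ C, Isolated c T, gramDet T =
      4 ^ C.card * (1 + offGram (coreEdges C)).det := by
  obtain ⟨τ, hτ⟩ := exists_matching hC hne
  set A := coreEdges C with hA
  have hinj : Set.InjOn τ A := by
    intro a ha b hb hab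
    obtain ⟨c, hc, i, rfl⟩ := mem_coreEdges.1 ha
    obtain ⟨c', hc', j, rfl⟩ := mem_coreEdges.1 hb
    rw [hτ c hc i, hτ c' hc' j] at hab
    have := injective_bandTri_of_separated hC (a₁ := (⟨c, hc⟩, i)) (a₂ := (⟨c', hc'⟩, j)) hab
    simp only [Prod.mk.injEq, Subtype.mk.injEq] at this
    rw [this.1, this.2]
  have hstar : ∀ a ∈ A, τ a ∈ star A := by
    intro a ha
    obtain ⟨c, hc, i, rfl⟩ := mem_coreEdges.1 ha
    refine Finset.mem_filter.2 ⟨Finset.mem_univ _, _, ha, ?_⟩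
    rw [hτ c hc i, triMat_band]
    exact coreMat_diag_ne_zero i
  have hzero : ∀ T, T.card = v.choose 2 → T ⊆ allowed A A τ → ∀ a ∈ A, Sum.inr (τ a) ∉ T →
      gramDet T = 0 := by
    intro T hcard hsub a ha haT
    have hsub' : T ⊆ allowed A (A.erase a) τ := by
      rintro (e | t) ht
      · simpa [allowed] using hsub ht
      · have h1 := hsub ht
        rw [allowed, Finset.inr_mem_disjSum, Finset.mem_union] at h1 ⊢
        rcases h1 with h1 | h1
        · left
          obtain ⟨b, hb, rfl⟩ := Finset.mem_image.1 h1
          refine Finset.mem_image_of_mem _ (Finset.mem_erase.2 ⟨?_, hb⟩)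
          rintro rfl
          exact haT ht
        · exact Or.inr h1
    have h2 := det_maskedGram_allowed (A.erase_subset a)
      (hinj.mono (Finset.coe_subset.2 (A.erase_subset a)))
      fun b hb => hstar b (A.erase_subset a hb)
    rw [det_replaced_eq_zero ha (Finset.notMem_erase a A), zero_pow two_ne_zero, zero_mul,
      cauchyBinet, card_edge] at h2
    refine (Finset.sum_eq_zero_iff_of_nonneg ?_).1 h2 T (Finset.mem_powersetCard.2 ⟨hsub', hcard⟩)
    exact fun T' hT' => gramDet_nonneg (Finset.mem_powersetCard.1 hT').2
  have h3 := det_maskedGram_allowed (subset_refl A) hinj hstar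
  rw [det_replaced_sq hC hτ, cauchyBinet, card_edge] at h3
  rw [← h3]
  refine Finset.sum_subset_zero_on_sdiff ?_ ?_ fun T _ => rfl
  · intro T hT
    obtain ⟨h1, h2⟩ := Finset.mem_filter.1 hT
    exact Finset.mem_powersetCard.2
      ⟨((isolated_iff hC hτ T).1 h2).1, (Finset.mem_powersetCard.1 h1).2⟩
  · intro T hT
    obtain ⟨h1, h2⟩ := Finset.mem_sdiff.1 hT
    obtain ⟨hsub, hcard⟩ := Finset.mem_powersetCard.1 h1
    have : ∃ a ∈ A, Sum.inr (τ a) ∉ T := by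
      by_contra! hall
      exact h2 (Finset.mem_filter.2
        ⟨Finset.mem_powersetCard.2 ⟨Finset.subset_univ _, hcard⟩,
          (isolated_iff hC hτ T).2 ⟨hsub, hall⟩⟩)
    obtain ⟨a, ha, haT⟩ := this
    exact hzero T hcard hsub a ha haT

end Bands

/-! ### Probabilities of isolation and the second moment inequality. -/

section SecondMoment

variable {v : ℕ}

open Classical in
/-- The probability that the set of triangles of the determinantal hypertree satisfies `E`. -/
def colProb (E : Finset (Col v) → Prop) : ℝ :=
  (∑ T ∈ Finset.univ.powersetCard (v.choose 2) with E T, gramDet T) /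
    ((v : ℝ) + 1) ^ ((v - 1).choose 2)

/-- Each band costs a factor 1 / (v + 1) for each of its five core edges and gains the factor 4 of
its squared determinant; the exponentials come from `det_one_add_offGram_bounds` with |A| = 5|C|. -/
theorem colProb_isolated_bounds (hv : 1 ≤ v) {C : Finset (Fin 5 ↪o Fin v)} (hC : Separated C)
    (hne : C.Nonempty) (hcard : 30 * C.card ≤ v + 1) :
    (4 / ((v : ℝ) + 1) ^ 5) ^ C.card * Real.exp (-(30 * (C.card : ℝ))) ≤
        colProb (fun T => ∀ c ∈ C, Isolated c T) ∧
      colProb (fun T => ∀ c ∈ C, Isolated c T) ≤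
        (4 / ((v : ℝ) + 1) ^ 5) ^ C.card * Real.exp (20 * (C.card : ℝ) / ((v : ℝ) + 1)) := by
  have hA := card_coreEdges hC
  obtain ⟨h1, h2⟩ := det_one_add_offGram_bounds hv (A := coreEdges C) (by omega)
  rw [hA] at h1 h2
  have h0 := @sum_gramDet_isolated v C hC hne (fun _ => Classical.propDecidable _)
  rw [colProb, h0]
  set x : ℝ := (v : ℝ) + 1 with hx
  have hxpos : 0 < x := by positivity
  set G := (1 + offGram (coreEdges C)).det
  have e1 : -(6 * ((5 * C.card : ℕ) : ℝ)) = -(30 * (C.card : ℝ)) := by push_cast; ring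
  have e2 : 4 * ((5 * C.card : ℕ) : ℝ) / x = 20 * (C.card : ℝ) / x := by push_cast; ring
  rw [e1] at h1
  rw [e2] at h2
  rw [pow_mul] at h1 h2
  have hpos : 0 < (x ^ 5) ^ C.card := by positivity
  have hpos2 : 0 < x ^ (v - 1).choose 2 := by positivity
  constructor
  · rw [le_div_iff₀ hpos2, div_pow, div_mul_eq_mul_div, div_mul_eq_mul_div, div_le_iff₀ hpos]
    have := mul_le_mul_of_nonneg_left h1 (by positivity : (0 : ℝ) ≤ 4 ^ C.card)
    linarith
  · rw [div_le_iff₀ hpos2, div_pow, div_mul_eq_mul_div, div_mul_eq_mul_div, le_div_iff₀ hpos]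
    have := mul_le_mul_of_nonneg_left h2 (by positivity : (0 : ℝ) ≤ 4 ^ C.card)
    linarith

open Classical in
theorem colProb_nonneg (E : Finset (Col v) → Prop) : 0 ≤ colProb E :=
  div_nonneg (Finset.sum_nonneg fun T hT =>
    gramDet_nonneg (Finset.mem_powersetCard.1 (Finset.mem_filter.1 hT).1).2) (by positivity)

-- For a separated family the error exp(20|C| / (v + 1)) is at most e^|C| ≤ 3^|C|, which turns 4
-- into 12. A family that is not separated, with aligned positions, is never isolated as a whole, by
-- `Isolated.eq_of_ne_zero`.
open Classical in
theorem colProb_isolated_le (hv : 20 ≤ v) {C : Finset (Fin 5 ↪o Fin v)}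
    (hal : ∀ c ∈ C, ∀ c' ∈ C, ∀ k k', c k = c' k' → k = k')
    (hne : C.Nonempty) (hcard : 30 * C.card ≤ v + 1) :
    colProb (fun T => ∀ c ∈ C, Isolated c T) ≤ (12 / ((v : ℝ) + 1) ^ 5) ^ C.card := by
  by_cases hC : Separated C
  · refine (colProb_isolated_bounds (by omega) hC hne hcard).2.trans ?_
    have h1 : Real.exp (20 * (C.card : ℝ) / ((v : ℝ) + 1)) ≤ 3 ^ C.card := by
      have h2 : Real.exp (20 * (C.card : ℝ) / ((v : ℝ) + 1)) ≤ Real.exp C.card := by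
        apply Real.exp_le_exp.2
        rw [div_le_iff₀ (by positivity)]
        have : (20 : ℝ) ≤ v := by exact_mod_cast hv
        nlinarith [(Nat.cast_nonneg C.card : (0 : ℝ) ≤ C.card)]
      refine h2.trans ?_
      rw [← Real.exp_one_pow]
      exact pow_le_pow_left₀ (Real.exp_pos 1).le (by linarith [Real.exp_one_lt_d9]) _
    calc (4 / ((v : ℝ) + 1) ^ 5) ^ C.card * Real.exp (20 * (C.card : ℝ) / ((v : ℝ) + 1))
        ≤ (4 / ((v : ℝ) + 1) ^ 5) ^ C.card * 3 ^ C.card := by gcongr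
      _ = _ := by
        rw [← mul_pow]
        congr 1
        ring
  · have : colProb (fun T => ∀ c ∈ C, Isolated c T) = 0 := by
      rw [colProb, Finset.sum_eq_zero, zero_div]
      intro T hT
      refine absurd ?_ hC
      intro c hc c' hc' hcc i j
      by_contra hij
      obtain ⟨-, hiso⟩ := by simpa only [Finset.mem_filter] using hT
      exact hcc ((hiso c hc).eq_of_ne_zero (hiso c' hc') (hal c hc c' hc') hij)
    rw [this]
    positivity

open Classical in
/-- The second moment method. -/
theorem sq_sum_colProb_le {ι : Type*} [Fintype ι] (E : ι → Finset (Col v) → Prop) :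
    (∑ x, colProb (E x)) ^ 2 ≤
      (∑ x, ∑ y, colProb fun T => E x T ∧ E y T) * colProb fun T => ∃ x, E x T := by
  set Ω := (Finset.univ : Finset (Col v)).powersetCard (v.choose 2) with hΩ
  set w : Finset (Col v) → ℝ := fun T => gramDet T / ((v : ℝ) + 1) ^ ((v - 1).choose 2) with hw
  have hw0 : ∀ T ∈ Ω, 0 ≤ w T := fun T hT =>
    div_nonneg (gramDet_nonneg (Finset.mem_powersetCard.1 hT).2) (by positivity)
  have hprob : ∀ F : Finset (Col v) → Prop, colProb F = ∑ T ∈ Ω, w T * if F T then 1 else 0 := by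
    intro F
    rw [colProb, Finset.sum_div, Finset.sum_filter]
    exact Finset.sum_congr rfl fun T _ => by split_ifs <;> simp [hw]
  set X : Finset (Col v) → ℝ := fun T => ∑ x, if E x T then 1 else 0 with hX
  have h1 : ∑ x, colProb (E x) = ∑ T ∈ Ω, w T * X T := by
    simp only [hprob, hX, Finset.mul_sum]
    exact Finset.sum_comm
  have h2 : ∑ x, ∑ y, colProb (fun T => E x T ∧ E y T) = ∑ T ∈ Ω, w T * X T ^ 2 := by
    have h5 : ∀ x y, colProb (fun T => E x T ∧ E y T) =
        ∑ T ∈ Ω, w T * ((if E x T then 1 else 0) * (if E y T then 1 else 0)) := by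
      intro x y
      rw [hprob]
      refine Finset.sum_congr rfl fun T _ => ?_
      by_cases hx : E x T <;> by_cases hy : E y T <;> simp [hx, hy]
    have h6 : ∀ T, w T * X T ^ 2 =
        ∑ x, ∑ y, w T * ((if E x T then 1 else 0) * (if E y T then 1 else 0)) := by
      intro T
      rw [sq]
      simp only [hX]
      rw [Finset.sum_mul_sum, Finset.mul_sum]
      exact Finset.sum_congr rfl fun x _ => Finset.mul_sum _ _ _
    simp only [h5, h6]
    rw [Finset.sum_comm (s := Ω)]
    exact Finset.sum_congr rfl fun x _ => Finset.sum_comm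
  rw [h1, h2, hprob]
  -- Multiplying the count `X` by the indicator of `X ≠ 0` does not change it; Cauchy–Schwarz is
  -- applied to √w · X and √w times this indicator.
  have h3 : ∑ T ∈ Ω, w T * X T = ∑ T ∈ Ω, (Real.sqrt (w T) * X T) *
      (Real.sqrt (w T) * if ∃ x, E x T then 1 else 0) := by
    refine Finset.sum_congr rfl fun T hT => ?_
    have h4 : X T * (if ∃ x, E x T then 1 else 0) = X T := by
      split_ifs with h
      · rw [mul_one]
      · push Not at h
        rw [mul_zero, hX]
        simp [h]
    calc w T * X T = (Real.sqrt (w T) * Real.sqrt (w T)) *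
          (X T * (if ∃ x, E x T then 1 else 0)) := by
          rw [Real.mul_self_sqrt (hw0 T hT), h4]
      _ = _ := by ring
  rw [h3]
  refine (Finset.sum_mul_sq_le_sq_mul_sq _ _ _).trans_eq ?_
  congr 1
  · exact Finset.sum_congr rfl fun T hT => by rw [mul_pow, Real.sq_sqrt (hw0 T hT)]
  · refine Finset.sum_congr rfl fun T hT => ?_
    rw [mul_pow, Real.sq_sqrt (hw0 T hT)]
    split_ifs <;> simp

end SecondMoment

/-! ### Placing the bands in disjoint blocks of vertices. -/

section Blocks

variable {v h m : ℕ}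

theorem block_lt (hv : 5 * (h * m) ≤ v) (k : Fin 5) (i : Fin h) (a : Fin m) :
    k * (h * m) + (i * m + a) < v := by
  have h1 : (i : ℕ) * m + a < h * m := by
    have : ((i : ℕ) + 1) * m ≤ h * m := Nat.mul_le_mul_right _ i.2
    have := a.2
    nlinarith
  have h2 : (k : ℕ) * (h * m) ≤ 4 * (h * m) := Nat.mul_le_mul_right _ (by omega)
  omega

/-- A vertex in the block with index `(k, i)`, the blocks being disjoint intervals of length `m`. -/
def blockVertex (hv : 5 * (h * m) ≤ v) (k : Fin 5) (i : Fin h) (a : Fin m) : Fin v :=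
  ⟨k * (h * m) + (i * m + a), block_lt hv k i a⟩

theorem blockVertex_lt (hv : 5 * (h * m) ≤ v) {k k' : Fin 5} (hk : k < k') (i i' : Fin h)
    (a a' : Fin m) : blockVertex hv k i a < blockVertex hv k' i' a' := by
  have h1 : (i : ℕ) * m + a < h * m := by
    have : ((i : ℕ) + 1) * m ≤ h * m := Nat.mul_le_mul_right _ i.2
    have := a.2
    nlinarith
  have h2 : ((k : ℕ) + 1) * (h * m) ≤ k' * (h * m) := Nat.mul_le_mul_right _ hk
  rw [Fin.lt_def]
  simp only [blockVertex]
  nlinarith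

theorem blockVertex_inj (hv : 5 * (h * m) ≤ v) {k k' : Fin 5} {i i' : Fin h} {a a' : Fin m}
    (heq : blockVertex hv k i a = blockVertex hv k' i' a') : k = k' ∧ i = i' ∧ a = a' := by
  have hk : k = k' := by
    rcases lt_trichotomy k k' with hk | hk | hk
    · exact absurd heq (blockVertex_lt hv hk i i' a a').ne
    · exact hk
    · exact absurd heq (blockVertex_lt hv hk i' i a' a).ne'
  subst hk
  have h1 : (i : ℕ) * m + a = i' * m + a' := by
    have := congrArg Fin.val heq
    simpa [blockVertex] using this
  have hm : 0 < m := a.pos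
  have h2 : (i : ℕ) = i' := by
    have := congrArg (· / m) h1
    simpa [Nat.mul_comm _ m, Nat.mul_add_div hm, Nat.div_eq_of_lt a.2,
      Nat.div_eq_of_lt a'.2] using this
  refine ⟨rfl, Fin.ext h2, Fin.ext ?_⟩
  rw [h2] at h1
  omega

/-- The band with one vertex in each of the five blocks with second index `i`. -/
def blockBand (hv : 5 * (h * m) ≤ v) (i : Fin h) (x : Fin 5 → Fin m) : Fin 5 ↪o Fin v :=
  OrderEmbedding.ofStrictMono (fun k => blockVertex hv k i (x k))
    fun _ _ hk => blockVertex_lt hv hk i i _ _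

theorem blockBand_apply_inj (hv : 5 * (h * m) ≤ v) {i i' : Fin h} {x x' : Fin 5 → Fin m}
    {k k' : Fin 5} (heq : blockBand hv i x k = blockBand hv i' x' k') :
    k = k' ∧ i = i' ∧ x k = x' k' :=
  blockVertex_inj hv heq

theorem blockBand_inj (hv : 5 * (h * m) ≤ v) {i i' : Fin h} {x x' : Fin 5 → Fin m}
    (heq : blockBand hv i x = blockBand hv i' x') : i = i' ∧ x = x' :=
  ⟨(blockBand_apply_inj hv (k := 0) (by rw [heq])).2.1,
    funext fun _ => (blockBand_apply_inj hv (by rw [heq])).2.2⟩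

/-- One band for each of the `h` groups of blocks. -/
def blockFamily (hv : 5 * (h * m) ≤ v) (x : Fin h → Fin 5 → Fin m) : Finset (Fin 5 ↪o Fin v) :=
  Finset.univ.image fun i => blockBand hv i (x i)

theorem card_blockFamily (hv : 5 * (h * m) ≤ v) (x : Fin h → Fin 5 → Fin m) :
    (blockFamily hv x).card = h := by
  rw [blockFamily, Finset.card_image_of_injective _ fun i j hij => (blockBand_inj hv hij).1]
  simp

theorem separated_blockFamily (hv : 5 * (h * m) ≤ v) (x : Fin h → Fin 5 → Fin m) :
    Separated (blockFamily hv x) := by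
  intro c hc c' hc' hne i j
  obtain ⟨k, -, rfl⟩ := Finset.mem_image.1 hc
  obtain ⟨k', -, rfl⟩ := Finset.mem_image.1 hc'
  by_contra hij
  apply hne
  have key : ∀ a b : Fin 5, blockBand hv k (x k) a = blockBand hv k' (x k') b → k = k' :=
    fun a b hab => (blockBand_apply_inj hv hab).2.1
  have : k = k' := by
    rcases eq_of_triMat_ne_zero hij with h1 | h1 | h1 <;>
      exact key _ _ (congrArg Prod.fst h1)
  rw [this]

theorem card_blockFamily_union (hv : 5 * (h * m) ≤ v) (x y : Fin h → Fin 5 → Fin m) :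
    (blockFamily hv x ∪ blockFamily hv y).card =
      h + (Finset.univ.filter fun i => x i ≠ y i).card := by
  rw [← Finset.union_sdiff_self_eq_union, Finset.card_union_of_disjoint Finset.disjoint_sdiff,
    card_blockFamily]
  congr 1
  have : blockFamily hv y \ blockFamily hv x =
      (Finset.univ.filter fun i => x i ≠ y i).image fun i => blockBand hv i (y i) := by
    ext c
    simp only [blockFamily, Finset.mem_sdiff, Finset.mem_image, Finset.mem_univ, true_and,
      Finset.mem_filter, not_exists]
    constructor
    · rintro ⟨⟨i, rfl⟩, hi⟩
      exact ⟨i, fun hxy => hi i (by rw [hxy]), rfl⟩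
    · rintro ⟨i, hi, rfl⟩
      refine ⟨⟨i, rfl⟩, fun j hj => hi ?_⟩
      obtain ⟨rfl, h2⟩ := blockBand_inj hv hj
      exact h2
  rw [this, Finset.card_image_of_injective _ fun i j hij => (blockBand_inj hv hij).1]

/-- The sum factors over the coordinates, and each factor is at most 1 + |β| q ≤ 2. -/
theorem sum_pow_card_ne_le {β : Type*} [Fintype β] [DecidableEq β] {q : ℝ} (hq : 0 ≤ q)
    (hq1 : Fintype.card β * q ≤ 1) (x : Fin h → β) :
    ∑ y : Fin h → β, q ^ (Finset.univ.filter fun i => x i ≠ y i).card ≤ 2 ^ h := by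
  have h1 : ∀ y : Fin h → β, q ^ (Finset.univ.filter fun i => x i ≠ y i).card =
      ∏ i, if x i ≠ y i then q else 1 := by
    intro y
    rw [Finset.prod_ite, Finset.prod_const, Finset.prod_const_one, mul_one]
  simp only [h1]
  rw [← Fintype.prod_sum fun i b => if x i ≠ b then q else 1]
  calc ∏ i, ∑ b, (if x i ≠ b then q else 1) ≤ ∏ _i : Fin h, (2 : ℝ) := by
        refine Finset.prod_le_prod (fun i _ => Finset.sum_nonneg fun b _ => by
          split_ifs <;> linarith) fun i _ => ?_
        calc ∑ b, (if x i ≠ b then q else 1) ≤ ∑ b, (q + if x i = b then 1 else 0) := by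
              refine Finset.sum_le_sum fun b _ => ?_
              by_cases hb : x i = b <;> simp [hb, hq]
          _ ≤ 2 := by
              rw [Finset.sum_add_distrib, Finset.sum_const, Finset.card_univ, nsmul_eq_mul,
                Finset.sum_ite_eq]
              simp only [Finset.mem_univ, if_true]
              linarith
    _ = 2 ^ h := by simp

/-- With probability bounded from below there are `h` isolated Möbius bands. -/
theorem le_colProb_exists_isolated (hh : 1 ≤ h) (hm : 1 ≤ m) (hv : 5 * (h * m) ≤ v)
    (hv' : 60 * h ≤ v) :
    ((m : ℝ) / ((v : ℝ) + 1)) ^ (5 * h) * Real.exp (-(61 * (h : ℝ))) ≤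
      colProb fun T => ∃ x : Fin h → Fin 5 → Fin m, ∀ c ∈ blockFamily hv x, Isolated c T := by
  set n : ℝ := (v : ℝ) + 1 with hn
  have hnpos : 0 < n := by positivity
  have hne : ∀ x : Fin h → Fin 5 → Fin m, (blockFamily hv x).Nonempty := fun x => by
    rw [← Finset.card_pos, card_blockFamily]
    exact hh
  set a : ℝ := (4 / n ^ 5) ^ h * Real.exp (-(30 * (h : ℝ))) with ha
  set N : ℝ := (m : ℝ) ^ (5 * h) with hN
  have hcard : (Fintype.card (Fin h → Fin 5 → Fin m) : ℝ) = N := by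
    simp [hN, pow_mul]
  set q : ℝ := 12 / n ^ 5 with hq
  have hq0 : 0 ≤ q := by positivity
  have hmn : (m : ℝ) / n ≤ 1 / 5 := by
    rw [div_le_div_iff₀ hnpos (by norm_num)]
    have : 5 * m ≤ v := by nlinarith
    have : (5 : ℝ) * m ≤ v := by exact_mod_cast this
    linarith
  have hq1 : (Fintype.card (Fin 5 → Fin m) : ℝ) * q ≤ 1 := by
    have h1 : (Fintype.card (Fin 5 → Fin m) : ℝ) * q = 12 * ((m : ℝ) / n) ^ 5 := by
      rw [hq, div_pow]
      simp
      ring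
    rw [h1]
    have : ((m : ℝ) / n) ^ 5 ≤ (1 / 5) ^ 5 := pow_le_pow_left₀ (by positivity) hmn 5
    norm_num at this ⊢
    linarith
  have hlow : N * a ≤ ∑ x : Fin h → Fin 5 → Fin m,
      colProb fun T => ∀ c ∈ blockFamily hv x, Isolated c T := by
    rw [← hcard, ← nsmul_eq_mul, ← Finset.card_univ]
    refine Finset.card_nsmul_le_sum _ _ _ fun x _ => ?_
    have := (colProb_isolated_bounds (by omega) (separated_blockFamily hv x) (hne x)
      (by rw [card_blockFamily]; omega)).1
    rwa [card_blockFamily] at this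
  have hup : ∑ x : Fin h → Fin 5 → Fin m, ∑ y : Fin h → Fin 5 → Fin m,
      colProb (fun T => (∀ c ∈ blockFamily hv x, Isolated c T) ∧
        ∀ c ∈ blockFamily hv y, Isolated c T) ≤ N * (q ^ h * 2 ^ h) := by
    rw [← hcard, ← nsmul_eq_mul, ← Finset.card_univ]
    refine Finset.sum_le_card_nsmul _ _ _ fun x _ => ?_
    refine le_trans ?_ (mul_le_mul_of_nonneg_left (sum_pow_card_ne_le hq0 hq1 x)
      (by positivity : (0 : ℝ) ≤ q ^ h))
    rw [Finset.mul_sum]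
    refine Finset.sum_le_sum fun y _ => ?_
    have hle : (Finset.univ.filter fun i => x i ≠ y i).card ≤ h :=
      (Finset.card_le_univ _).trans_eq (Fintype.card_fin h)
    -- The two families together have at most 2h bands; `60 * h ≤ v` is what makes the bound 30 · 2h
    -- ≤ v + 1 available.
    have := colProb_isolated_le (v := v) (C := blockFamily hv x ∪ blockFamily hv y) (by omega) ?_
      ((hne x).mono Finset.subset_union_left) (by rw [card_blockFamily_union]; omega)
    · rw [card_blockFamily_union, pow_add] at this
      refine le_trans (le_of_eq ?_) this
      congr 1
      ext T
      simp only [Finset.mem_union, or_imp, forall_and]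
    · have key : ∀ c ∈ blockFamily hv x ∪ blockFamily hv y, ∃ i z, c = blockBand hv i z := by
        intro c hc
        rcases Finset.mem_union.1 hc with hc | hc
        · obtain ⟨i, -, rfl⟩ := Finset.mem_image.1 hc
          exact ⟨i, _, rfl⟩
        · obtain ⟨i, -, rfl⟩ := Finset.mem_image.1 hc
          exact ⟨i, _, rfl⟩
      intro c hc c' hc' k k' hkk
      obtain ⟨i, z, rfl⟩ := key c hc
      obtain ⟨i', z', rfl⟩ := key c' hc'
      exact (blockBand_apply_inj hv hkk).1
  have hsq := sq_sum_colProb_le fun (x : Fin h → Fin 5 → Fin m) T =>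
    ∀ c ∈ blockFamily hv x, Isolated c T
  set P := colProb fun T => ∃ x : Fin h → Fin 5 → Fin m, ∀ c ∈ blockFamily hv x, Isolated c T
    with hP
  have hP0 : 0 ≤ P := colProb_nonneg _
  have hNpos : 0 < N := by positivity
  have hapos : 0 < a := by positivity
  have h1 : (N * a) ^ 2 ≤ N * (q ^ h * 2 ^ h) * P :=
    (pow_le_pow_left₀ (by positivity) hlow 2).trans
      (hsq.trans (mul_le_mul_of_nonneg_right hup hP0))
  have h2 : N * a ^ 2 ≤ q ^ h * 2 ^ h * P := by
    refine le_of_mul_le_mul_left ?_ hNpos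
    linarith
  -- The ratio of the squared first moment to the second moment, per band: 4² / (12 · 2) = 2 / 3.
  have h3 : a ^ 2 = q ^ h * 2 ^ h * ((2 / 3 / n ^ 5) ^ h * Real.exp (-(60 * (h : ℝ)))) := by
    rw [ha, mul_pow, ← Real.exp_nat_mul, ← pow_mul, mul_comm h 2, pow_mul, ← mul_assoc, ← mul_pow,
      ← mul_pow]
    congr 2
    · rw [hq]
      field_simp
      norm_num
    · push_cast
      ring
  have h4 : N * ((2 / 3 / n ^ 5) ^ h * Real.exp (-(60 * (h : ℝ)))) ≤ P := by
    have hpos : 0 < q ^ h * 2 ^ h := by positivity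
    refine le_of_mul_le_mul_left ?_ hpos
    rw [h3] at h2
    linarith
  refine le_trans ?_ h4
  -- The factor (2 / 3)^h is absorbed into one more e^(-h), whence the exponent 61.
  have h5 : Real.exp (-(h : ℝ)) ≤ (2 / 3) ^ h := by
    have : Real.exp (-(h : ℝ)) = Real.exp (-1) ^ h := by
      rw [← Real.exp_nat_mul]
      congr 1
      ring
    rw [this]
    refine pow_le_pow_left₀ (Real.exp_pos _).le ?_ h
    rw [Real.exp_neg]
    refine inv_le_of_inv_le₀ (by norm_num) ?_
    linarith [Real.exp_one_gt_d9]
  calc ((m : ℝ) / n) ^ (5 * h) * Real.exp (-(61 * (h : ℝ)))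
      = N * (1 / n ^ 5) ^ h * (Real.exp (-(h : ℝ)) * Real.exp (-(60 * (h : ℝ)))) := by
        rw [← Real.exp_add, div_pow, hN, one_div, inv_pow, ← pow_mul, div_eq_mul_inv]
        congr 2
        ring
    _ ≤ N * (1 / n ^ 5) ^ h * ((2 / 3) ^ h * Real.exp (-(60 * (h : ℝ)))) := by gcongr
    _ = _ := by
        rw [show (2 / 3 / n ^ 5 : ℝ) = (1 / n ^ 5) * (2 / 3) by ring, mul_pow]
        ring

end Blocks

/-! ### Isolated bands force a large first Betti number mod 2. -/

section LowerBound

variable {v : ℕ}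

theorem colProb_le_prob {E : Finset (Col v) → Prop} {F : Hypertree (v + 1) → Prop}
    (hEF : ∀ S : Hypertree (v + 1), E (triangles S.1) → F S) : colProb E ≤ prob (v + 1) F := by
  classical
  have h := sum_weight_mul (v := v) fun T => if E T then 1 else 0
  have h1 : colProb E = ∑ S : Hypertree (v + 1), weight S * if E (triangles S.1) then 1 else 0 := by
    rw [h, colProb, Finset.sum_filter]
    simp
  rw [h1, prob, Finset.sum_filter]
  refine Finset.sum_le_sum fun S _ => ?_
  have := weight_nonneg S
  by_cases hE : E (triangles S.1)
  · simp [hE, hEF S hE]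
  · simp only [hE, if_false, mul_zero]
    split_ifs <;> simp [this]

theorem colMat_zmod_eq_zero (p : ℕ) {e : Edge v} {t : Col v} (h : colMat ℝ v e t = 0) :
    colMat (ZMod p) v e t = 0 := by
  rw [← colMat_map (Int.castRingHom ℝ), Matrix.map_apply] at h
  have h0 : colMat ℤ v e t = 0 := by simpa using h
  rw [← colMat_map (Int.castRingHom (ZMod p)), Matrix.map_apply, h0, map_zero]

theorem sum_coreMat_col (j : Fin 5) : ∑ i, coreMat (ZMod 2) i j = 0 := by
  fin_cases j <;> decide

/-- The sum over the core edges of an isolated band is a functional that kills all boundaries. -/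
theorem Isolated.sum_colVec {c : Fin 5 ↪o Fin v} {T : Finset (Col v)} (h : Isolated c T)
    {t : Col v} (ht : t ∈ T) : ∑ i, colVec (ZMod 2) t (bandEdge c i) = 0 := by
  by_cases hi : ∃ i, colMat ℝ v (bandEdge c i) t ≠ 0
  · obtain ⟨j, rfl⟩ := (h t).1 ⟨ht, hi⟩
    simp only [colVec, colMat_inr, triMat_band]
    exact sum_coreMat_col j
  · push Not at hi
    exact Finset.sum_eq_zero fun i _ => colMat_zmod_eq_zero 2 (hi i)

/-- The core sums of the h bands descend to functionals on H_1(S, F_2). They are independent because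
different bands occupy disjoint blocks, so evaluating at one core edge of each band realizes the
coordinate vectors. -/
theorem le_bettiOne {h m : ℕ} (hv : 5 * (h * m) ≤ v) (S : Hypertree (v + 1))
    (x : Fin h → Fin 5 → Fin m) (hx : ∀ c ∈ blockFamily hv x, Isolated c (triangles S.1)) :
    h ≤ bettiOne 2 S := by
  have hiso : ∀ k, Isolated (blockBand hv k (x k)) (triangles S.1) := fun k =>
    hx _ (Finset.mem_image_of_mem _ (Finset.mem_univ k))
  let Φ : (Edge v → ZMod 2) →ₗ[ZMod 2] (Fin h → ZMod 2) :=
    LinearMap.pi fun k => ∑ i, LinearMap.proj (bandEdge (blockBand hv k (x k)) i)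
  have hΦ : ∀ w k, Φ w k = ∑ i, w (bandEdge (blockBand hv k (x k)) i) := by
    intro w k
    simp [Φ]
  have hker : Submodule.span (ZMod 2) (colVec (ZMod 2) '' (triangles S.1 : Set (Col v))) ≤
      LinearMap.ker Φ := by
    rw [Submodule.span_le]
    rintro _ ⟨t, ht, rfl⟩
    rw [SetLike.mem_coe, LinearMap.mem_ker]
    ext k
    rw [hΦ]
    exact (hiso k).sum_colVec ht
  have hsurj : Function.Surjective Φ := by
    intro y
    refine ⟨∑ k, y k • Pi.single (bandEdge (blockBand hv k (x k)) 0) 1, ?_⟩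
    have hsingle : ∀ k, Φ (Pi.single (bandEdge (blockBand hv k (x k)) 0) 1) = Pi.single k 1 := by
      intro k
      ext l
      rw [hΦ]
      by_cases hkl : l = k
      · subst hkl
        rw [Finset.sum_eq_single 0]
        · simp
        · intro i _ hi
          rw [Pi.single_eq_of_ne]
          exact fun h => hi (bandEdge_injective _ h)
        · simp
      · rw [Pi.single_eq_of_ne hkl]
        refine Finset.sum_eq_zero fun i _ => ?_
        rw [Pi.single_eq_of_ne]
        intro h
        exact hkl (blockBand_apply_inj hv (congrArg (fun e => e.1.1) h)).2.1
    rw [map_sum]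
    simp only [map_smul, hsingle]
    ext l
    simp [Finset.sum_apply, Pi.single_apply]
  have hle := LinearMap.finrank_le_finrank_of_surjective
    (f := (Submodule.span (ZMod 2) (colVec (ZMod 2) '' (triangles S.1 : Set (Col v)))).liftQ Φ hker)
    (fun y => by
      obtain ⟨w, hw⟩ := hsurj y
      exact ⟨Submodule.Quotient.mk w, hw⟩)
  rw [bettiOne, (homologyEquiv S.2.complete_skeleton (ZMod 2)).finrank_eq]
  simpa using hle

theorem eventually_le_prob (h : ℕ) (hh : 0 < h) : ∀ᶠ n : ℕ in atTop,
    Real.exp (-(200 * (h : ℝ))) / (100 * (h : ℝ)) ^ (5 * h) ≤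
      prob n fun S => h ≤ bettiOne 2 S := by
  filter_upwards [eventually_ge_atTop (60 * h + 1)] with n hn
  obtain ⟨v, rfl⟩ : ∃ v, n = v + 1 := ⟨n - 1, by omega⟩
  have hv' : 60 * h ≤ v := by omega
  -- The largest block length for which 5h blocks fit. It gives m / (v + 1) ≥ 1 / (100h) with room
  -- to spare, as 200 leaves room for 61.
  set m := v / (5 * h) with hm
  have hdm := Nat.div_add_mod v (5 * h)
  have hmod := Nat.mod_lt v (by omega : 0 < 5 * h)
  rw [← hm] at hdm
  have hv : 5 * (h * m) ≤ v := by
    rw [← mul_assoc]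
    omega
  have hm1 : 1 ≤ m := by
    rw [hm, Nat.le_div_iff_mul_le (by omega)]
    omega
  have h1 := le_colProb_exists_isolated hh hm1 hv hv'
  have h2 := colProb_le_prob (v := v)
    (E := fun T => ∃ x : Fin h → Fin 5 → Fin m, ∀ c ∈ blockFamily hv x, Isolated c T)
    (F := fun S => h ≤ bettiOne 2 S) fun S ⟨x, hx⟩ => le_bettiOne hv S x hx
  refine le_trans ?_ (h1.trans h2)
  have hhpos : (0 : ℝ) < h := by exact_mod_cast hh
  have h3 : 1 / (100 * (h : ℝ)) ≤ (m : ℝ) / ((v : ℝ) + 1) := by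
    rw [div_le_div_iff₀ (by positivity) (by positivity)]
    have h4 : v + 1 ≤ 100 * h * m := by nlinarith
    have : (v : ℝ) + 1 ≤ 100 * h * m := by exact_mod_cast h4
    linarith
  calc Real.exp (-(200 * (h : ℝ))) / (100 * (h : ℝ)) ^ (5 * h)
      = (1 / (100 * (h : ℝ))) ^ (5 * h) * Real.exp (-(200 * (h : ℝ))) := by
        rw [one_div, inv_pow]
        ring
    _ ≤ ((m : ℝ) / ((v : ℝ) + 1)) ^ (5 * h) * Real.exp (-(61 * (h : ℝ))) := by
        gcongr
        linarith

end LowerBound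

/-! ### Counting tuples in a finite abelian group by the subgroup they generate. -/

section Counting

variable {W G : Type} [AddCommGroup W] [Finite W] [AddCommGroup G] [Finite G] {m : ℕ}

theorem card_hom_pi_zmod_le (q m : ℕ) [NeZero q] (G : Type) [AddCommGroup G] [Finite G] :
    Nat.card ((Fin m → ZMod q) →+ G) ≤ Nat.card G ^ m := by
  have h : Function.Injective fun (f : (Fin m → ZMod q) →+ G) (i : Fin m) => f (Pi.single i 1) := by
    intro f g hfg
    have h1 : ∀ (i : Fin m) (x : ZMod q), f (Pi.single i x) = g (Pi.single i x) := by
      intro i x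
      have hx : (Pi.single i x : Fin m → ZMod q) = x.val • Pi.single i 1 := by
        rw [← Pi.single_smul, nsmul_eq_mul, mul_one, ZMod.natCast_zmod_val]
      rw [hx, map_nsmul, map_nsmul]
      exact congrArg (x.val • ·) (congrFun hfg i)
    exact AddMonoidHom.functions_ext _ _ _ h1
  calc Nat.card ((Fin m → ZMod q) →+ G) ≤ Nat.card (Fin m → G) :=
        Nat.card_le_card_of_injective _ h
    _ = Nat.card G ^ m := by simp [Nat.card_fun]

/-- A first moment bound for the number of tuples in the kernel of some surjection onto `G`. -/
theorem card_killed_mul_card_aut_le (hHom : Nat.card (W →+ G) ≤ Nat.card G ^ m) :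
    Nat.card {A : Fin m → W // ∃ f : W →+ G, Function.Surjective f ∧ ∀ i, f (A i) = 0} *
      Nat.card (G ≃+ G) ≤ Nat.card W ^ m := by
  have : Finite (W →+ G) := Finite.of_injective (fun f => (f : W → G)) DFunLike.coe_injective
  set X := {A : Fin m → W // ∃ f : W →+ G, Function.Surjective f ∧ ∀ i, f (A i) = 0}
  let φ : X → (W →+ G) := fun A => A.2.choose
  have hφ : ∀ A : X, Function.Surjective (φ A) := fun A => A.2.choose_spec.1
  have hφ0 : ∀ (A : X) i, φ A (A.1 i) = 0 := fun A => A.2.choose_spec.2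
  -- The composite f = α ∘ φ_A together with the translated tuple determines everything: applying f
  -- returns g, the chosen section of f then returns A, and f with φ_A returns α. The extra factor
  -- |G|^m cancels against the bound on |Hom(W, G)|.
  let F : (X × (G ≃+ G)) × (Fin m → G) → (W →+ G) × (Fin m → W) := fun p =>
    ((p.1.2 : G →+ G).comp (φ p.1.1), fun i => p.1.1.1 i +
      Function.surjInv (p.1.2.surjective.comp (hφ p.1.1)) (p.2 i))
  have hF : Function.Injective F := by
    rintro ⟨⟨A, α⟩, g⟩ ⟨⟨A', α'⟩, g'⟩ h
    have h1 : (α : G →+ G).comp (φ A) = (α' : G →+ G).comp (φ A') := congrArg Prod.fst h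
    have h1' : (fun w => α (φ A w)) = fun w => α' (φ A' w) := funext fun w => DFunLike.congr_fun h1 w
    have h2 : ∀ i, A.1 i + Function.surjInv (α.surjective.comp (hφ A)) (g i) =
        A'.1 i + Function.surjInv (α'.surjective.comp (hφ A')) (g' i) := fun i =>
      congrFun (congrArg Prod.snd h) i
    have hs : ∀ y, α (φ A (Function.surjInv (α.surjective.comp (hφ A)) y)) = y := fun y =>
      Function.surjInv_eq (α.surjective.comp (hφ A)) y
    have hs' : ∀ y, α' (φ A' (Function.surjInv (α'.surjective.comp (hφ A')) y)) = y := fun y =>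
      Function.surjInv_eq (α'.surjective.comp (hφ A')) y
    have hg : g = g' := by
      ext i
      have h3 := congrArg (fun w => α (φ A w)) (h2 i)
      simp only [map_add, hφ0, zero_add, hs] at h3
      have h4 := congrFun h1' (A'.1 i)
      have h5 := congrFun h1' (Function.surjInv (α'.surjective.comp (hφ A')) (g' i))
      simp only [hφ0, map_zero, hs'] at h4 h5
      rw [h3, h4, h5, zero_add]
    subst hg
    -- The section depends only on the composite, which is the same on both sides.
    have hsurj : Function.surjInv (α.surjective.comp (hφ A)) =
        Function.surjInv (α'.surjective.comp (hφ A')) := by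
      have hfun : (⇑α ∘ ⇑(φ A)) = ⇑α' ∘ ⇑(φ A') := h1'
      congr 1
    have hA : A = A' := by
      apply Subtype.ext
      ext i
      have := h2 i
      rw [hsurj] at this
      exact add_right_cancel this
    subst hA
    have hα : α = α' := by
      ext y
      obtain ⟨w, rfl⟩ := hφ A y
      exact congrFun h1' w
    rw [hα]
  have hcard := Nat.card_le_card_of_injective F hF
  simp only [Nat.card_prod, Nat.card_fun, Nat.card_eq_fintype_card (α := Fin m), Fintype.card_fin]
    at hcard
  have hpos : 0 < Nat.card G ^ m := pow_pos Nat.card_pos m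
  refine Nat.le_of_mul_le_mul_right ?_ hpos
  calc _ ≤ Nat.card (W →+ G) * Nat.card W ^ m := hcard
    _ ≤ Nat.card G ^ m * Nat.card W ^ m := Nat.mul_le_mul_right _ hHom
    _ = _ := mul_comm _ _

/-- An upper bound for the number of subgroups with quotient `G`. -/
theorem card_subgroup_mul_card_aut_le (W G : Type) [AddCommGroup W] [Finite W] [AddCommGroup G]
    [Finite G] :
    Nat.card {K : AddSubgroup W // Nonempty (W ⧸ K ≃+ G)} * Nat.card (G ≃+ G) ≤
      Nat.card (W →+ G) := by
  have : Finite (W →+ G) := Finite.of_injective (fun f => (f : W → G)) DFunLike.coe_injective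
  rw [← Nat.card_prod]
  let F : {K : AddSubgroup W // Nonempty (W ⧸ K ≃+ G)} × (G ≃+ G) → (W →+ G) := fun p =>
    ((p.2 : G →+ G).comp (p.1.2.some : W ⧸ p.1.1 →+ G)).comp (QuotientAddGroup.mk' p.1.1)
  refine Nat.card_le_card_of_injective F ?_
  rintro ⟨⟨K, hK⟩, α⟩ ⟨⟨K', hK'⟩, α'⟩ h
  have hval : ∀ w : W, α (hK.some (QuotientAddGroup.mk w)) =
      α' (hK'.some (QuotientAddGroup.mk w)) := fun w => DFunLike.congr_fun h w
  have hKK : K = K' := by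
    ext w
    rw [← QuotientAddGroup.eq_zero_iff w, ← QuotientAddGroup.eq_zero_iff (N := K') w]
    have := hval w
    constructor
    · intro h0
      rw [h0, map_zero, map_zero] at this
      simpa using this.symm
    · intro h0
      rw [h0, map_zero, map_zero] at this
      simpa using this
  subst hKK
  have hα : α = α' := by
    ext y
    obtain ⟨x, rfl⟩ := hK.some.surjective y
    obtain ⟨w, rfl⟩ := QuotientAddGroup.mk_surjective x
    exact hval w
  rw [hα]

/-- The number of `m`-tuples that generate the subgroup `K`. -/
def genCard (m : ℕ) (K : AddSubgroup W) : ℕ :=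
  Nat.card {A : Fin m → W // AddSubgroup.closure (Set.range A) = K}

/-- Transposing, m vectors span F_2^d only if the d rows in F_2^m are linearly independent. -/
theorem card_spanning_le {d m : ℕ} (hd : d ≤ m) :
    Nat.card {A : Fin m → (Fin d → ZMod 2) // Submodule.span (ZMod 2) (Set.range A) = ⊤} ≤
      ∏ i : Fin d, (2 ^ m - 2 ^ (i : ℕ)) := by
  have h := card_linearIndependent (K := ZMod 2) (V := Fin m → ZMod 2) (k := d) (by simpa using hd)
  simp only [Module.finrank_fin_fun, ZMod.card] at h
  rw [← h]
  let F : {A : Fin m → (Fin d → ZMod 2) // Submodule.span (ZMod 2) (Set.range A) = ⊤} →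
      {s : Fin d → (Fin m → ZMod 2) // LinearIndependent (ZMod 2) s} := fun A =>
    ⟨fun j i => A.1 i j, by
      rw [Fintype.linearIndependent_iff]
      intro c hc
      let f : (Fin d → ZMod 2) →ₗ[ZMod 2] ZMod 2 := dotProductBilin (ZMod 2) (ZMod 2) c
      have hf : ∀ x, f x = ∑ j, c j * x j := fun x => rfl
      have hle : Submodule.span (ZMod 2) (Set.range A.1) ≤ LinearMap.ker f := by
        rw [Submodule.span_le]
        rintro _ ⟨i, rfl⟩
        rw [SetLike.mem_coe, LinearMap.mem_ker, hf]
        have := congrFun hc i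
        simpa [Finset.sum_apply] using this
      rw [A.2] at hle
      intro j
      have := LinearMap.mem_ker.1 (hle (Submodule.mem_top (x := Pi.single j 1)))
      rw [hf] at this
      simpa [Pi.single_apply] using this⟩
  refine Nat.card_le_card_of_injective F ?_
  intro A B hAB
  apply Subtype.ext
  ext i j
  exact congrFun (congrFun (congrArg Subtype.val hAB) j) i

/-- `G` surjects onto the elementary abelian group of order `2 ^ d`. -/
def HasRank (d : ℕ) (G : Type) [AddCommGroup G] : Prop :=
  ∃ ψ : G →+ (Fin d → ZMod 2), Function.Surjective ψ

/-- An upper bound for the number of generating tuples, in terms of the rank modulo `2`. -/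
theorem genCard_top_mul_le {d : ℕ} (hd : d ≤ m) (hW : HasRank d W) :
    genCard m (⊤ : AddSubgroup W) * (2 ^ d) ^ m ≤
      Nat.card W ^ m * ∏ i : Fin d, (2 ^ m - 2 ^ (i : ℕ)) := by
  obtain ⟨ψ, hψ⟩ := hW
  have hker : Nat.card ψ.ker * 2 ^ d = Nat.card W := by
    rw [← AddSubgroup.card_mul_index ψ.ker, AddSubgroup.index_ker, AddMonoidHom.range_eq_top.2 hψ,
      AddSubgroup.card_top]
    simp
  have hspan : ∀ A : Fin m → W, AddSubgroup.closure (Set.range A) = ⊤ →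
      Submodule.span (ZMod 2) (Set.range fun i => ψ (A i)) = ⊤ := by
    intro A hA
    rw [eq_top_iff]
    rintro y -
    obtain ⟨w, rfl⟩ := hψ y
    have hw : w ∈ AddSubgroup.closure (Set.range A) := hA ▸ AddSubgroup.mem_top w
    induction hw using AddSubgroup.closure_induction with
    | mem x hx =>
      obtain ⟨i, rfl⟩ := hx
      exact Submodule.subset_span ⟨i, rfl⟩
    | zero => rw [map_zero]; exact Submodule.zero_mem _
    | add x y _ _ hx hy => rw [map_add]; exact Submodule.add_mem _ hx hy
    | neg x _ hx => rw [map_neg]; exact Submodule.neg_mem _ hx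
  -- A tuple is recovered from its image under ψ, which must span, and its displacement from a fixed
  -- lift of that image, which lies in the kernel.
  let F : {A : Fin m → W // AddSubgroup.closure (Set.range A) = ⊤} →
      {B : Fin m → (Fin d → ZMod 2) // Submodule.span (ZMod 2) (Set.range B) = ⊤} ×
        (Fin m → ψ.ker) := fun A =>
    (⟨fun i => ψ (A.1 i), hspan A.1 A.2⟩, fun i => ⟨A.1 i - Function.surjInv hψ (ψ (A.1 i)), by
      rw [AddMonoidHom.mem_ker, map_sub, Function.surjInv_eq hψ, sub_self]⟩)
  have hF : Function.Injective F := by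
    intro A B hAB
    apply Subtype.ext
    ext i
    have h1 : ψ (A.1 i) = ψ (B.1 i) :=
      congrFun (congrArg Subtype.val (congrArg Prod.fst hAB)) i
    have h2 : A.1 i - Function.surjInv hψ (ψ (A.1 i)) = B.1 i - Function.surjInv hψ (ψ (B.1 i)) :=
      congrArg Subtype.val (congrFun (congrArg Prod.snd hAB) i)
    rw [h1] at h2
    exact sub_left_injective h2
  have hcard := Nat.card_le_card_of_injective F hF
  rw [Nat.card_prod, Nat.card_fun, Nat.card_eq_fintype_card (α := Fin m), Fintype.card_fin] at hcard
  calc genCard m (⊤ : AddSubgroup W) * (2 ^ d) ^ m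
      ≤ ((∏ i : Fin d, (2 ^ m - 2 ^ (i : ℕ))) * Nat.card ψ.ker ^ m) * (2 ^ d) ^ m :=
        Nat.mul_le_mul_right _ (hcard.trans (Nat.mul_le_mul_right _ (card_spanning_le hd)))
    _ = _ := by rw [mul_assoc, ← mul_pow, hker, mul_comm]

theorem genCard_le_genCard_top (K : AddSubgroup W) :
    genCard m K ≤ genCard m (⊤ : AddSubgroup K) := by
  have hmem : ∀ A : {A : Fin m → W // AddSubgroup.closure (Set.range A) = K}, ∀ i, A.1 i ∈ K :=
    fun A i => by
      have h := AddSubgroup.subset_closure (k := Set.range A.1) ⟨i, rfl⟩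
      rwa [A.2] at h
  let F : {A : Fin m → W // AddSubgroup.closure (Set.range A) = K} →
      {B : Fin m → K // AddSubgroup.closure (Set.range B) = ⊤} := fun A =>
    ⟨fun i => ⟨A.1 i, hmem A i⟩, by
      apply AddSubgroup.map_injective K.subtype_injective
      rw [AddMonoidHom.map_closure, ← Set.range_comp, ← AddMonoidHom.range_eq_map,
        AddSubgroup.range_subtype]
      exact A.2⟩
  refine Nat.card_le_card_of_injective F fun A B hAB => ?_
  apply Subtype.ext
  ext i
  exact congrArg Subtype.val (congrFun (congrArg Subtype.val hAB) i)

/-- The proportion of `m`-tuples in `(ℤ / 2) ^ d` that generate. -/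
def genRatio (m d : ℕ) : ℝ := ∏ i ∈ Finset.range d, (1 - 2 ^ i / 2 ^ m)

theorem genCard_le {d : ℕ} (hd : d ≤ m) (K : AddSubgroup W) (hK : HasRank d K) :
    (genCard m K : ℝ) ≤ (Nat.card K : ℝ) ^ m * genRatio m d := by
  have h1 : (genCard m (⊤ : AddSubgroup K) : ℝ) * (2 ^ d) ^ m ≤
      (Nat.card K : ℝ) ^ m * ((∏ i : Fin d, (2 ^ m - 2 ^ (i : ℕ)) : ℕ) : ℝ) := by
    exact_mod_cast genCard_top_mul_le hd hK
  have h2 : ((∏ i : Fin d, (2 ^ m - 2 ^ (i : ℕ)) : ℕ) : ℝ) = genRatio m d * (2 ^ d) ^ m := by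
    rw [genRatio, ← pow_mul, mul_comm d m, pow_mul, ← Finset.prod_range (n := d)
      (fun i => 2 ^ m - 2 ^ i), Nat.cast_prod]
    have : ((2 : ℝ) ^ m) ^ d = ∏ _i ∈ Finset.range d, (2 : ℝ) ^ m := by simp
    rw [this, ← Finset.prod_mul_distrib]
    refine Finset.prod_congr rfl fun i hi => ?_
    have hle : 2 ^ i ≤ 2 ^ m :=
      Nat.pow_le_pow_right (by norm_num) ((Finset.mem_range.1 hi).le.trans hd)
    rw [Nat.cast_sub hle, sub_mul, one_mul, div_mul_cancel₀ _ (by positivity)]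
    push_cast
    ring
  rw [h2, ← mul_assoc] at h1
  have h3 := le_of_mul_le_mul_right h1 (by positivity)
  exact le_trans (by exact_mod_cast genCard_le_genCard_top K) h3

theorem hasRank_of_le_card {d : ℕ}
    (hW : 2 ^ d ≤ Nat.card (W ⧸ (nsmulAddMonoidHom (α := W) 2).range)) : HasRank d W := by
  let : Module (ZMod 2) (W ⧸ (nsmulAddMonoidHom (α := W) 2).range) :=
    QuotientAddGroup.zmodModule fun x => ⟨x, rfl⟩
  set Q := W ⧸ (nsmulAddMonoidHom (α := W) 2).range
  have : Finite Q := Quotient.finite _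
  have hcard : Nat.card Q = 2 ^ Module.finrank (ZMod 2) Q := by
    rw [Module.natCard_eq_pow_finrank (K := ZMod 2), Nat.card_zmod]
  rw [hcard] at hW
  have hle : d ≤ Module.finrank (ZMod 2) Q := (Nat.pow_le_pow_iff_right (by norm_num)).1 hW
  let b := Module.finBasis (ZMod 2) Q
  let f : Q →ₗ[ZMod 2] (Fin d → ZMod 2) :=
    (LinearMap.funLeft (ZMod 2) (ZMod 2) (Fin.castLE hle)).comp b.equivFun.toLinearMap
  refine ⟨f.toAddMonoidHom.comp (QuotientAddGroup.mk' _), ?_⟩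
  have hf : Function.Surjective f :=
    (LinearMap.funLeft_surjective_of_injective (ZMod 2) (ZMod 2) (Fin.castLE hle)
      (Fin.castLE_injective hle)).comp
      b.equivFun.surjective
  exact hf.comp (QuotientAddGroup.mk'_surjective _)

/-- Kernel and cokernel of an endomorphism of a finite group have equal order. The rank mod 2 of a
subgroup can thus be bounded from below by exhibiting elements killed by 2. -/
theorem card_quotient_two_eq :
    Nat.card (W ⧸ (nsmulAddMonoidHom (α := W) 2).range) =
      Nat.card (nsmulAddMonoidHom (α := W) 2).ker := by
  set f := nsmulAddMonoidHom (α := W) 2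
  have h1 := AddSubgroup.card_mul_index f.range
  have h2 := AddSubgroup.card_mul_index f.ker
  rw [AddSubgroup.index_ker] at h2
  have hpos : 0 < Nat.card f.range := Nat.card_pos
  rw [← h2, mul_comm] at h1
  exact Nat.eq_of_mul_eq_mul_right hpos h1

open Classical in
theorem sum_genCard (m : ℕ) (P : AddSubgroup W → Prop) [Fintype (AddSubgroup W)] :
    ∑ K : AddSubgroup W with P K, genCard m K =
      Nat.card {A : Fin m → W // P (AddSubgroup.closure (Set.range A))} := by
  have := Fintype.ofFinite W
  have h : ∀ K : AddSubgroup W, genCard m K =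
      ∑ A : Fin m → W, if AddSubgroup.closure (Set.range A) = K then 1 else 0 := fun K => by
    rw [genCard, Nat.card_eq_fintype_card, Fintype.card_subtype, Finset.card_filter]
  simp_rw [h]
  rw [Finset.sum_comm, Nat.card_eq_fintype_card, Fintype.card_subtype, Finset.card_filter]
  refine Finset.sum_congr rfl fun A _ => ?_
  rw [Finset.sum_ite_eq]
  simp

end Counting

/-! ### Automorphism counts and the resulting bounds on the mass of tuples. -/

section Mass

variable {W : Type} [AddCommGroup W] [Finite W] {m : ℕ}

theorem finite_addEquiv (A B : Type) [AddCommGroup A] [Finite A] [AddCommGroup B] [Finite B] :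
    Finite (A ≃+ B) :=
  Finite.of_injective (fun f => (f : A → B)) DFunLike.coe_injective

theorem card_aut_pos (A : Type) [AddCommGroup A] [Finite A] : 0 < Nat.card (A ≃+ A) := by
  have := finite_addEquiv A A
  exact Nat.card_pos

theorem prod_le_card_aut (k : ℕ) : ∏ i : Fin k, (2 ^ k - 2 ^ (i : ℕ)) ≤
    Nat.card ((Fin k → ZMod 2) ≃+ (Fin k → ZMod 2)) := by
  have := finite_addEquiv (Fin k → ZMod 2) (Fin k → ZMod 2)
  have h := Matrix.card_GL_field (𝔽 := ZMod 2) k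
  rw [ZMod.card] at h
  rw [← h]
  refine Nat.card_le_card_of_injective
    (fun g => (LinearMap.GeneralLinearGroup.generalLinearEquiv (ZMod 2) (Fin k → ZMod 2)
      (Matrix.GeneralLinearGroup.toLin g)).toAddEquiv) ?_
  intro g g' hg
  have h1 : LinearMap.GeneralLinearGroup.generalLinearEquiv (ZMod 2) (Fin k → ZMod 2)
      (Matrix.GeneralLinearGroup.toLin g) = LinearMap.GeneralLinearGroup.generalLinearEquiv
        (ZMod 2) (Fin k → ZMod 2) (Matrix.GeneralLinearGroup.toLin g') :=
    LinearEquiv.ext fun x => DFunLike.congr_fun hg x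
  exact Matrix.GeneralLinearGroup.toLin.injective (MulEquiv.injective _ h1)

theorem two_pow_le_card_aut (k : ℕ) : 2 ^ (k * (k - 1)) ≤
    Nat.card ((Fin k → ZMod 2) ≃+ (Fin k → ZMod 2)) := by
  refine le_trans ?_ (prod_le_card_aut k)
  calc 2 ^ (k * (k - 1)) = ∏ _i : Fin k, 2 ^ (k - 1) := by
        rw [Finset.prod_const, Finset.card_univ, Fintype.card_fin, ← pow_mul, mul_comm]
    _ ≤ _ := Finset.prod_le_prod' fun i _ => ?_
  obtain ⟨l, rfl⟩ : ∃ l, k = l + 1 := ⟨k - 1, by have := i.2; omega⟩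
  have h1 : 2 ^ (i : ℕ) ≤ 2 ^ l := Nat.pow_le_pow_right (by norm_num) (by have := i.2; omega)
  rw [Nat.add_sub_cancel, pow_succ]
  omega

theorem two_pow_le_card_aut_zmod {e : ℕ} (he : 0 < e) : 2 ^ (e - 1) ≤
    Nat.card (ZMod (2 ^ e) ≃+ ZMod (2 ^ e)) := by
  have := finite_addEquiv (ZMod (2 ^ e)) (ZMod (2 ^ e))
  have h : Nat.card (ZMod (2 ^ e))ˣ = 2 ^ (e - 1) := by
    rw [Nat.card_eq_fintype_card, ZMod.card_units_eq_totient, Nat.totient_prime_pow Nat.prime_two he]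
    simp
  rw [← h]
  refine Nat.card_le_card_of_injective
    (fun u => DistribMulAction.toAddEquiv (ZMod (2 ^ e)) u) fun u v huv => ?_
  have h1 := DFunLike.congr_fun huv 1
  simp only [DistribMulAction.toAddEquiv_apply, Units.smul_def, smul_eq_mul, mul_one] at h1
  exact Units.ext h1

open Classical in
/-- The number of tuples generating a subgroup with property `P`, bounded by a sum over the
isomorphism types of the quotients. -/
theorem card_closure_le {ι : Type} (I : Finset ι) (G : ι → Type) [∀ i, AddCommGroup (G i)]
    [∀ i, Finite (G i)] (ρ : ι → ℝ) (hρ : ∀ i, 0 ≤ ρ i) (P : AddSubgroup W → Prop)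
    (hHom : ∀ i, Nat.card (W →+ G i) ≤ Nat.card (G i) ^ m)
    (hcover : ∀ K, P K → ∃ i ∈ I, Nonempty (W ⧸ K ≃+ G i))
    (hgen : ∀ K i, P K → Nonempty (W ⧸ K ≃+ G i) →
      (genCard m K : ℝ) ≤ (Nat.card K : ℝ) ^ m * ρ i) :
    (Nat.card {A : Fin m → W // P (AddSubgroup.closure (Set.range A))} : ℝ) ≤
      (Nat.card W : ℝ) ^ m * ∑ i ∈ I, (Nat.card (G i ≃+ G i) : ℝ)⁻¹ * ρ i := by
  have := Fintype.ofFinite (AddSubgroup W)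
  rw [← sum_genCard m P, Nat.cast_sum]
  have hGpos : ∀ i, (0 : ℝ) < Nat.card (G i) := fun i => by exact_mod_cast Nat.card_pos
  have hApos : ∀ i, (0 : ℝ) < Nat.card (G i ≃+ G i) := fun i => by
    exact_mod_cast card_aut_pos (G i)
  -- Since |K| = |W| / |G i|, this is the bound on `genCard m K` for any K with quotient `G i`; the
  -- power of |G i| later cancels against the number of such K.
  set c : ι → ℝ := fun i => (Nat.card W : ℝ) ^ m * ρ i / (Nat.card (G i) : ℝ) ^ m with hc
  have hc0 : ∀ i, 0 ≤ c i := fun i => by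
    have := hρ i
    positivity
  calc ∑ K : AddSubgroup W with P K, (genCard m K : ℝ)
      ≤ ∑ K : AddSubgroup W with P K, ∑ i ∈ I, if Nonempty (W ⧸ K ≃+ G i) then c i else 0 := by
        refine Finset.sum_le_sum fun K hK => ?_
        have hPK : P K := (Finset.mem_filter.1 hK).2
        obtain ⟨i, hi, hiso⟩ := hcover K hPK
        have h1 : (if Nonempty (W ⧸ K ≃+ G i) then c i else 0) ≤
            ∑ i ∈ I, if Nonempty (W ⧸ K ≃+ G i) then c i else 0 :=
          Finset.single_le_sum (f := fun i => if Nonempty (W ⧸ K ≃+ G i) then c i else 0)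
            (fun j _ => by split_ifs <;> simp [hc0]) hi
        refine le_trans ?_ h1
        rw [if_pos hiso]
        refine (hgen K i hPK hiso).trans (le_of_eq ?_)
        have h2 : (Nat.card W : ℝ) = Nat.card K * Nat.card (G i) := by
          rw [← Nat.card_congr hiso.some.toEquiv, ← Nat.cast_mul]
          exact_mod_cast (AddSubgroup.card_mul_index K).symm
        rw [hc]
        dsimp only
        rw [h2, mul_pow]
        have := (hGpos i).ne'
        field_simp
    _ ≤ ∑ K : AddSubgroup W, ∑ i ∈ I, if Nonempty (W ⧸ K ≃+ G i) then c i else 0 :=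
        Finset.sum_le_sum_of_subset_of_nonneg (Finset.filter_subset _ _) fun K _ _ =>
          Finset.sum_nonneg fun i _ => by split_ifs <;> simp [hc0]
    _ = ∑ i ∈ I, (Nat.card {K : AddSubgroup W // Nonempty (W ⧸ K ≃+ G i)} : ℝ) * c i := by
        rw [Finset.sum_comm]
        refine Finset.sum_congr rfl fun i _ => ?_
        rw [← Finset.sum_filter, Finset.sum_const, nsmul_eq_mul, Nat.card_eq_fintype_card,
          Fintype.card_subtype]
    _ ≤ ∑ i ∈ I, (Nat.card W : ℝ) ^ m * ((Nat.card (G i ≃+ G i) : ℝ)⁻¹ * ρ i) := by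
        refine Finset.sum_le_sum fun i _ => ?_
        have h1 : (Nat.card {K : AddSubgroup W // Nonempty (W ⧸ K ≃+ G i)} : ℝ) *
            Nat.card (G i ≃+ G i) ≤ (Nat.card (G i) : ℝ) ^ m := by
          exact_mod_cast (card_subgroup_mul_card_aut_le W (G i)).trans (hHom i)
        have h2 : (Nat.card {K : AddSubgroup W // Nonempty (W ⧸ K ≃+ G i)} : ℝ) ≤
            (Nat.card (G i) : ℝ) ^ m / Nat.card (G i ≃+ G i) := (le_div_iff₀ (hApos i)).2 h1
        refine (mul_le_mul_of_nonneg_right h2 (hc0 i)).trans (le_of_eq ?_)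
        rw [hc]
        have := (hGpos i).ne'
        have := (hApos i).ne'
        field_simp
    _ = _ := by rw [← Finset.mul_sum]

/-- Few tuples lie in the kernel of a surjection onto a group with many automorphisms. -/
theorem card_killed_le {G : Type} [AddCommGroup G] [Finite G] {a : ℕ} (ha : 0 < a)
    (hHom : Nat.card (W →+ G) ≤ Nat.card G ^ m) (hG : a ≤ Nat.card (G ≃+ G))
    (P : (Fin m → W) → Prop)
    (hP : ∀ A, P A → ∃ f : W →+ G, Function.Surjective f ∧ ∀ i, f (A i) = 0) :
    (Nat.card {A : Fin m → W // P A} : ℝ) ≤ (Nat.card W : ℝ) ^ m * (a : ℝ)⁻¹ := by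
  have h1 : Nat.card {A : Fin m → W // P A} ≤
      Nat.card {A : Fin m → W // ∃ f : W →+ G, Function.Surjective f ∧ ∀ i, f (A i) = 0} :=
    Nat.card_le_card_of_injective (fun A => ⟨A.1, hP A.1 A.2⟩) fun A B hAB => by
      apply Subtype.ext
      simpa using hAB
  have h2 : Nat.card {A : Fin m → W // P A} * a ≤ Nat.card W ^ m :=
    (Nat.mul_le_mul h1 hG).trans (card_killed_mul_card_aut_le hHom)
  rw [← div_eq_mul_inv, le_div_iff₀ (by exact_mod_cast ha)]
  exact_mod_cast h2

theorem card_hasRank_le (q h m : ℕ) [NeZero q] :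
    (Nat.card {A : Fin m → (Fin m → ZMod q) //
      HasRank h ((Fin m → ZMod q) ⧸ AddSubgroup.closure (Set.range A))} : ℝ) ≤
      (Nat.card (Fin m → ZMod q) : ℝ) ^ m * (2 ^ (h * (h - 1)))⁻¹ := by
  have h1 := card_killed_le (W := Fin m → ZMod q) (m := m) (G := Fin h → ZMod 2)
    (a := 2 ^ (h * (h - 1))) (by positivity) (card_hom_pi_zmod_le q m _) (two_pow_le_card_aut h)
    (fun A => HasRank h ((Fin m → ZMod q) ⧸ AddSubgroup.closure (Set.range A)))
    (fun A ⟨ψ, hψ⟩ => ⟨ψ.comp (QuotientAddGroup.mk' _),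
      hψ.comp (QuotientAddGroup.mk'_surjective _), fun i => by
        have h2 : (QuotientAddGroup.mk' (AddSubgroup.closure (Set.range A))) (A i) = 0 :=
          (QuotientAddGroup.eq_zero_iff _).2 (AddSubgroup.subset_closure ⟨i, rfl⟩)
        rw [AddMonoidHom.comp_apply, h2, map_zero]⟩)
  simpa using h1

/-- A group of exponent dividing `2 ^ e` and not dividing `2 ^ (e - 1)` surjects onto
`ℤ / 2 ^ e`. -/
theorem exists_surjective_zmod {e : ℕ} (he : 0 < e) (hW : ∀ x : W, 2 ^ e • x = 0)
    {x : W} (hx : 2 ^ (e - 1) • x ≠ 0) :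
    ∃ f : W →+ ZMod (2 ^ e), Function.Surjective f := by
  have : NeZero (2 ^ e) := ⟨by positivity⟩
  have : NeZero (Monoid.exponent (Multiplicative W)) :=
    ⟨Monoid.exponent_ne_zero_of_finite⟩
  -- A complex character that is nontrivial on 2^(e-1) x takes values in the cyclic group of 2^e-th
  -- roots of unity, which serves as a copy of ℤ / 2^e.
  obtain ⟨χ, hχ⟩ := CommGroup.exists_apply_ne_one_of_hasEnoughRootsOfUnity (Multiplicative W) ℂ
    (a := Multiplicative.ofAdd (2 ^ (e - 1) • x)) (fun h0 => hx h0)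
  let χ' : Multiplicative W →* rootsOfUnity (2 ^ e) ℂ := χ.codRestrict _ fun w => by
    rw [mem_rootsOfUnity, ← map_pow]
    have : w ^ (2 ^ e) = 1 := hW w.toAdd
    rw [this, map_one]
  have hcard : Nat.card (Multiplicative (ZMod (2 ^ e))) = Nat.card (rootsOfUnity (2 ^ e) ℂ) := by
    rw [HasEnoughRootsOfUnity.natCard_rootsOfUnity ℂ (2 ^ e), Nat.card_eq_fintype_card]
    simp
  have : IsCyclic (Multiplicative (ZMod (2 ^ e))) := inferInstance
  have : IsCyclic (rootsOfUnity (2 ^ e) ℂ) := inferInstance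
  let φ : rootsOfUnity (2 ^ e) ℂ ≃* Multiplicative (ZMod (2 ^ e)) := mulEquivOfCyclicCardEq hcard.symm
  let f : W →+ ZMod (2 ^ e) := AddMonoidHom.toMultiplicative.symm (φ.toMonoidHom.comp χ')
  have hf : f (2 ^ (e - 1) • x) ≠ 0 := by
    intro h0
    apply hχ
    have h1 : φ (χ' (Multiplicative.ofAdd (2 ^ (e - 1) • x))) = 1 := h0
    rw [map_eq_one_iff φ φ.injective] at h1
    exact congrArg Subtype.val h1
  -- An even residue mod 2^e is killed by 2^(e-1); hence f x is odd, and a unit generates.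
  have hunit : IsUnit (f x) := by
    rw [← ZMod.natCast_zmod_val (f x), ZMod.isUnit_iff_coprime, Nat.coprime_pow_right_iff he,
      Nat.coprime_two_right]
    by_contra hev
    rw [Nat.not_odd_iff_even] at hev
    obtain ⟨k, hk⟩ := hev
    apply hf
    rw [map_nsmul, ← ZMod.natCast_zmod_val (f x), hk, nsmul_eq_mul, ← two_mul, ← Nat.cast_mul,
      ← mul_assoc, ← pow_succ, Nat.sub_add_cancel he, ZMod.natCast_eq_zero_iff]
    exact dvd_mul_right _ _
  obtain ⟨u, hu⟩ := hunit
  refine ⟨f, fun y => ⟨(y * (↑u⁻¹ : ZMod (2 ^ e))).val • x, ?_⟩⟩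
  rw [map_nsmul, nsmul_eq_mul, ZMod.natCast_zmod_val, ← hu, mul_assoc, Units.inv_mul, mul_one]

/-- If the generated subgroup misses part of 2^(e-1) W, the quotient surjects onto ℤ / 2^e, which
has 2^(e-1) automorphisms; so such tuples are rare. -/
theorem card_exponent_le {e : ℕ} (he : 0 < e) (m : ℕ) :
    (Nat.card {A : Fin m → (Fin m → ZMod (2 ^ e)) //
      ¬ ∀ x : Fin m → ZMod (2 ^ e), 2 ^ (e - 1) • x ∈ AddSubgroup.closure (Set.range A)} : ℝ) ≤
      (Nat.card (Fin m → ZMod (2 ^ e)) : ℝ) ^ m * (2 ^ (e - 1))⁻¹ := by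
  have h1 := card_killed_le (W := Fin m → ZMod (2 ^ e)) (m := m) (G := ZMod (2 ^ e))
    (a := 2 ^ (e - 1)) (by positivity) (card_hom_pi_zmod_le (2 ^ e) m _)
    (two_pow_le_card_aut_zmod he)
    (fun A => ¬ ∀ x : Fin m → ZMod (2 ^ e), 2 ^ (e - 1) • x ∈ AddSubgroup.closure (Set.range A)) ?_
  · simpa using h1
  intro A hA
  push Not at hA
  obtain ⟨x, hx⟩ := hA
  have h2 : ∀ y : (Fin m → ZMod (2 ^ e)) ⧸ AddSubgroup.closure (Set.range A), 2 ^ e • y = 0 := by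
    intro y
    obtain ⟨w, rfl⟩ := QuotientAddGroup.mk_surjective y
    have : 2 ^ e • w = 0 := by
      ext i
      rw [Pi.smul_apply, nsmul_eq_mul, Nat.cast_pow, ← Nat.cast_pow, ZMod.natCast_self, zero_mul]
      rfl
    rw [← QuotientAddGroup.mk_nsmul, this]
    rfl
  obtain ⟨f, hf⟩ := exists_surjective_zmod he h2
    (x := (QuotientAddGroup.mk x : (Fin m → ZMod (2 ^ e)) ⧸ AddSubgroup.closure (Set.range A))) (by
      rw [← QuotientAddGroup.mk_nsmul]
      exact fun h0 => hx ((QuotientAddGroup.eq_zero_iff _).1 h0))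
  refine ⟨f.comp (QuotientAddGroup.mk' _), hf.comp (QuotientAddGroup.mk'_surjective _),
    fun i => ?_⟩
  have h3 : (QuotientAddGroup.mk' (AddSubgroup.closure (Set.range A))) (A i) = 0 :=
    (QuotientAddGroup.eq_zero_iff _).2 (AddSubgroup.subset_closure ⟨i, rfl⟩)
  rw [AddMonoidHom.comp_apply, h3, map_zero]

end Mass

/-! ### Lower bounds for the Cohen-Lenstra mass of small rank. -/

section CohenLenstra

/-- The partial products of `∏ (1 - 2 ^ (-j))`. -/
def eulerPart (m : ℕ) : ℝ := ∏ j ∈ Finset.range m, (1 - ((2 : ℝ) ^ (j + 1))⁻¹)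

theorem inv_two_pow_succ_le (j : ℕ) : ((2 : ℝ) ^ (j + 1))⁻¹ ≤ 1 / 2 := by
  rw [one_div]
  refine inv_anti₀ (by norm_num) ?_
  rw [pow_succ]
  have : (1 : ℝ) ≤ 2 ^ j := one_le_pow₀ (by norm_num)
  linarith

theorem eulerPart_pos (m : ℕ) : 0 < eulerPart m :=
  Finset.prod_pos fun j _ => by
    have := inv_two_pow_succ_le j
    linarith

/-- The factors of the generation probability are 1 - 2^(-j) for k < j ≤ m, in reverse order. -/
theorem genRatio_mul_eulerPart {k m : ℕ} (hk : k ≤ m) :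
    genRatio m (m - k) * eulerPart k = eulerPart m := by
  obtain ⟨l, rfl⟩ := Nat.exists_eq_add_of_le hk
  rw [Nat.add_sub_cancel_left, eulerPart, eulerPart, Finset.prod_range_add, mul_comm, genRatio,
    ← Finset.prod_range_reflect (fun i => (1 - 2 ^ i / 2 ^ (k + l) : ℝ))]
  congr 1
  refine Finset.prod_congr rfl fun i hi => ?_
  rw [Finset.mem_range] at hi
  have h1 : k + l = (l - 1 - i) + (k + i + 1) := by omega
  rw [h1, pow_add]
  have h2 : (2 : ℝ) ^ (l - 1 - i) ≠ 0 := by positivity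
  field_simp

theorem genRatio_self (m : ℕ) : genRatio m m = eulerPart m := by
  have := genRatio_mul_eulerPart (Nat.zero_le m)
  simpa [eulerPart] using this

theorem genRatio_nonneg (k m : ℕ) : 0 ≤ genRatio m (m - k) := by
  refine Finset.prod_nonneg fun i hi => ?_
  rw [Finset.mem_range] at hi
  rw [sub_nonneg, div_le_one (by positivity)]
  exact pow_le_pow_right₀ (by norm_num) (by omega)

theorem le_card_aut (k : ℕ) : (2 : ℝ) ^ (k ^ 2) * eulerPart k ≤
    Nat.card ((Fin k → ZMod 2) ≃+ (Fin k → ZMod 2)) := by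
  refine le_trans (le_of_eq ?_) (Nat.cast_le.2 (prod_le_card_aut k))
  rw [← genRatio_self, genRatio, ← Finset.prod_range (n := k) (fun i => 2 ^ k - 2 ^ i),
    Nat.cast_prod, sq, pow_mul]
  have h : ((2 : ℝ) ^ k) ^ k = ∏ _i ∈ Finset.range k, (2 : ℝ) ^ k := by simp
  rw [h, ← Finset.prod_mul_distrib]
  refine Finset.prod_congr rfl fun i hi => ?_
  have hle : 2 ^ i ≤ 2 ^ k :=
    Nat.pow_le_pow_right (by norm_num) (Finset.mem_range.1 hi).le
  rw [Nat.cast_sub hle, mul_sub, mul_one, mul_div_cancel₀ _ (by positivity)]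
  push_cast
  ring

theorem card_subtype_le_add {X : Type} [Finite X] {P Q R : X → Prop}
    (h : ∀ x, P x → Q x ∨ R x) :
    Nat.card {x // P x} ≤ Nat.card {x // Q x} + Nat.card {x // R x} := by
  classical
  have := Fintype.ofFinite X
  simp only [Nat.card_eq_fintype_card, Fintype.card_subtype]
  refine le_trans (Finset.card_le_card fun x hx => ?_) (Finset.card_union_le _ _)
  simpa using h x (by simpa using hx)

theorem card_le_add_of_or {X : Type} [Finite X] {P Q : X → Prop} (h : ∀ x, P x ∨ Q x) :
    Nat.card X ≤ Nat.card {x // P x} + Nat.card {x // Q x} := by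
  have h1 := card_subtype_le_add (P := fun _ : X => True) fun x _ => h x
  rwa [Nat.card_congr (Equiv.subtypeUnivEquiv fun _ => trivial)] at h1

theorem HasRank.mono {h k : ℕ} {G : Type} [AddCommGroup G] (hk : h ≤ k) (hG : HasRank k G) :
    HasRank h G := by
  obtain ⟨ψ, hψ⟩ := hG
  exact ⟨(LinearMap.funLeft (ZMod 2) (ZMod 2) (Fin.castLE hk)).toAddMonoidHom.comp ψ,
    (LinearMap.funLeft_surjective_of_injective (ZMod 2) (ZMod 2) (Fin.castLE hk)
      (Fin.castLE_injective hk)).comp hψ⟩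

theorem HasRank.of_surjective {h : ℕ} {G G' : Type} [AddCommGroup G] [AddCommGroup G']
    (hG : HasRank h G') (f : G →+ G') (hf : Function.Surjective f) : HasRank h G := by
  obtain ⟨ψ, hψ⟩ := hG
  exact ⟨ψ.comp f, hψ.comp hf⟩

theorem exists_addEquiv_fun {V : Type} [AddCommGroup V] [Finite V] (hV : ∀ x : V, 2 • x = 0) :
    ∃ k : ℕ, Nonempty (V ≃+ (Fin k → ZMod 2)) := by
  let : Module (ZMod 2) V := AddCommGroup.zmodModule hV
  exact ⟨_, ⟨(Module.finBasis (ZMod 2) V).equivFun.toAddEquiv⟩⟩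

theorem hasRank_of_le_card_ker {K : Type} [AddCommGroup K] [Finite K] {d : ℕ}
    (hK : 2 ^ d ≤ Nat.card (nsmulAddMonoidHom (α := K) 2).ker) : HasRank d K :=
  hasRank_of_le_card (by rwa [card_quotient_two_eq])

/-- The Cohen-Lenstra measure on ranks gives mass at least `1 - 2 ^ (- h (h - 1))` to the ranks
below `h`. -/
theorem le_sum_rank {h m : ℕ} (hm : h ≤ m) :
    1 - ((2 : ℝ) ^ (h * (h - 1)))⁻¹ ≤
      ∑ k ∈ Finset.range h, ((2 : ℝ) ^ (k ^ 2) * eulerPart k ^ 2)⁻¹ * eulerPart m := by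
  set W := Fin m → ZMod 2
  have hcardW : Nat.card W = 2 ^ m := by simp [W]
  have hW2 : ∀ x : W, 2 • x = 0 := fun x => by
    ext i
    rw [Pi.smul_apply, nsmul_eq_mul]
    have : ((2 : ℕ) : ZMod 2) = 0 := rfl
    rw [this, zero_mul]
    rfl
  have hbad := card_hasRank_le 2 h m
  -- A quotient (ℤ/2)^k leaves a subgroup isomorphic to (ℤ/2)^(m-k). Its generation ratio `eulerPart
  -- m / eulerPart k` and the lower bound 2^(k²) `eulerPart k` for the number of automorphisms give
  -- the square of `eulerPart k` in the result.
  have hgood := card_closure_le (W := W) (m := m) (Finset.range h) (fun k => Fin k → ZMod 2)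
    (fun k => genRatio m (m - k)) (fun k => genRatio_nonneg k m) (fun K => ¬ HasRank h (W ⧸ K))
    (fun k => card_hom_pi_zmod_le 2 m _) ?_ ?_
  · have hor := card_le_add_of_or (X := Fin m → W)
      (P := fun A => ¬ HasRank h (W ⧸ AddSubgroup.closure (Set.range A)))
      (Q := fun A => HasRank h (W ⧸ AddSubgroup.closure (Set.range A))) fun A => (em _).symm
    have hX : Nat.card (Fin m → W) = Nat.card W ^ m := by simp
    rw [hX] at hor
    have hor' : ((Nat.card W ^ m : ℕ) : ℝ) ≤ _ := Nat.cast_le.2 hor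
    have hpos : (0 : ℝ) < (Nat.card W : ℝ) ^ m := by
      rw [hcardW]
      positivity
    have h1 : 1 ≤ (∑ k ∈ Finset.range h, (Nat.card ((Fin k → ZMod 2) ≃+ (Fin k → ZMod 2)) : ℝ)⁻¹ *
        genRatio m (m - k)) + ((2 : ℝ) ^ (h * (h - 1)))⁻¹ := by
      refine le_of_mul_le_mul_left ?_ hpos
      rw [mul_one, mul_add]
      push_cast at hor'
      linarith
    refine le_trans (sub_le_iff_le_add.2 h1) (Finset.sum_le_sum fun k hk => ?_)
    have h2 := le_card_aut k
    have hkpos := eulerPart_pos k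
    have h3 : genRatio m (m - k) = (eulerPart k)⁻¹ * eulerPart m := by
      rw [← genRatio_mul_eulerPart ((Finset.mem_range.1 hk).le.trans hm)]
      field_simp
    rw [h3, ← mul_assoc]
    refine mul_le_mul_of_nonneg_right ?_ (eulerPart_pos m).le
    rw [← mul_inv]
    refine inv_anti₀ (by positivity) ?_
    rw [sq (eulerPart k), ← mul_assoc]
    exact mul_le_mul_of_nonneg_right h2 hkpos.le
  · intro K hK
    obtain ⟨k, hk⟩ := exists_addEquiv_fun (V := W ⧸ K) fun x => by
      obtain ⟨w, rfl⟩ := QuotientAddGroup.mk_surjective x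
      rw [← QuotientAddGroup.mk_nsmul, hW2]
      rfl
    refine ⟨k, ?_, hk⟩
    rw [Finset.mem_range]
    by_contra hlt
    exact hK (HasRank.mono (not_lt.1 hlt) ⟨hk.some.toAddMonoidHom, hk.some.surjective⟩)
  · intro K k _ hiso
    have h1 : Nat.card K * 2 ^ k = 2 ^ m := by
      rw [← hcardW, ← AddSubgroup.card_mul_index K, AddSubgroup.index,
        Nat.card_congr hiso.some.toEquiv]
      simp
    refine genCard_le (Nat.sub_le m k) K (hasRank_of_le_card_ker ?_)
    have h2 : (nsmulAddMonoidHom (α := K) 2).ker = ⊤ := by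
      rw [eq_top_iff]
      intro x _
      rw [AddMonoidHom.mem_ker]
      exact Subtype.ext (hW2 x.1)
    rw [h2, AddSubgroup.card_top]
    have hkm : k ≤ m := by
      have : 2 ^ k ≤ 2 ^ m := Nat.le_of_dvd (by positivity) ⟨_, by rw [← h1, mul_comm]⟩
      exact (Nat.pow_le_pow_iff_right (by norm_num)).1 this
    refine Nat.le_of_mul_le_mul_right ?_ (show 0 < 2 ^ k by positivity)
    rw [h1, ← pow_add, Nat.sub_add_cancel hkm]

/-- The Cohen-Lenstra measure gives mass close to one to the groups of rank below `h`. -/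
theorem exists_le_sum_inv_card_aut (h m : ℕ) {e : ℕ} (he : 0 < e) :
    ∃ (ι : Type) (I : Finset ι) (G : ι → Type) (_ : ∀ i, AddCommGroup (G i))
      (_ : ∀ i, Finite (G i)), (∀ i, IsPGroup 2 (Multiplicative (G i))) ∧
      (∀ i ∈ I, ∀ j ∈ I, Nonempty (G i ≃+ G j) → i = j) ∧ (∀ i, ¬ HasRank h (G i)) ∧
      1 - ((2 : ℝ) ^ (h * (h - 1)))⁻¹ - ((2 : ℝ) ^ (e - 1))⁻¹ ≤
        (∑ i ∈ I, (Nat.card (G i ≃+ G i) : ℝ)⁻¹) * eulerPart m := by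
  classical
  set W := Fin m → ZMod (2 ^ e) with hWdef
  have : NeZero (2 ^ e) := ⟨by positivity⟩
  have hWe : ∀ x : W, 2 ^ e • x = 0 := fun x => by
    ext i
    rw [Pi.smul_apply, nsmul_eq_mul, ZMod.natCast_self, zero_mul]
    rfl
  -- The first condition ensures that K contains 2^(e-1) W, of order 2^m and killed by 2. So K has
  -- rank at least m, and the generation ratio `eulerPart m` applies to every such K.
  set P : AddSubgroup W → Prop := fun K => (∀ x : W, 2 ^ (e - 1) • x ∈ K) ∧ ¬ HasRank h (W ⧸ K)
    with hP
  have : Fintype {K // P K} := Fintype.ofFinite _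
  -- One subgroup is kept per isomorphism type of the quotient; this makes the index set finite
  -- without any classification of groups.
  let s : Setoid {K // P K} :=
    { r := fun K L => Nonempty (W ⧸ K.1 ≃+ W ⧸ L.1)
      iseqv := ⟨fun _ => ⟨AddEquiv.refl _⟩, fun ⟨f⟩ => ⟨f.symm⟩, fun ⟨f⟩ ⟨g⟩ => ⟨f.trans g⟩⟩ }
  let r : {K // P K} → {K // P K} := fun K => (Quotient.mk s K).out
  have hr : ∀ K, Nonempty (W ⧸ (r K).1 ≃+ W ⧸ K.1) := fun K => Quotient.mk_out (s := s) K
  refine ⟨{K // P K}, Finset.univ.image r, fun K => W ⧸ K.1, fun K => inferInstance,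
    fun K => inferInstance, fun K => ?_, ?_, fun K => K.2.2, ?_⟩
  · intro g
    refine ⟨e, ?_⟩
    obtain ⟨w, hw⟩ := QuotientAddGroup.mk_surjective (Multiplicative.toAdd g)
    have h1 : 2 ^ e • Multiplicative.toAdd g = 0 := by
      rw [← hw, ← QuotientAddGroup.mk_nsmul, hWe]
      rfl
    exact h1
  · intro K hK L hL hKL
    obtain ⟨K', -, rfl⟩ := Finset.mem_image.1 hK
    obtain ⟨L', -, rfl⟩ := Finset.mem_image.1 hL
    have h1 : Quotient.mk s (r K') = Quotient.mk s (r L') := Quotient.sound hKL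
    have h2 : Quotient.mk s K' = Quotient.mk s L' := by
      rw [← Quotient.out_eq (Quotient.mk s K'), ← Quotient.out_eq (Quotient.mk s L')]
      exact h1
    exact congrArg Quotient.out h2
  · have hbad := card_hasRank_le (2 ^ e) h m
    have hbad' := card_exponent_le he m
    have hgood := card_closure_le (W := W) (m := m) (Finset.univ.image r) (fun K => W ⧸ K.1)
      (fun _ => eulerPart m) (fun _ => (eulerPart_pos m).le) P
      (fun K => card_hom_pi_zmod_le (2 ^ e) m _) ?_ ?_
    · have hor := card_le_add_of_or (X := Fin m → W)
        (P := fun A => P (AddSubgroup.closure (Set.range A)))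
        (Q := fun A => ¬ P (AddSubgroup.closure (Set.range A))) fun A => em _
      have hor' := card_subtype_le_add (X := Fin m → W)
        (P := fun A => ¬ P (AddSubgroup.closure (Set.range A)))
        (Q := fun A => HasRank h (W ⧸ AddSubgroup.closure (Set.range A)))
        (R := fun A => ¬ ∀ x : W, 2 ^ (e - 1) • x ∈ AddSubgroup.closure (Set.range A)) fun A hA => by
          by_contra hcon
          push Not at hcon
          exact hA ⟨hcon.2, hcon.1⟩
      have hX : Nat.card (Fin m → W) = Nat.card W ^ m := by simp
      rw [hX] at hor
      have hsum : ((Nat.card W ^ m : ℕ) : ℝ) ≤ _ :=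
        Nat.cast_le.2 (hor.trans (Nat.add_le_add_left hor' _))
      push_cast at hsum
      have hpos : (0 : ℝ) < (Nat.card W : ℝ) ^ m :=
        pow_pos (by exact_mod_cast Nat.card_pos) m
      rw [← Finset.sum_mul] at hgood
      refine le_of_mul_le_mul_left ?_ hpos
      rw [mul_sub, mul_sub, mul_one]
      linarith
    · intro K hK
      exact ⟨r ⟨K, hK⟩, Finset.mem_image_of_mem _ (Finset.mem_univ _), ⟨(hr ⟨K, hK⟩).some.symm⟩⟩
    · intro K _ hK _
      rw [← genRatio_self]
      refine genCard_le le_rfl K (hasRank_of_le_card_ker ?_)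
      -- The elements 2^(e-1) a with a in {0,1}^m are 2^m distinct elements of K killed by 2.
      let F : (Fin m → Fin 2) → (nsmulAddMonoidHom (α := K) 2).ker := fun a =>
        ⟨⟨2 ^ (e - 1) • fun i => ((a i : ℕ) : ZMod (2 ^ e)), hK.1 _⟩, by
          rw [AddMonoidHom.mem_ker]
          refine Subtype.ext ?_
          have h1 : 2 • (2 ^ (e - 1) • fun i => ((a i : ℕ) : ZMod (2 ^ e)) : W) = 0 := by
            rw [← mul_nsmul', ← pow_succ', Nat.sub_add_cancel he, hWe]
          exact h1⟩
      have hF : Function.Injective F := by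
        intro a b hab
        have h1 : (2 ^ (e - 1) • fun i => ((a i : ℕ) : ZMod (2 ^ e)) : W) =
            2 ^ (e - 1) • fun i => ((b i : ℕ) : ZMod (2 ^ e)) :=
          congrArg (fun z => z.1.1) hab
        ext i
        have h2 : 2 ^ (e - 1) • ((a i : ℕ) : ZMod (2 ^ e)) = 2 ^ (e - 1) • ((b i : ℕ) : ZMod (2 ^ e)) :=
          congrFun h1 i
        simp only [nsmul_eq_mul, ← Nat.cast_mul] at h2
        rw [ZMod.natCast_eq_natCast_iff'] at h2
        have hlt : ∀ c : Fin 2, 2 ^ (e - 1) * (c : ℕ) < 2 ^ e := by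
          intro c
          have : 2 ^ e = 2 ^ (e - 1) * 2 := by rw [← pow_succ, Nat.sub_add_cancel he]
          rw [this]
          exact Nat.mul_lt_mul_of_pos_left c.2 (by positivity)
        rw [Nat.mod_eq_of_lt (hlt _), Nat.mod_eq_of_lt (hlt _)] at h2
        exact Nat.eq_of_mul_eq_mul_left (by positivity) h2
      have h3 := Nat.card_le_card_of_injective F hF
      simpa using h3

end CohenLenstra

/-! ### Comparison of the two masses. -/

section Refutation

variable {v : ℕ}

theorem exists_surjective_homology (S : Hypertree (v + 1)) :
    ∃ f : H1 ℤ S.1 →+ H1 (ZMod 2) S.1, Function.Surjective f := by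
  have hS := S.2.complete_skeleton
  set N := Submodule.span (ZMod 2) (colVec (ZMod 2) '' (triangles S.1 : Set (Col v)))
  let red : (Edge v → ℤ) →+ (Edge v → ZMod 2) :=
    { toFun := fun w e => (w e : ZMod 2)
      map_zero' := funext fun e => Int.cast_zero
      map_add' := fun w w' => funext fun e => Int.cast_add _ _ }
  have hred : Function.Surjective red := fun y =>
    ⟨fun e => ((y e).val : ℤ), funext fun e => by
      change (((y e).val : ℤ) : ZMod 2) = y e
      simp⟩
  let g : (Edge v → ℤ) →ₗ[ℤ] (Edge v → ZMod 2) ⧸ N :=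
    (N.mkQ.toAddMonoidHom.comp red).toIntLinearMap
  have hg : Submodule.span ℤ (colVec ℤ '' (triangles S.1 : Set (Col v))) ≤ LinearMap.ker g := by
    rw [Submodule.span_le]
    rintro _ ⟨t, ht, rfl⟩
    rw [SetLike.mem_coe, LinearMap.mem_ker]
    have h1 : red (colVec ℤ t) = colVec (ZMod 2) t := by
      funext e
      change ((colMat ℤ v e t : ℤ) : ZMod 2) = colMat (ZMod 2) v e t
      rw [← colMat_map (Int.castRingHom (ZMod 2))]
      rfl
    change N.mkQ (red (colVec ℤ t)) = 0
    rw [h1, Submodule.mkQ_apply, Submodule.Quotient.mk_eq_zero]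
    exact Submodule.subset_span ⟨t, ht, rfl⟩
  refine ⟨((homologyEquiv hS (ZMod 2)).symm.toLinearMap.toAddMonoidHom.comp
    ((Submodule.liftQ _ g hg).toAddMonoidHom)).comp (homologyEquiv hS ℤ).toLinearMap.toAddMonoidHom,
    ?_⟩
  have hsurj : Function.Surjective (Submodule.liftQ _ g hg) := by
    intro y
    obtain ⟨w, rfl⟩ := N.mkQ_surjective y
    obtain ⟨u, rfl⟩ := hred w
    exact ⟨Submodule.Quotient.mk u, rfl⟩
  exact ((homologyEquiv hS (ZMod 2)).symm.surjective.comp hsurj).comp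
    (homologyEquiv hS ℤ).surjective

/-- Multiplication by the odd part of |H| moves any element into the 2-primary component and does
not change its image in an F_2-vector space. -/
theorem HasRank.primaryComponent {h : ℕ} {H : Type} [AddCommGroup H] [Finite H]
    (hH : HasRank h H) : HasRank h (AddCommGroup.primaryComponent H 2) := by
  obtain ⟨ψ, hψ⟩ := hH
  refine ⟨ψ.comp (AddCommGroup.primaryComponent H 2).subtype, fun y => ?_⟩
  obtain ⟨x, rfl⟩ := hψ y
  obtain ⟨a, b, hb, hab⟩ := Nat.exists_eq_two_pow_mul_odd (n := Nat.card H) Nat.card_pos.ne'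
  have hmem : b • x ∈ AddCommGroup.primaryComponent H 2 := by
    refine ⟨a, ?_⟩
    rw [← mul_nsmul', ← hab]
    exact card_nsmul_eq_zero'
  refine ⟨⟨b • x, hmem⟩, ?_⟩
  change ψ (b • x) = ψ x
  rw [map_nsmul]
  funext i
  obtain ⟨c, rfl⟩ := hb
  rw [Pi.smul_apply, nsmul_eq_mul]
  have h2 : (2 : ZMod 2) = 0 := rfl
  push_cast
  rw [h2, zero_mul, zero_add, one_mul]

theorem hasRank_torsion {h : ℕ} (S : Hypertree (v + 1)) (hS : h ≤ bettiOne 2 S) :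
    HasRank h (Torsion 2 S) := by
  have := S.2.finite_homology
  obtain ⟨f, hf⟩ := exists_surjective_homology S
  refine HasRank.primaryComponent (HasRank.of_surjective ?_ f hf)
  refine HasRank.mono hS ?_
  exact ⟨(Module.finBasis (ZMod 2) (H1 (ZMod 2) S.1)).equivFun.toAddEquiv.toAddMonoidHom,
    (Module.finBasis (ZMod 2) (H1 (ZMod 2) S.1)).equivFun.surjective⟩

open Classical in
theorem sum_prob_add_prob_le (hv : 1 ≤ v) {ι : Type} (I : Finset ι)
    (E : ι → Hypertree (v + 1) → Prop) (F : Hypertree (v + 1) → Prop)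
    (hE : ∀ S, ∀ i ∈ I, ∀ j ∈ I, E i S → E j S → i = j) (hF : ∀ S, ∀ i ∈ I, E i S → ¬ F S) :
    ∑ i ∈ I, prob (v + 1) (E i) + prob (v + 1) F ≤ 1 := by
  rw [← sum_weight hv]
  simp only [prob, Finset.sum_filter]
  rw [Finset.sum_comm, ← Finset.sum_add_distrib]
  refine Finset.sum_le_sum fun S _ => ?_
  by_cases hS : ∃ i ∈ I, E i S
  · obtain ⟨i, hi, hiS⟩ := hS
    rw [if_neg (hF S i hi hiS), add_zero, Finset.sum_eq_single_of_mem i hi, if_pos hiS]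
    intro j hj hji
    rw [if_neg fun hjS => hji (hE S j hj i hi hjS hiS)]
  · push Not at hS
    rw [Finset.sum_eq_zero fun i hi => if_neg (hS i hi), zero_add]
    split_ifs
    exacts [le_rfl, weight_nonneg S]

theorem tendsto_eulerPart : Tendsto eulerPart atTop (𝓝 (eulerProd 2)) := by
  have h1 : Summable fun j : ℕ => -((2 : ℝ) ^ (j + 1))⁻¹ := by
    have h2 : Summable fun j : ℕ => ((1 : ℝ) / 2) ^ (j + 1) :=
      (summable_nat_add_iff 1).2 summable_geometric_two
    refine h2.neg.congr fun j => ?_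
    rw [one_div, inv_pow]
  have h3 := (Real.multipliable_one_add_of_summable h1).tendsto_prod_tprod_nat
  simp only [← sub_eq_add_neg] at h3
  simp only [eulerProd, Nat.cast_ofNat]
  exact h3

/-- The summand beyond 1 / 4 makes the induction close; the bound serves only to show that the
infinite product is positive. -/
theorem le_eulerPart (m : ℕ) : 1 / 4 + ((2 : ℝ) ^ (m + 2))⁻¹ ≤ eulerPart (m + 1) := by
  induction m with
  | zero => norm_num [eulerPart]
  | succ m ih =>
    rw [eulerPart, Finset.prod_range_succ, ← eulerPart]
    set t : ℝ := ((2 : ℝ) ^ (m + 2))⁻¹ with ht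
    have h1 : ((2 : ℝ) ^ (m + 1 + 2))⁻¹ = t / 2 := by
      rw [ht, pow_succ _ (m + 2), mul_inv]
      ring
    have h2 : t ≤ 1 / 4 := by
      rw [ht, one_div]
      refine inv_anti₀ (by norm_num) ?_
      have : (1 : ℝ) ≤ 2 ^ m := one_le_pow₀ (by norm_num)
      rw [pow_add]
      linarith
    have h3 : 0 < t := by positivity
    rw [h1]
    refine le_trans ?_ (mul_le_mul_of_nonneg_right ih (by linarith))
    nlinarith

theorem eulerProd_two_pos : 0 < eulerProd 2 := by
  have h1 : (1 : ℝ) / 4 ≤ eulerProd 2 := by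
    refine ge_of_tendsto ((tendsto_add_atTop_iff_nat 1).2 tendsto_eulerPart)
      (Eventually.of_forall fun m => ?_)
    refine le_trans ?_ (le_eulerPart m)
    have : (0 : ℝ) < ((2 : ℝ) ^ (m + 2))⁻¹ := by positivity
    linarith
  linarith

/-- The lower bound for the probability that the first Betti number modulo `2` is large exceeds
the Cohen-Lenstra mass of the groups of large rank. -/
theorem exists_inv_two_pow_lt : ∃ h : ℕ, 0 < h ∧ ((2 : ℝ) ^ (h * (h - 1)))⁻¹ <
    Real.exp (-(200 * (h : ℝ))) / (100 * (h : ℝ)) ^ (5 * h) := by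
  -- From e² ≤ 2³ and 100 · 512 ≤ 2^16, the reciprocal of the right side is at most 2^(300h + 80h),
  -- so it suffices that h - 1 > 380.
  refine ⟨512, by norm_num, ?_⟩
  have h1 : Real.exp 1 ^ 2 ≤ 2 ^ 3 := by
    have := Real.exp_one_lt_d9
    have h0 := Real.exp_pos 1
    nlinarith
  have h2 : Real.exp (200 * 512) ≤ 2 ^ (300 * 512) := by
    calc Real.exp (200 * 512) = (Real.exp 1 ^ 2) ^ (100 * 512) := by
          rw [← pow_mul, ← Real.exp_nat_mul]
          congr 1
          norm_num
      _ ≤ (2 ^ 3) ^ (100 * 512) := pow_le_pow_left₀ (by positivity) h1 _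
      _ = 2 ^ (300 * 512) := by rw [← pow_mul]
  have h3 : ((100 : ℝ) * 512) ^ (5 * 512) ≤ 2 ^ (80 * 512) := by
    calc ((100 : ℝ) * 512) ^ (5 * 512) ≤ (2 ^ 16) ^ (5 * 512) :=
          pow_le_pow_left₀ (by norm_num) (by norm_num) _
      _ = 2 ^ (80 * 512) := by rw [← pow_mul]
  have h4 : (0 : ℝ) < (100 * 512) ^ (5 * 512) := pow_pos (by norm_num) _
  rw [Real.exp_neg, div_eq_mul_inv, ← mul_inv]
  push_cast
  refine inv_strictAnti₀ (mul_pos (Real.exp_pos _) h4) ?_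
  calc Real.exp (200 * 512) * (100 * 512) ^ (5 * 512)
      ≤ 2 ^ (300 * 512) * 2 ^ (80 * 512) := mul_le_mul h2 h3 h4.le (pow_nonneg (by norm_num) _)
    _ = 2 ^ (380 * 512) := by rw [← pow_add]
    _ < 2 ^ (512 * (512 - 1)) := pow_lt_pow_right₀ (by norm_num) (by norm_num)

/-- The events in `I` are disjoint from each other and from Betti number at least h, so their
probabilities leave room for the lower bound of the latter. As `I` is finite, this passes to the
limit. -/
theorem sum_limit_le {ι : Type} (I : Finset ι) (E : (n : ℕ) → ι → Hypertree n → Prop) (c : ι → ℝ)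
    (hlim : ∀ i ∈ I, Tendsto (fun n => prob n (E n i)) atTop (𝓝 (c i))) {h : ℕ} (hh : 0 < h)
    (hE : ∀ v S, ∀ i ∈ I, ∀ j ∈ I, E (v + 1) i S → E (v + 1) j S → i = j)
    (hF : ∀ v S, ∀ i ∈ I, E (v + 1) i S → ¬ h ≤ bettiOne 2 S) :
    ∑ i ∈ I, c i ≤ 1 - Real.exp (-(200 * (h : ℝ))) / (100 * (h : ℝ)) ^ (5 * h) := by
  refine le_of_tendsto (tendsto_finsetSum I hlim) ?_
  filter_upwards [eventually_le_prob h hh, eventually_ge_atTop 2] with n hn h2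
  obtain ⟨v, rfl⟩ : ∃ v, n = v + 1 := ⟨n - 1, by omega⟩
  have h3 := sum_prob_add_prob_le (by omega : 1 ≤ v) I (E (v + 1)) (fun S => h ≤ bettiOne 2 S)
    (hE v) (hF v)
  linarith

theorem prod_Icc_eq_eulerPart (k : ℕ) :
    ∏ j ∈ Finset.Icc 1 k, ((1 - ((2 : ℝ) ^ j)⁻¹) ^ 2)⁻¹ = (eulerPart k ^ 2)⁻¹ := by
  rw [eulerPart, ← Finset.prod_pow, ← Finset.prod_inv_distrib, Finset.range_eq_Ico,
    Finset.prod_Ico_add' (fun j => ((1 - ((2 : ℝ) ^ j)⁻¹) ^ 2)⁻¹) 0 k 1]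
  rfl

theorem not_rankPrediction_two : ¬ RankPrediction 2 := by
  intro hpred
  obtain ⟨h, hh, hlt⟩ := exists_inv_two_pow_lt
  have h1 := sum_limit_le (Finset.range h) (fun n k S => bettiOne 2 S = k) _
    (fun k _ => hpred k) hh (fun v S i _ j _ hi hj => hi.symm.trans hj) fun v S i hi hS hle => by
      rw [Finset.mem_range] at hi
      omega
  have h2 : 1 - ((2 : ℝ) ^ (h * (h - 1)))⁻¹ ≤
      ∑ k ∈ Finset.range h, ((2 : ℝ) ^ (k ^ 2) * eulerPart k ^ 2)⁻¹ * eulerProd 2 := by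
    refine ge_of_tendsto (tendsto_finsetSum (Finset.range h) fun k _ =>
      tendsto_eulerPart.const_mul (((2 : ℝ) ^ (k ^ 2) * eulerPart k ^ 2)⁻¹)) ?_
    filter_upwards [eventually_ge_atTop h] with m hm using le_sum_rank hm
  have h3 : ∀ k : ℕ, (((2 : ℕ) : ℝ) ^ (k ^ 2))⁻¹ *
      (∏ j ∈ Finset.Icc 1 k, ((1 - (((2 : ℕ) : ℝ) ^ j)⁻¹) ^ 2)⁻¹) * eulerProd 2 =
      ((2 : ℝ) ^ (k ^ 2) * eulerPart k ^ 2)⁻¹ * eulerProd 2 := fun k => by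
    rw [Nat.cast_ofNat, prod_Icc_eq_eulerPart, mul_inv]
  simp only [h3] at h1
  linarith

theorem not_kahleNewman_two : ¬ KahleNewman 2 := by
  intro hpred
  obtain ⟨h, hh, hlt⟩ := exists_inv_two_pow_lt
  set b := Real.exp (-(200 * (h : ℝ))) / (100 * (h : ℝ)) ^ (5 * h)
  -- The finite family of groups depends on m. Multiplying the mass bound by `eulerProd 2` and the
  -- limit bound by `eulerPart m` eliminates the common sum over the family, so no infinite sum over
  -- groups is needed and m can tend to infinity.
  have key : ∀ m : ℕ, eulerProd 2 * (1 - ((2 : ℝ) ^ (h * (h - 1)))⁻¹ - ((2 : ℝ) ^ m)⁻¹) ≤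
      eulerPart m * (1 - b) := by
    intro m
    obtain ⟨ι, I, G, _, _, hG, hI, hrank, hmass⟩ :=
      exists_le_sum_inv_card_aut h m (e := m + 1) (Nat.succ_pos m)
    have h1 := sum_limit_le I (fun n i S => Nonempty (Torsion 2 S ≃+ G i)) _
      (fun i _ => hpred (G i) (hG i)) hh
      (fun v S i hi j hj ⟨f⟩ ⟨g⟩ => hI i hi j hj ⟨f.symm.trans g⟩)
      fun v S i _ ⟨f⟩ hS => hrank i
        ((hasRank_torsion S hS).of_surjective f.symm.toAddMonoidHom f.symm.surjective)
    rw [← Finset.sum_mul] at h1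
    rw [Nat.add_sub_cancel] at hmass
    have h2 := eulerProd_two_pos
    have h3 := eulerPart_pos m
    calc _ ≤ eulerProd 2 * ((∑ i ∈ I, (Nat.card (G i ≃+ G i) : ℝ)⁻¹) * eulerPart m) :=
          mul_le_mul_of_nonneg_left hmass h2.le
      _ = eulerPart m * ((∑ i ∈ I, (Nat.card (G i ≃+ G i) : ℝ)⁻¹) * eulerProd 2) := by ring
      _ ≤ _ := mul_le_mul_of_nonneg_left h1 h3.le
  have hinv : Tendsto (fun m : ℕ => ((2 : ℝ) ^ m)⁻¹) atTop (𝓝 0) :=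
    tendsto_inv_atTop_zero.comp (tendsto_pow_atTop_atTop_of_one_lt (by norm_num))
  have hle := le_of_tendsto_of_tendsto'
    ((hinv.const_sub (1 - ((2 : ℝ) ^ (h * (h - 1)))⁻¹)).const_mul (eulerProd 2))
    (tendsto_eulerPart.mul_const (1 - b)) key
  have := le_of_mul_le_mul_left hle eulerProd_two_pos
  linarith

end Refutation

end DetHypertree

end

theorem theorem1 :
    (∀ h : ℕ, 0 < h → ∀ᶠ n : ℕ in atTop,
      Real.exp (-(200 * (h : ℝ))) / (100 * (h : ℝ)) ^ (5 * h) ≤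
        DetHypertree.prob n fun S => h ≤ DetHypertree.bettiOne 2 S) ∧
    ¬ DetHypertree.RankPrediction 2 ∧
    ¬ DetHypertree.KahleNewman 2 ∧
    ¬ (∀ p : ℕ, p.Prime → DetHypertree.KahleNewman p) :=
  ⟨DetHypertree.eventually_le_prob, DetHypertree.not_rankPrediction_two,
    DetHypertree.not_kahleNewman_two,
    fun h => DetHypertree.not_kahleNewman_two (h 2 Nat.prime_two)⟩
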